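/- Let \(\Bbbk\) be a commutative ring. Let \(\square\) be the cube category with connections: its objects are the sets \(\mathbf 2^n=\{0,1\}^n\), \(n\ge 0\), and its morphisms are the maps generated under composition by the faces \(\delta^\epsilon_i\) (insert \(\epsilon\in\{0,1\}\) as \(i\)-th coordinate), the degeneracies \(\sigma_i\) (delete the \(i\)-th coordinate) and the connections \(\gamma_i\) (replace the \(i\)-th and \((i+1)\)-st coordinates by their minimum). A cubical set \(Y\) is a presheaf on \(\square\); write \(d^\epsilon_i,s_i,\gamma_i\) for the induced operators. The product \(Y\times Z\) of cubical sets has \((Y\times Z)_n=\bigsqcup_{k+l=n}Y_k\times Z_l/{\sim}\) with \((s_{k+1}y,z)\sim(y,s_1z)\), the structure maps acting on the first or second factor according to dimensions. A cubical monoid is a monoid \(Y\), with unit \(e\in Y_0\), with respect to this product, so that a \(k\)-cube \(y\) and an \(l\)-cube \(z\) have a product \(yz\in Y_{k+l}\). It is a cubical group if every cube \(y\) has an inverse \(z\), meaning that \(yz\) and \(zy\) are the iterated degeneracies of \(e\) in their dimension. Let \(\mathbb I^n\) be the \(n\)-th power of the simplicial interval \(\Delta^1\); its \(m\)-simplices are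 the weakly increasing sequences of \(m+1\) elements of \(\mathbf 2^n\). For \(\pi\in S_n\) let \(u_\pi\in\mathbb I^n\) be the \(n\)-simplex whose first vertex is \((0,\dots,0)\) and whose \((j+1)\)-st vertex is obtained from the \(j\)-th one by changing the coordinate \(\pi(j)\) to \(1\), \(1\le j\le n\). The triangulation of \(Y\) is the simplicial set \[ TY=\bigsqcup_{y\in Y}\mathbb I^{\dim y}\Big/\,(\lambda^*y,u)\sim(y,\lambda_*u)\quad\text{for all morphisms }\lambda\text{ of }\square, \] and \([y,u]\) denotes the class of \((y,u)\). Let \(C(Y)\) be the normalized cubical chains of \(Y\) over \(\Bbbk\) (modulo all \(s_iy\) and \(\gamma_iy\)), with differential \(dy=\sum_{i=1}^n(-1)^i(d^0_iy-d^1_iy)\), the Serre diagonal \[ \Delta y=\sum_{k+l=n}\ \sum_{(\alpha,\beta)}(-1)^{(\alpha,\beta)}\,d^0_{\beta_1}\cdots d^0_{\beta_l}y\otimes d^1_{\alpha_1}\cdots d^1_{\alpha_k}y \] over all \((k,l)\)-shuffles \((\alpha,\beta)\), and the augmentation sending every \(0\)-cube to \(1\). For a simplicial set \(X\) let \(C(X)\)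 be its normalized chains with the differential \(\sum_i(-1)^id_i\), the diagonal \(\Delta x=\sum_i x(0\dots i)\otimes x(i\dots n)\) and the augmentation sending every \(0\)-simplex to \(1\). If \(Y\) is a cubical monoid, then \(TY\) is canonically a simplicial monoid, with product \([y,v]\cdot[z,w]=[yz,(v,w)]\), where \((v,w)\in\mathbb I^k\times\mathbb I^l=\mathbb I^{k+l}\); if \(Y\) is a cubical group, then \(TY\) is a simplicial group. Moreover, \(C(Y)\), with the product induced by that of \(Y\), and \(C(TY)\), with the shuffle map followed by the map induced by the product of \(TY\), are dg bialgebras, and the map \[ t_Y\colon C(Y)\to C(TY),\qquad y\mapsto\sum_{\pi\in S_n}\operatorname{sgn}(\pi)\,[y,u_\pi]\quad(n=\dim y), \] is multiplicative and a quasi-isomorphism of dg bialgebras. -/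

import Mathlib

open CategoryTheory Opposite TensorProduct DirectSum
universe u v w

/-! ### The cube category with connections -/

namespace CubeMap

/-- The face map `δ^ε_i`, inserting the coordinate `ε` at position `i`. -/
def face {n : ℕ} (ε : Fin 2) (i : Fin (n + 1)) (t : Fin n → Fin 2) : Fin (n + 1) → Fin 2 :=
  i.insertNth ε t

/-- The degeneracy map `σ_i`, deleting the coordinate at position `i`. -/
def degen {n : ℕ} (i : Fin (n + 1)) (t : Fin (n + 1) → Fin 2) : Fin n → Fin 2 :=
  fun j => t (i.succAbove j)

/-- The connection map `γ_i`, replacing the coordinates at the adjacent positions `i` and `i + 1`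
by their minimum. (For `j < i` both arguments of `min` are `t j`, for `j > i` both
are `t (j + 1)`, and for `j = i` they are `t (i + 1)` and `t i`.) -/
def conn {n : ℕ} (i : Fin (n + 1)) (t : Fin (n + 2) → Fin 2) : Fin (n + 1) → Fin 2 :=
  fun j => min (t (i.castSucc.succAbove j)) (t (i.succ.succAbove j))

/-- The Cartesian product of two maps between sets `2^n`. -/
def prod {m n m' n' : ℕ} (f : (Fin m → Fin 2) → (Fin n → Fin 2))
    (g : (Fin m' → Fin 2) → (Fin n' → Fin 2)) (t : Fin (m + m') → Fin 2) : Fin (n + n') → Fin 2 :=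
  Fin.append (f fun i => t (Fin.castAdd m' i)) (g fun i => t (Fin.natAdd m i))

/-- The coordinate inclusion `2^m → 2^n` along an order embedding `e`,
all new coordinates being equal to `ε`. -/
noncomputable def incl {m n : ℕ} (e : Fin m ↪o Fin n) (ε : Fin 2) (t : Fin m → Fin 2) :
    Fin n → Fin 2 :=
  Function.extend e t fun _ => ε

end CubeMap

/-- The maps `2^m → 2^n` in the cube category with connections: they are generated under
composition by the maps `δ^ε_i`, `σ_i` and `γ_i`. -/
inductive IsCubeMap : ∀ {m n : ℕ}, ((Fin m → Fin 2) → (Fin n → Fin 2)) → Prop where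
  | id (n : ℕ) : IsCubeMap (id : (Fin n → Fin 2) → (Fin n → Fin 2))
  | comp {l m n : ℕ} {g : (Fin m → Fin 2) → (Fin n → Fin 2)}
      {f : (Fin l → Fin 2) → (Fin m → Fin 2)} :
      IsCubeMap g → IsCubeMap f → IsCubeMap (g ∘ f)
  | face {n : ℕ} (ε : Fin 2) (i : Fin (n + 1)) : IsCubeMap (CubeMap.face ε i)
  | degen {n : ℕ} (i : Fin (n + 1)) : IsCubeMap (CubeMap.degen i)
  | conn {n : ℕ} (i : Fin (n + 1)) : IsCubeMap (CubeMap.conn i)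

namespace IsCubeMap

theorem monotone {m n : ℕ} {f : (Fin m → Fin 2) → (Fin n → Fin 2)} (hf : IsCubeMap f) :
    Monotone f := by
  induction hf with
  | id n => exact monotone_id
  | comp _ _ hg hf => exact hg.comp hf
  | face ε i =>
    intro s t h j
    refine Fin.succAboveCases i ?_ (fun k => ?_) j
    · simp [CubeMap.face]
    · simpa [CubeMap.face] using h k
  | degen i => exact fun s t h j => h _
  | conn i => exact fun s t h j => min_le_min (h _) (h _)

theorem cast {m n : ℕ} (h : m = n) :
    IsCubeMap (fun (t : Fin m → Fin 2) (i : Fin n) => t (Fin.cast h.symm i)) := by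
  subst h; exact id _

/-- Relabelling along equalities of dimensions. -/
theorem relabel {m n m' n' : ℕ} {f : (Fin m → Fin 2) → (Fin n → Fin 2)} (hf : IsCubeMap f)
    (hm : m = m') (hn : n = n') :
    IsCubeMap (fun (t : Fin m' → Fin 2) (i : Fin n') =>
      f (fun j => t (Fin.cast hm j)) (Fin.cast hn.symm i)) := by
  subst hm hn; exact hf

end IsCubeMap

namespace CubeMap

theorem val_succAbove {n : ℕ} (i : Fin (n + 1)) (j : Fin n) :
    (i.succAbove j : ℕ) = if (j : ℕ) < i then (j : ℕ) else j + 1 := by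
  by_cases h : (j : ℕ) < i
  · rw [if_pos h, Fin.succAbove_of_castSucc_lt _ _ (by exact h)]; rfl
  · rw [if_neg h, Fin.succAbove_of_le_castSucc _ _ (by exact not_lt.1 h)]; rfl

theorem face_eq {n : ℕ} (ε : Fin 2) (i : Fin (n + 1)) (t : Fin n → Fin 2)
    (u : Fin (n + 1) → Fin 2) (h₁ : u i = ε) (h₂ : ∀ j, u (i.succAbove j) = t j) :
    face ε i t = u :=
  Fin.insertNth_eq_iff.2 ⟨h₁.symm, funext fun j => (h₂ j).symm⟩

end CubeMap

namespace IsCubeMap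

theorem prod_id {m n : ℕ} {f : (Fin m → Fin 2) → (Fin n → Fin 2)} (hf : IsCubeMap f) (l : ℕ) :
    IsCubeMap (CubeMap.prod f (fun t : Fin l → Fin 2 => t)) := by
  induction hf with
  | id n =>
    convert! IsCubeMap.id (n + l) using 1
    funext t j
    refine Fin.addCases (fun i => ?_) (fun i => ?_) j <;> simp [CubeMap.prod]
  | comp _ _ hg hf =>
    convert! comp hg hf using 1
    funext t j
    refine Fin.addCases (fun i => ?_) (fun i => ?_) j <;> simp [CubeMap.prod]
  | @face n ε i =>
    have key : CubeMap.prod (CubeMap.face ε i) (fun t : Fin l → Fin 2 => t) = fun t j =>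
        CubeMap.face (n := n + l) ε ⟨i, by omega⟩ t
          (Fin.cast (by omega : n + 1 + l = n + l + 1) j) := by
      funext t
      have := CubeMap.face_eq (n := n + l) ε ⟨i, by omega⟩ t
        (fun j => CubeMap.prod (CubeMap.face ε i) (fun t : Fin l → Fin 2 => t) t
          (Fin.cast (by omega : n + l + 1 = n + 1 + l) j)) ?_ ?_
      · rw [this]; rfl
      · have : Fin.cast (by omega : n + l + 1 = n + 1 + l) ⟨i, by omega⟩ = Fin.castAdd l i := rfl
        simp [this, CubeMap.prod, CubeMap.face]
      · intro j
        refine Fin.addCases (fun j => ?_) (fun j => ?_) j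
        · have : Fin.cast (by omega : n + l + 1 = n + 1 + l)
              (Fin.succAbove ⟨i, by omega⟩ (Fin.castAdd l j)) = Fin.castAdd l (i.succAbove j) := by
            ext; simp [CubeMap.val_succAbove]
          simp [this, CubeMap.prod, CubeMap.face]
        · have : Fin.cast (by omega : n + l + 1 = n + 1 + l)
              (Fin.succAbove ⟨i, by omega⟩ (Fin.natAdd n j)) = Fin.natAdd (n + 1) j := by
            ext
            have := i.2
            simp only [Fin.val_cast, CubeMap.val_succAbove, Fin.val_natAdd]
            rw [if_neg (by omega)]
            omega
          simp [this, CubeMap.prod]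
    rw [key]
    exact (face (n := n + l) ε ⟨i, by omega⟩).relabel rfl (by omega)
  | @degen n i =>
    have key : CubeMap.prod (CubeMap.degen i) (fun t : Fin l → Fin 2 => t) = fun t =>
        CubeMap.degen (n := n + l) ⟨i, by omega⟩
          (fun j => t (Fin.cast (by omega : n + l + 1 = n + 1 + l) j)) := by
      funext t j
      refine Fin.addCases (fun j => ?_) (fun j => ?_) j
      · simp only [CubeMap.prod, Fin.append_left, CubeMap.degen]
        congr 1
        ext; simp [CubeMap.val_succAbove]
      · simp only [CubeMap.prod, Fin.append_right, CubeMap.degen]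
        congr 1
        ext
        have := i.2
        simp only [Fin.val_cast, CubeMap.val_succAbove, Fin.val_natAdd]
        rw [if_neg (by omega)]
        omega
    rw [key]
    exact (degen (n := n + l) ⟨i, by omega⟩).relabel (by omega) rfl
  | @conn n i =>
    have key : CubeMap.prod (CubeMap.conn i) (fun t : Fin l → Fin 2 => t) = fun t j =>
        CubeMap.conn (n := n + l) ⟨i, by omega⟩
          (fun j => t (Fin.cast (by omega : n + l + 2 = n + 2 + l) j))
          (Fin.cast (by omega : n + 1 + l = n + l + 1) j) := by
      funext t j
      refine Fin.addCases (fun j => ?_) (fun j => ?_) j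
      · simp only [CubeMap.prod, Fin.append_left, CubeMap.conn]
        congr 2 <;> (ext; simp [CubeMap.val_succAbove])
      · simp only [CubeMap.prod, Fin.append_right, CubeMap.conn]
        have := i.2
        rw [eq_comm]
        convert! min_self _ using 3
        all_goals
          ext
          simp only [Fin.val_cast, CubeMap.val_succAbove, Fin.val_natAdd, Fin.val_castSucc,
            Fin.val_succ]
          split_ifs <;> omega
    rw [key]
    exact (conn (n := n + l) ⟨i, by omega⟩).relabel (by omega) (by omega)

theorem id_prod {m n : ℕ} {f : (Fin m → Fin 2) → (Fin n → Fin 2)} (hf : IsCubeMap f) (l : ℕ) :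
    IsCubeMap (CubeMap.prod (fun t : Fin l → Fin 2 => t) f) := by
  induction hf with
  | id n =>
    convert! IsCubeMap.id (l + n) using 1
    funext t j
    refine Fin.addCases (fun i => ?_) (fun i => ?_) j <;> simp [CubeMap.prod]
  | comp _ _ hg hf =>
    convert! comp hg hf using 1
    funext t j
    refine Fin.addCases (fun i => ?_) (fun i => ?_) j <;> simp [CubeMap.prod]
  | @face n ε i =>
    have key : CubeMap.prod (fun t : Fin l → Fin 2 => t) (CubeMap.face ε i) =
        CubeMap.face (n := l + n) ε (Fin.natAdd l i) := by
      funext t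
      refine (CubeMap.face_eq (n := l + n) ε (Fin.natAdd l i) t _ ?_ ?_).symm
      · exact (Fin.append_right _ _ _).trans (by simp [CubeMap.face])
      · intro j
        refine Fin.addCases (fun j => ?_) (fun j => ?_) j
        · have : Fin.succAbove (n := l + n) (Fin.natAdd l i) (Fin.castAdd n j) =
              Fin.castAdd (n + 1) j := by
            ext
            have := j.2
            simp only [CubeMap.val_succAbove, Fin.val_natAdd, Fin.val_castAdd]
            rw [if_pos (by omega)]
          rw [this]
          simp [CubeMap.prod]
        · have : Fin.succAbove (n := l + n) (Fin.natAdd l i) (Fin.natAdd l j) =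
              Fin.natAdd l (i.succAbove j) := by
            ext
            simp only [CubeMap.val_succAbove, Fin.val_natAdd, add_lt_add_iff_left]
            split_ifs <;> omega
          rw [this]
          simp [CubeMap.prod, CubeMap.face]
    rw [key]
    exact face ε _
  | @degen n i =>
    have key : CubeMap.prod (fun t : Fin l → Fin 2 => t) (CubeMap.degen i) =
        CubeMap.degen (n := l + n) (Fin.natAdd l i) := by
      funext t j
      refine Fin.addCases (fun j => ?_) (fun j => ?_) j
      · simp only [CubeMap.prod, Fin.append_left, CubeMap.degen]
        congr 1
        ext
        have := j.2
        simp only [CubeMap.val_succAbove, Fin.val_natAdd, Fin.val_castAdd]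
        rw [if_pos (by omega)]
      · simp only [CubeMap.prod, Fin.append_right, CubeMap.degen]
        congr 1
        ext
        simp only [CubeMap.val_succAbove, Fin.val_natAdd, add_lt_add_iff_left]
        split_ifs <;> omega
    rw [key]
    exact degen _
  | @conn n i =>
    have key : CubeMap.prod (fun t : Fin l → Fin 2 => t) (CubeMap.conn i) =
        CubeMap.conn (n := l + n) (Fin.natAdd l i) := by
      funext t j
      refine Fin.addCases (fun j => ?_) (fun j => ?_) j
      · simp only [CubeMap.prod, Fin.append_left, CubeMap.conn]
        have := j.2
        rw [eq_comm]
        convert! min_self _ using 3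
        all_goals
          ext
          simp only [CubeMap.val_succAbove, Fin.val_natAdd, Fin.val_castAdd, Fin.val_castSucc,
            Fin.val_succ]
          split_ifs <;> omega
      · simp only [CubeMap.prod, Fin.append_right, CubeMap.conn]
        congr 2
        all_goals
          ext
          simp only [CubeMap.val_succAbove, Fin.val_natAdd, Fin.val_castSucc, Fin.val_succ]
          split_ifs <;> omega
    rw [key]
    exact conn _

theorem prod {m n m' n' : ℕ} {f : (Fin m → Fin 2) → (Fin n → Fin 2)}
    {g : (Fin m' → Fin 2) → (Fin n' → Fin 2)} (hf : IsCubeMap f) (hg : IsCubeMap g) :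
    IsCubeMap (CubeMap.prod f g) := by
  have : CubeMap.prod f g = CubeMap.prod f (fun t : Fin n' → Fin 2 => t) ∘
      CubeMap.prod (fun t : Fin m → Fin 2 => t) g := by
    funext t j
    refine Fin.addCases (fun i => ?_) (fun i => ?_) j <;> simp [CubeMap.prod]
  rw [this]
  exact (hf.prod_id n').comp (hg.id_prod m)

theorem incl {m n : ℕ} (e : Fin m ↪o Fin n) (ε : Fin 2) : IsCubeMap (CubeMap.incl e ε) := by
  induction n with
  | zero =>
    obtain rfl : m = 0 := by
      have := Fintype.card_le_of_embedding e.toEmbedding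
      simpa using this
    convert! IsCubeMap.id 0 using 1
  | succ n ih =>
    by_cases h : ∃ i, i ∉ Set.range e
    · obtain ⟨i, hi⟩ := h
      have hne : ∀ j, e j ≠ i := fun j hj => hi ⟨j, hj⟩
      choose e' he' using fun j => Fin.exists_succAbove_eq (hne j)
      have hle : ∀ a b, e' a ≤ e' b ↔ a ≤ b := fun a b => by
        rw [← e.le_iff_le, ← he' a, ← he' b, Fin.succAbove_le_succAbove_iff]
      have key : CubeMap.incl e ε = CubeMap.face ε i ∘
          CubeMap.incl (OrderEmbedding.ofMapLEIff e' hle) ε := by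
        funext t
        refine (CubeMap.face_eq ε i _ _ ?_ ?_).symm
        · exact Function.extend_apply' _ _ _ hi
        · intro j
          by_cases hj : ∃ a, e' a = j
          · obtain ⟨a, rfl⟩ := hj
            have h1 := e.injective.extend_apply t (fun _ => ε) a
            have h2 := (OrderEmbedding.ofMapLEIff e' hle).injective.extend_apply t (fun _ => ε) a
            rw [← he'] at h1
            exact h1.trans h2.symm
          · refine (Function.extend_apply' _ _ _ ?_).trans
              (Function.extend_apply' (f := e') t (fun _ => ε) _ hj).symm
            rintro ⟨a, ha⟩
            exact hj ⟨a, Fin.succAbove_right_injective ((he' a).trans ha)⟩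
      rw [key]
      exact (face ε i).comp (ih _)
    · push Not at h
      have hs : Function.Surjective e := h
      obtain rfl : m = n + 1 := by
        simpa using Fintype.card_of_bijective ⟨e.injective, hs⟩
      have he : ∀ j, e j = j := fun j => by
        have := Subsingleton.elim (e.strictMono.orderIsoOfSurjective e hs) (OrderIso.refl _)
        exact DFunLike.congr_fun this j
      convert! IsCubeMap.id (n + 1) using 1
      funext t j
      have := e.injective.extend_apply t (fun _ => ε) j
      rw [he] at this
      exact this

theorem toZero (n : ℕ) : IsCubeMap (fun (_ : Fin n → Fin 2) (i : Fin 0) => i.elim0) := by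
  induction n with
  | zero =>
    convert! IsCubeMap.id 0 using 1
  | succ n ih => exact ih.comp (degen 0)

end IsCubeMap

/-- The cube category with connections; the object `⟨n⟩` is the set `2^n`. -/
structure Cube where
  /-- The dimension. -/
  dim : ℕ

namespace Cube

instance : Category Cube where
  Hom a b := {f : (Fin a.dim → Fin 2) → (Fin b.dim → Fin 2) // IsCubeMap f}
  id _ := ⟨id, .id _⟩
  comp f g := ⟨g.1 ∘ f.1, g.2.comp f.2⟩

/-- The morphism `δ^ε_i`. -/
def face {n : ℕ} (ε : Fin 2) (i : Fin (n + 1)) : (⟨n⟩ : Cube) ⟶ ⟨n + 1⟩ :=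
  ⟨CubeMap.face ε i, .face ε i⟩

/-- The morphism `σ_i`. -/
def degen {n : ℕ} (i : Fin (n + 1)) : (⟨n + 1⟩ : Cube) ⟶ ⟨n⟩ :=
  ⟨CubeMap.degen i, .degen i⟩

/-- The morphism `γ_i`. -/
def conn {n : ℕ} (i : Fin (n + 1)) : (⟨n + 2⟩ : Cube) ⟶ ⟨n + 1⟩ :=
  ⟨CubeMap.conn i, .conn i⟩

/-- The monoidal product of morphisms, i.e. the Cartesian product of maps. -/
def prod {m n m' n' : ℕ} (f : (⟨m⟩ : Cube) ⟶ ⟨n⟩) (g : (⟨m'⟩ : Cube) ⟶ ⟨n'⟩) :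
    (⟨m + m'⟩ : Cube) ⟶ ⟨n + n'⟩ :=
  ⟨CubeMap.prod f.1 g.1, f.2.prod g.2⟩

/-- The coordinate inclusion `2^{#s} → 2^n` for a set `s` of coordinates; the coordinates not
in `s` are set to `ε`. If `b_1 < ... < b_l` are the elements of the complement of `s`, this
is the iterated face map `δ^ε_{b_l} ∘ ... ∘ δ^ε_{b_1}`. -/
noncomputable def incl {n : ℕ} (s : Finset (Fin n)) (ε : Fin 2) : (⟨s.card⟩ : Cube) ⟶ ⟨n⟩ :=
  ⟨CubeMap.incl (s.orderEmbOfFin rfl) ε, .incl _ ε⟩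

/-- The unique map `2^n → 2^0`. -/
def toZero (n : ℕ) : (⟨n⟩ : Cube) ⟶ ⟨0⟩ :=
  ⟨fun _ i => i.elim0, .toZero n⟩

end Cube

/-! ### Cubical sets with connections and cubical monoids -/

/-- Cubical sets (with connections), as presheaves on the cube category. -/
abbrev CubicalSet : Type (u + 1) := Cubeᵒᵖ ⥤ Type u

namespace CubicalSet

/-- The set of `n`-cubes. -/
abbrev cubes (Y : CubicalSet.{u}) (n : ℕ) : Type u := Y.obj (op ⟨n⟩)

/-- The map `l^* : Y_n → Y_m` induced by a morphism `l : 2^m → 2^n`. -/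
def pull (Y : CubicalSet.{u}) {m n : ℕ} (l : (⟨m⟩ : Cube) ⟶ ⟨n⟩) (y : Y.cubes n) : Y.cubes m :=
  Y.map l.op y

/-- An `n`-cube is negligible if it is degenerate (of the form `s_i y`) or folded
(of the form `γ_i y`). -/
inductive IsNegligible (Y : CubicalSet.{u}) : ∀ n : ℕ, Y.cubes n → Prop where
  | degenerate {n : ℕ} (i : Fin (n + 1)) (y : Y.cubes n) :
      IsNegligible Y (n + 1) (Y.pull (Cube.degen i) y)
  | folded {n : ℕ} (i : Fin (n + 1)) (y : Y.cubes (n + 1)) :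
      IsNegligible Y (n + 2) (Y.pull (Cube.conn i) y)

end CubicalSet

/-- A cubical monoid: a monoid object in cubical sets with connections with respect to the
product `Y × Z` whose `n`-cubes are the classes `[y, z]` of pairs of a `k`-cube `y` and an `l`-cube
`z` with `k + l = n`, subject to `[s_{k+1} y, z] = [y, s_1 z]`, and whose structure maps act
on `y` or on `z` according to the dimensions. A morphism `Y × Y → Y` is the same as a family of maps
`Y_k × Y_l → Y_{k+l}`, `(y, z) ↦ y z`, with `(f^* y) (g^* z) = (f × g)^* (y z)` for all morphisms
`f` and `g` of the cube category. -/
structure CubicalMonoid (Y : CubicalSet.{u}) where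
  /-- The product of two cubes. -/
  mul : ∀ {k l : ℕ}, Y.cubes k → Y.cubes l → Y.cubes (k + l)
  /-- The unit `Cube^0 → Y`. -/
  one : Y.cubes 0
  mul_pull : ∀ {k k' l l' : ℕ} (f : (⟨k'⟩ : Cube) ⟶ ⟨k⟩) (g : (⟨l'⟩ : Cube) ⟶ ⟨l⟩)
    (y : Y.cubes k) (z : Y.cubes l),
    mul (Y.pull f y) (Y.pull g z) = Y.pull (Cube.prod f g) (mul y z)
  mul_assoc : ∀ {k l m : ℕ} (x : Y.cubes k) (y : Y.cubes l) (z : Y.cubes m),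
    (⟨_, mul (mul x y) z⟩ : Σ n, Y.cubes n) = ⟨_, mul x (mul y z)⟩
  one_mul : ∀ {k : ℕ} (y : Y.cubes k), (⟨_, mul one y⟩ : Σ n, Y.cubes n) = ⟨_, y⟩
  mul_one : ∀ {k : ℕ} (y : Y.cubes k), (⟨_, mul y one⟩ : Σ n, Y.cubes n) = ⟨_, y⟩

/-- A cubical monoid is a cubical group if every cube `y` has an inverse `z`: both `y z` and `z y`
are iterated degeneracies of the unit (products add dimensions, so equality with the unit is
understood up to degeneracies). -/
def CubicalMonoid.IsGroup {Y : CubicalSet.{u}} (M : CubicalMonoid Y) : Prop :=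
  ∀ (k : ℕ) (y : Y.cubes k), ∃ (l : ℕ) (z : Y.cubes l),
    M.mul y z = Y.pull (Cube.toZero _) M.one ∧ M.mul z y = Y.pull (Cube.toZero _) M.one

/-! ### Simplicial cubes and triangulation -/

/-- The `m`-simplices of the simplicial cube `𝕀^n`: weakly increasing sequences of `m + 1` vertices
in `2^n`, i.e. `n`-tuples of `m`-simplices in `Δ^1`. -/
abbrev CubeSimplex (n m : ℕ) : Type := Fin (m + 1) →o (Fin n → Fin 2)

namespace CubeSimplex

/-- The map `l_* : 𝕀^n → 𝕀^n'` induced by a morphism `l : 2^n → 2^n'`. -/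
def push {n n' m : ℕ} (l : (⟨n⟩ : Cube) ⟶ ⟨n'⟩) (u : CubeSimplex n m) : CubeSimplex n' m :=
  ⟨fun v => l.1 (u v), fun _ _ h => l.2.monotone (u.monotone h)⟩

/-- The pair `(v, w)` under the identification `𝕀^k × 𝕀^l = 𝕀^{k+l}`. -/
def pair {k l m : ℕ} (v : CubeSimplex k m) (w : CubeSimplex l m) : CubeSimplex (k + l) m :=
  ⟨fun a => Fin.append (v a) (w a), fun a b h j => by
    refine Fin.addCases (fun i => ?_) (fun i => ?_) j
    · simpa using v.monotone h i
    · simpa using w.monotone h i⟩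

/-- The `n`-simplex `u_π` of `𝕀^n`: passing from its `j`-th to its `(j+1)`-st vertex, the coordinate
`π j` changes from `0` to `1` (where `0 ≤ j < n`). -/
def ofPerm {n : ℕ} (π : Equiv.Perm (Fin n)) : CubeSimplex n n :=
  ⟨fun v i => if (π.symm i : ℕ) < v then 1 else 0, fun a b h i => by
    have hab : (a : ℕ) ≤ b := h
    dsimp only
    split_ifs
    · exact le_rfl
    · omega
    · exact Fin.zero_le _
    · exact le_rfl⟩

end CubeSimplex

namespace CubicalSet

/-- The identification `(l^* y, u) ∼ (y, l_* u)` on `m`-simplices of the disjoint union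
of the simplicial cubes `𝕀_y`. -/
inductive TriangRel (Y : CubicalSet.{u}) (m : ℕ) :
    (Σ n, Y.cubes n × CubeSimplex n m) → (Σ n, Y.cubes n × CubeSimplex n m) → Prop where
  | glue {n n' : ℕ} (l : (⟨n⟩ : Cube) ⟶ ⟨n'⟩) (y : Y.cubes n') (u : CubeSimplex n m) :
      TriangRel Y m ⟨n, Y.pull l y, u⟩ ⟨n', y, CubeSimplex.push l u⟩

/-- The triangulation `T Y` of a cubical set `Y`. -/
def triang (Y : CubicalSet.{u}) : SSet.{u} where
  obj m := Quot (TriangRel Y m.unop.len)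
  map θ := ↾(Quot.map (fun p => ⟨p.1, p.2.1, p.2.2.comp θ.unop.toOrderHom⟩) (by
    rintro _ _ ⟨l, y, u⟩
    exact TriangRel.glue l y (u.comp θ.unop.toOrderHom)))
  map_id m := by
    ext x
    induction x using Quot.ind
    rfl
  map_comp θ ψ := by
    ext x
    induction x using Quot.ind
    rfl

/-- The `m`-simplex `[y, u]` of `T Y`. -/
def simplex (Y : CubicalSet.{u}) {n m : ℕ} (y : Y.cubes n) (u : CubeSimplex n m) :
    Y.triang.obj (op (SimplexCategory.mk m)) :=
  Quot.mk _ ⟨n, y, u⟩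

end CubicalSet

/-! ### Simplicial monoids and groups -/

/-- The structure of a simplicial monoid on a simplicial set. -/
structure SimplicialMonoid (X : SSet.{u}) where
  /-- The product in each degree. -/
  mul : ∀ {n : SimplexCategoryᵒᵖ}, X.obj n → X.obj n → X.obj n
  /-- The unit in each degree. -/
  one : ∀ n : SimplexCategoryᵒᵖ, X.obj n
  mul_assoc : ∀ {n : SimplexCategoryᵒᵖ} (x y z : X.obj n), mul (mul x y) z = mul x (mul y z)
  one_mul : ∀ {n : SimplexCategoryᵒᵖ} (x : X.obj n), mul (one n) x = x
  mul_one : ∀ {n : SimplexCategoryᵒᵖ} (x : X.obj n), mul x (one n) = x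
  map_mul : ∀ {m n : SimplexCategoryᵒᵖ} (θ : m ⟶ n) (x y : X.obj m),
    X.map θ (mul x y) = mul (X.map θ x) (X.map θ y)
  map_one : ∀ {m n : SimplexCategoryᵒᵖ} (θ : m ⟶ n), X.map θ (one m) = one n

/-- A simplicial monoid is a simplicial group if every simplex has an inverse. -/
def SimplicialMonoid.IsGroup {X : SSet.{u}} (G : SimplicialMonoid X) : Prop :=
  ∀ (n : SimplexCategoryᵒᵖ) (x : X.obj n), ∃ y, G.mul x y = G.one n ∧ G.mul y x = G.one n

/-! ### Differential graded bialgebras -/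

section Graded

variable (k : Type v) [CommRing k] (A : ℕ → Type w) [∀ n, AddCommGroup (A n)]
  [∀ n, Module k (A n)]

/-- The sign involution `a ↦ (-1)^{|a|} a` of a graded module. -/
noncomputable def signInvolution : (⨁ n, A n) →ₗ[k] ⨁ n, A n :=
  DirectSum.lmap fun n => ((-1 : k) ^ n) • LinearMap.id

variable {A} in
/-- The total differential given by its components `A_{n+1} → A_n`. -/
noncomputable def totalDifferential (d : ∀ n, A (n + 1) →ₗ[k] A n) :
    (⨁ n, A n) →ₗ[k] ⨁ n, A n :=
  DirectSum.toModule k ℕ _ fun n =>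
    match n with
    | 0 => 0
    | n + 1 => DirectSum.lof k ℕ A n ∘ₗ d n

/-- The map `a ⊗ b ⊗ a' ⊗ b' ↦ (-1)^{|b||a'|} a ⊗ a' ⊗ b ⊗ b'`. -/
noncomputable def middleSwap :
    ((⨁ n, A n) ⊗[k] ⨁ n, A n) ⊗[k] ((⨁ n, A n) ⊗[k] ⨁ n, A n) →ₗ[k]
      ((⨁ n, A n) ⊗[k] ⨁ n, A n) ⊗[k] ((⨁ n, A n) ⊗[k] ⨁ n, A n) :=
  (TensorProduct.assoc k (⨁ n, A n) (⨁ n, A n) ((⨁ n, A n) ⊗[k] ⨁ n, A n)).symm.toLinearMap ∘ₗ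
    LinearMap.lTensor (⨁ n, A n)
      ((TensorProduct.assoc k (⨁ n, A n) (⨁ n, A n) (⨁ n, A n)).toLinearMap ∘ₗ
        LinearMap.rTensor (⨁ n, A n) (TensorProduct.gradedComm k A A).toLinearMap ∘ₗ
        (TensorProduct.assoc k (⨁ n, A n) (⨁ n, A n) (⨁ n, A n)).symm.toLinearMap) ∘ₗ
    (TensorProduct.assoc k (⨁ n, A n) (⨁ n, A n) ((⨁ n, A n) ⊗[k] ⨁ n, A n)).toLinearMap

/-- The structure of a (non-negatively graded) differential graded bialgebra over `k` on the graded
module `A`: a differential of degree `-1`, an associative unital product, and a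
coassociative counital diagonal, such that `A` is a dg algebra and a dg coalgebra and
diagonal and augmentation are morphisms of algebras. The usual sign rule is used
for tensor products. -/
structure DGBialgebra where
  /-- The differential. -/
  d : ∀ n, A (n + 1) →ₗ[k] A n
  /-- The product. -/
  mul : (⨁ n, A n) →ₗ[k] (⨁ n, A n) →ₗ[k] ⨁ n, A n
  /-- The unit. -/
  one : ⨁ n, A n
  /-- The diagonal. -/
  comul : (⨁ n, A n) →ₗ[k] (⨁ n, A n) ⊗[k] ⨁ n, A n
  /-- The augmentation. -/
  counit : (⨁ n, A n) →ₗ[k] k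
  d_comp_d : ∀ n, d n ∘ₗ d (n + 1) = 0
  mul_degree : ∀ (p q : ℕ) (a : A p) (b : A q),
    mul (DirectSum.lof k ℕ A p a) (DirectSum.lof k ℕ A q b) ∈
      LinearMap.range (DirectSum.lof k ℕ A (p + q))
  one_degree : one ∈ LinearMap.range (DirectSum.lof k ℕ A 0)
  comul_degree : ∀ (n : ℕ) (a : A n),
    comul (DirectSum.lof k ℕ A n a) ∈ ⨆ p : {p : ℕ × ℕ // p.1 + p.2 = n}, LinearMap.range
      (TensorProduct.map (DirectSum.lof k ℕ A p.1.1) (DirectSum.lof k ℕ A p.1.2))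
  counit_degree : ∀ (n : ℕ) (a : A (n + 1)), counit (DirectSum.lof k ℕ A (n + 1) a) = 0
  mul_assoc : ∀ a b c, mul (mul a b) c = mul a (mul b c)
  one_mul : ∀ a, mul one a = a
  mul_one : ∀ a, mul a one = a
  coassoc : ∀ a, TensorProduct.assoc k _ _ _ (comul.rTensor (⨁ n, A n) (comul a)) =
    comul.lTensor (⨁ n, A n) (comul a)
  counit_comul : ∀ a, counit.rTensor (⨁ n, A n) (comul a) = 1 ⊗ₜ[k] a
  comul_counit : ∀ a, counit.lTensor (⨁ n, A n) (comul a) = a ⊗ₜ[k] 1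
  comul_mul : ∀ a b, comul (mul a b) =
    TensorProduct.map (TensorProduct.lift mul) (TensorProduct.lift mul)
      (middleSwap k A (comul a ⊗ₜ[k] comul b))
  comul_one : comul one = one ⊗ₜ[k] one
  counit_mul : ∀ a b, counit (mul a b) = counit a * counit b
  counit_one : counit one = 1
  d_mul : ∀ a b, totalDifferential k d (mul a b) =
    mul (totalDifferential k d a) b + mul (signInvolution k A a) (totalDifferential k d b)
  d_comul : ∀ a, comul (totalDifferential k d a) =
    (totalDifferential k d).rTensor (⨁ n, A n) (comul a) +
      TensorProduct.map (signInvolution k A) (totalDifferential k d) (comul a)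
  counit_d : ∀ a, counit (totalDifferential k d a) = 0

end Graded

namespace DGBialgebra

variable {k : Type v} [CommRing k] {A B : ℕ → Type w} [∀ n, AddCommGroup (A n)]
  [∀ n, Module k (A n)] [∀ n, AddCommGroup (B n)] [∀ n, Module k (B n)]

/-- The underlying chain complex. -/
noncomputable def complex (S : DGBialgebra k A) : ChainComplex (ModuleCat.{w} k) ℕ :=
  ChainComplex.of (fun n => ModuleCat.of k (A n)) (fun n => ModuleCat.ofHom (S.d n)) fun n => by
    rw [← ModuleCat.ofHom_comp, S.d_comp_d]; rfl

/-- Morphisms of dg bialgebras: maps of degree `0` compatible with differentials, products, units,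
diagonals and augmentations. -/
structure Hom (S : DGBialgebra k A) (T : DGBialgebra k B) where
  /-- The components of the map. -/
  f : ∀ n, A n →ₗ[k] B n
  comm_d : ∀ n, f n ∘ₗ S.d n = T.d n ∘ₗ f (n + 1)
  map_mul : ∀ a b, DirectSum.lmap f (S.mul a b) = T.mul (DirectSum.lmap f a) (DirectSum.lmap f b)
  map_one : DirectSum.lmap f S.one = T.one
  map_comul : ∀ a, T.comul (DirectSum.lmap f a) =
    TensorProduct.map (DirectSum.lmap f) (DirectSum.lmap f) (S.comul a)
  map_counit : ∀ a, T.counit (DirectSum.lmap f a) = S.counit a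

/-- The underlying chain map of a morphism of dg bialgebras. -/
noncomputable def Hom.chainMap {S : DGBialgebra k A} {T : DGBialgebra k B} (φ : Hom S T) :
    S.complex ⟶ T.complex :=
  ChainComplex.ofHom (fun n => ModuleCat.ofHom (φ.f n)) fun n => by
    simp only [complex, ChainComplex.of_d, ← ModuleCat.ofHom_comp, φ.comm_d]

end DGBialgebra

/-! ### Normalized chains -/

/-- The sign of the shuffle given by a subset `α` of an `n`-element set and its complement `β`:
the sign of the permutation sending `(1, ..., n)` to `(α_1, ..., α_k, β_1, ..., β_l)`. -/
def shuffleSign {n : ℕ} (α : Finset (Fin n)) : ℤ :=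
  Equiv.Perm.sign ((finCongr (by simp)).trans
    (finSumFinEquiv.symm.trans (finSumEquivOfFinset (rfl : α.card = α.card) rfl)))

/-- The monotone map from `{0, ..., n}` to `{0, ..., p}` for a `p`-element set `α` of steps:
it increases by one at the steps in `α` and is constant at the other ones. If `b_1 < ... < b_l` are
the steps not in `α` (numbered from `1`), the induced map of simplices
is `s_{b_l - 1} ... s_{b_1 - 1}`. -/
def collapse {n p : ℕ} (α : Finset (Fin n)) (h : α.card = p) :
    SimplexCategory.mk n ⟶ SimplexCategory.mk p :=
  SimplexCategory.mkHom
    ⟨fun v => ⟨(α.filter fun i : Fin n => (i : ℕ) < v).card,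
      Nat.lt_succ_of_le ((Finset.card_filter_le _ _).trans h.le)⟩,
      fun _ _ hab => Finset.card_le_card
        (Finset.monotone_filter_right _ fun _ _ hi => lt_of_lt_of_le hi hab)⟩

section Chains

variable (k : Type v) [CommRing k]

namespace CubicalSet

/-- The normalized chains of degree `n` of a cubical set: the free module on the `n`-cubes modulo
the degenerate and folded ones. -/
abbrev Chains (Y : CubicalSet.{u}) (n : ℕ) : Type (max u v) :=
  (Y.cubes n →₀ k) ⧸ Submodule.span k {c | ∃ y, Y.IsNegligible n y ∧ c = Finsupp.single y (1 : k)}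

/-- The class of a cube in the normalized chains. -/
noncomputable def chain (Y : CubicalSet.{u}) {n : ℕ} (y : Y.cubes n) : Y.Chains k n :=
  Submodule.Quotient.mk (Finsupp.single y (1 : k))

/-- The class of a cube in the total module of normalized chains. -/
noncomputable def totalChain (Y : CubicalSet.{u}) {n : ℕ} (y : Y.cubes n) : ⨁ n, Y.Chains k n :=
  DirectSum.lof k ℕ (Y.Chains k) n (Y.chain k y)

end CubicalSet

/-- The normalized chains of degree `n` of a simplicial set: the free module on the `n`-simplices
modulo the degenerate ones. -/
abbrev SSet.NormalizedChains (X : SSet.{u}) (n : ℕ) : Type (max u v) :=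
  (X.obj (op (SimplexCategory.mk n)) →₀ k) ⧸
    Submodule.span k {c | ∃ x ∈ X.degenerate n, c = Finsupp.single x (1 : k)}

/-- The class of a simplex in the normalized chains. -/
noncomputable def SSet.chain (X : SSet.{u}) {n : ℕ} (x : X.obj (op (SimplexCategory.mk n))) :
    X.NormalizedChains k n :=
  Submodule.Quotient.mk (Finsupp.single x (1 : k))

/-- The class of a simplex in the total module of normalized chains. -/
noncomputable def SSet.totalChain (X : SSet.{u}) {n : ℕ}
    (x : X.obj (op (SimplexCategory.mk n))) : ⨁ n, X.NormalizedChains k n :=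
  DirectSum.lof k ℕ (X.NormalizedChains k) n (X.chain k x)

variable {k}

/-- The dg bialgebra of normalized chains on a cubical monoid: the differential is
`d y = ∑_{1 ≤ i ≤ n} (-1)^i (d^0_i y - d^1_i y)`, the product and the unit are induced by those
of the monoid, `Δ` is the Serre diagonal and the augmentation sends each `0`-cube to `1`.
(These formulas on generators determine all structure maps.) -/
structure CubicalMonoid.IsChainBialgebra {Y : CubicalSet.{u}} (M : CubicalMonoid Y)
    (S : DGBialgebra k (Y.Chains k)) : Prop where
  d_apply : ∀ (n : ℕ) (y : Y.cubes (n + 1)), S.d n (Y.chain k y) =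
    ∑ i : Fin (n + 1), (-1 : ℤ) ^ ((i : ℕ) + 1) •
      (Y.chain k (Y.pull (Cube.face 0 i) y) - Y.chain k (Y.pull (Cube.face 1 i) y))
  mul_apply : ∀ (p q : ℕ) (y : Y.cubes p) (z : Y.cubes q),
    S.mul (Y.totalChain k y) (Y.totalChain k z) = Y.totalChain k (M.mul y z)
  one_eq : S.one = Y.totalChain k M.one
  comul_apply : ∀ (n : ℕ) (y : Y.cubes n), S.comul (Y.totalChain k y) =
    ∑ α : Finset (Fin n), shuffleSign α •
      (Y.totalChain k (Y.pull (Cube.incl α 0) y) ⊗ₜ[k]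
        Y.totalChain k (Y.pull (Cube.incl αᶜ 1) y))
  counit_apply : ∀ y : Y.cubes 0, S.counit (Y.totalChain k y) = 1

/-- The dg bialgebra of normalized chains on a simplicial monoid: the differential is
`d x = ∑_{0 ≤ i ≤ n} (-1)^i d_i x`, the product is the shuffle map `C(X) ⊗ C(X) → C(X × X)`
followed by the map induced by the product of the monoid, `Δ x = ∑_i x(0...i) ⊗ x(i...n)` and
the augmentation sends each `0`-simplex to `1`.
(These formulas on generators determine all structure maps.) -/
structure SimplicialMonoid.IsChainBialgebra {X : SSet.{u}} (G : SimplicialMonoid X)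
    (S : DGBialgebra k (X.NormalizedChains k)) : Prop where
  d_apply : ∀ (n : ℕ) (x : X.obj (op (SimplexCategory.mk (n + 1)))), S.d n (X.chain k x) =
    ∑ i : Fin (n + 2), (-1 : ℤ) ^ (i : ℕ) • X.chain k (X.map (SimplexCategory.δ i).op x)
  mul_apply : ∀ (p q : ℕ) (x : X.obj (op (SimplexCategory.mk p)))
    (y : X.obj (op (SimplexCategory.mk q))),
    S.mul (X.totalChain k x) (X.totalChain k y) =
      ∑ α : {α : Finset (Fin (p + q)) // α.card = p}, shuffleSign α.1 •
        X.totalChain k (G.mul (X.map (collapse α.1 α.2).op x)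
          (X.map (collapse α.1ᶜ (by simp [Finset.card_compl, α.2])).op y))
  one_eq : S.one = X.totalChain k (G.one (op (SimplexCategory.mk 0)))
  comul_apply : ∀ (n : ℕ) (x : X.obj (op (SimplexCategory.mk n))),
    S.comul (X.totalChain k x) =
      ∑ i : Fin (n + 1),
        X.totalChain k (X.map (SimplexCategory.subinterval 0 i (by omega)).op x) ⊗ₜ[k]
        X.totalChain k (X.map (SimplexCategory.subinterval i (n - i) (by omega)).op x)
  counit_apply : ∀ x : X.obj (op (SimplexCategory.mk 0)), S.counit (X.totalChain k x) = 1

end Chains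

/-!
The product of `TY` is given by the stated formula; it respects the identifications because the
morphisms of the cube category act on the first or second factor of `2^{k+l}`, and inverses in `Y`
give inverses in `TY` (`CubicalMonoid.triangMonoid`, `CubicalMonoid.triangMonoid_isGroup`).

*Singular cubes.* A map `c : 𝕀^n → X` of simplicial sets carries the chain
`E(c) = ∑_π sgn(π) c(u_π)` (`SingularCube.chain`). In its boundary the inner faces cancel in pairs
(`SingularCube.chainD_chain`). Writing a permutation as a shuffle composed with permutations of two
blocks shows that `E` turns products of singular cubes into shuffle products
(`SimplicialMonoid.chainMul_totalChain`) and the Serre diagonal into the Alexander-Whitney diagonal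
(`SingularCube.chainComul_totalChain`). Moreover, every simplex is, up to degenerate ones, the chain
of a singular cube, namely of its composition with the map `𝕀^n → Δ^n` counting leading ones
(`SSet.totalChain_toCube`). Those axioms of a dg bialgebra for `C(X)` that involve the shuffle
product therefore reduce to evident identities between singular cubes, without any manipulation of
shuffles of shuffles (`SimplicialMonoid.chainBialgebra`). A cube `y` of `Y` is a singular cube
of `TY`. As `E` kills degeneracies and connections (`SingularCube.chain_comp_degen`,
`SingularCube.chain_comp_conn`), this defines `t_Y` (`CubicalSet.triangChain`).

*A retraction.* The Alexander-Whitney map of the `n`-fold product `𝕀^n` sends an `m`-simplex `s` to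
the sum of the `m`-dimensional faces of the cube with interior coordinates `i_1 < ... < i_m` such
that the coordinate `i_v` changes in the `v`-th step of `s`; a coordinate between `i_v` and
`i_{v+1}` has the value that it has at the vertex `v` of `s`. Up to degeneracies and connections
this is natural for all morphisms of the cube category (`pathSum_push`), hence gives a map `g` from
`C(TY)` to `C(Y)` (`CubicalSet.cubicalChain`). Only `u_π` with `π = 1` contributes to `g t_Y`, and
therefore `g t_Y = 1` (`CubicalSet.cubicalChain_triangChain`). So `C(Y)` is a retract of `C(TY)`,
and by the identities for singular cubes its image is closed under all operations. This transfers
the axioms of a dg bialgebra from `C(TY)` to `C(Y)`, and `t_Y` is a morphism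
(`DGBialgebra.RetractData.bialgebra`, `CubicalMonoid.retractData`).

*A homotopy.* The Alexander-Whitney map is compatible with boundaries (`pathSum_faceBoundary`), and
so is the endomorphism of the chains of `𝕀^n` which is this map followed by `E`. As `𝕀^n` is
contracted by cones, there is a homotopy from the identity to this endomorphism
(`cubeSSet.chainD_homotopy`). Taking the first vertex of each simplex as the apex of the cone makes
the homotopy natural in the cube (`cubeSSet.homotopy_pushChain`), so that it descends to a homotopy
between `1` and `t_Y g` on `C(TY)` (`CubicalSet.triangHomotopy`). Hence `t_Y` is a homotopy
equivalence of complexes (`CubicalMonoid.quasiIso_triangHom`).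
-/

/-! ### Free modules modulo a set of generators -/

section FreeQuotient

variable {k : Type v} [CommRing k]

/-- The free module on `S` modulo the generators satisfying `P`. The two kinds of normalized chains
unfold to modules of this form. This is not an abbreviation so that the additive structure of a
direct sum of such modules is always found through `AddCommGroup`. -/
def FreeQuotient (k : Type v) [CommRing k] {S : Type u} (P : S → Prop) : Type (max u v) :=
  (S →₀ k) ⧸ Submodule.span k {c | ∃ x, P x ∧ c = Finsupp.single x (1 : k)}

namespace FreeQuotient

variable {S : Type u} {P : S → Prop} {V : Type w} [AddCommGroup V] [Module k V]

noncomputable instance : AddCommGroup (FreeQuotient k P) :=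
  inferInstanceAs (AddCommGroup ((S →₀ k) ⧸
    Submodule.span k {c | ∃ x, P x ∧ c = Finsupp.single x (1 : k)}))

noncomputable instance : Module k (FreeQuotient k P) :=
  inferInstanceAs (Module k ((S →₀ k) ⧸
    Submodule.span k {c | ∃ x, P x ∧ c = Finsupp.single x (1 : k)}))

/-- The class of a generator. -/
noncomputable def gen (k : Type v) [CommRing k] (P : S → Prop) (x : S) : FreeQuotient k P :=
  Submodule.Quotient.mk (Finsupp.single x (1 : k))

theorem gen_eq_zero {x : S} (h : P x) : gen k P x = 0 :=
  (Submodule.Quotient.mk_eq_zero _).2 (Submodule.subset_span ⟨x, h, rfl⟩)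

/-- The linear map determined by its values on generators. -/
noncomputable def lift (φ : S → V) (h : ∀ x, P x → φ x = 0) : FreeQuotient k P →ₗ[k] V :=
  Submodule.liftQ _ (Finsupp.linearCombination k φ) (by
    rw [Submodule.span_le]
    rintro _ ⟨x, hx, rfl⟩
    simp [h x hx])

@[simp]
theorem lift_gen (φ : S → V) (h : ∀ x, P x → φ x = 0) (x : S) :
    lift φ h (gen k P x) = φ x := by
  unfold lift gen
  erw [Submodule.liftQ_apply]
  simp

theorem hom_ext {f g : FreeQuotient k P →ₗ[k] V} (h : ∀ x, f (gen k P x) = g (gen k P x)) :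
    f = g := by
  apply Submodule.linearMap_qext
  apply Finsupp.lhom_ext'
  intro x
  ext
  exact h x

theorem mem_of_gen_mem (p : Submodule k (FreeQuotient k P)) (h : ∀ x, gen k P x ∈ p)
    (a : FreeQuotient k P) : a ∈ p := by
  have : p.mkQ = 0 := hom_ext fun x => by
    simpa using h x
  simpa using LinearMap.congr_fun this a

end FreeQuotient

namespace GradedFreeQuotient

variable {S : ℕ → Type u} {P : ∀ n, S n → Prop} {V : Type w} [AddCommGroup V] [Module k V]

/-- The class of a generator in the total module. -/
noncomputable def gen (k : Type v) [CommRing k] (P : ∀ n, S n → Prop) (n : ℕ) (x : S n) :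
    ⨁ n, FreeQuotient k (P n) :=
  DirectSum.lof k ℕ (fun n => FreeQuotient k (P n)) n (FreeQuotient.gen k (P n) x)

/-- The linear map on the total module determined by its values on generators. -/
noncomputable def lift (φ : ∀ n, S n → V) (h : ∀ n x, P n x → φ n x = 0) :
    (⨁ n, FreeQuotient k (P n)) →ₗ[k] V :=
  DirectSum.toModule k ℕ V fun n => FreeQuotient.lift (φ n) (h n)

@[simp]
theorem lift_gen (φ : ∀ n, S n → V) (h : ∀ n x, P n x → φ n x = 0) (n : ℕ) (x : S n) :
    lift φ h (gen k P n x) = φ n x := by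
  simp [lift, gen]

theorem hom_ext {f g : (⨁ n, FreeQuotient k (P n)) →ₗ[k] V}
    (h : ∀ n x, f (gen k P n x) = g (gen k P n x)) : f = g :=
  DirectSum.linearMap_ext k fun n => FreeQuotient.hom_ext (h n)

end GradedFreeQuotient

end FreeQuotient

/-! ### Linear maps out of normalized chains -/

section ChainMaps

variable {k : Type v} [CommRing k] {V : Type w} [AddCommGroup V] [Module k V]

namespace SSet

variable {X : SSet.{u}}

variable (k X) in
/-- The normalized chains of degree `n` of a simplicial set; this unfolds to
`SSet.NormalizedChains`. -/
abbrev NChains (n : ℕ) : Type (max u v) :=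
  FreeQuotient k fun x : X.obj (op (SimplexCategory.mk n)) => x ∈ X.degenerate n

variable (k) in
/-- The class of a simplex in the normalized chains. -/
noncomputable def cell {n : ℕ} (x : X.obj (op (SimplexCategory.mk n))) : X.NChains k n :=
  FreeQuotient.gen k _ x

variable (k) in
/-- The class of a simplex in the total module of normalized chains. -/
noncomputable def totalCell {n : ℕ} (x : X.obj (op (SimplexCategory.mk n))) :
    ⨁ n, X.NChains k n :=
  DirectSum.lof k ℕ (X.NChains k) n (cell k x)

theorem cell_eq_zero {n : ℕ} {x : X.obj (op (SimplexCategory.mk n))} (h : x ∈ X.degenerate n) :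
    cell k x = 0 :=
  FreeQuotient.gen_eq_zero (P := (· ∈ X.degenerate n)) h

theorem totalCell_eq_zero {n : ℕ} {x : X.obj (op (SimplexCategory.mk n))}
    (h : x ∈ X.degenerate n) : totalCell k x = 0 := by
  rw [totalCell, cell_eq_zero h, map_zero]

/-- The linear map on normalized chains of degree `n` determined by its values on simplices. -/
noncomputable def chainLift {n : ℕ} (φ : X.obj (op (SimplexCategory.mk n)) → V)
    (h : ∀ x ∈ X.degenerate n, φ x = 0) : X.NChains k n →ₗ[k] V :=
  FreeQuotient.lift (P := (· ∈ X.degenerate n)) φ h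

@[simp]
theorem chainLift_cell {n : ℕ} (φ : X.obj (op (SimplexCategory.mk n)) → V)
    (h : ∀ x ∈ X.degenerate n, φ x = 0) (x) : chainLift φ h (cell k x) = φ x :=
  FreeQuotient.lift_gen (P := (· ∈ X.degenerate n)) φ h x

/-- The linear map on all normalized chains determined by its values on simplices. -/
noncomputable def totalLift (φ : ∀ n, X.obj (op (SimplexCategory.mk n)) → V)
    (h : ∀ n, ∀ x ∈ X.degenerate n, φ n x = 0) : (⨁ n, X.NChains k n) →ₗ[k] V :=
  GradedFreeQuotient.lift (P := fun n x => x ∈ X.degenerate n) φ h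

@[simp]
theorem totalLift_totalCell (φ : ∀ n, X.obj (op (SimplexCategory.mk n)) → V)
    (h : ∀ n, ∀ x ∈ X.degenerate n, φ n x = 0) {n : ℕ} (x : X.obj (op (SimplexCategory.mk n))) :
    totalLift φ h (totalCell k x) = φ n x :=
  GradedFreeQuotient.lift_gen (P := fun n x => x ∈ X.degenerate n) φ h n x

theorem chain_hom_ext {n : ℕ} {f g : X.NChains k n →ₗ[k] V}
    (h : ∀ x, f (cell k x) = g (cell k x)) : f = g :=
  FreeQuotient.hom_ext (P := (· ∈ X.degenerate n)) h

theorem total_hom_ext {f g : (⨁ n, X.NChains k n) →ₗ[k] V}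
    (h : ∀ n (x : X.obj (op (SimplexCategory.mk n))),
      f (totalCell k x) = g (totalCell k x)) : f = g :=
  GradedFreeQuotient.hom_ext (P := fun n x => x ∈ X.degenerate n) h

theorem mem_of_cell_mem {n : ℕ} (p : Submodule k (X.NChains k n))
    (h : ∀ x, cell k x ∈ p) (a) : a ∈ p :=
  FreeQuotient.mem_of_gen_mem (P := (· ∈ X.degenerate n)) p h a

end SSet

namespace CubicalSet

variable {Y : CubicalSet.{u}}

variable (k Y) in
/-- The normalized chains of degree `n` of a cubical set; this unfolds to
`CubicalSet.Chains`. -/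
abbrev NChains (n : ℕ) : Type (max u v) := FreeQuotient k (Y.IsNegligible n)

variable (k) in
/-- The class of a cube in the normalized chains. -/
noncomputable def cell {n : ℕ} (y : Y.cubes n) : Y.NChains k n := FreeQuotient.gen k _ y

variable (k) in
/-- The class of a cube in the total module of normalized chains. -/
noncomputable def totalCell {n : ℕ} (y : Y.cubes n) : ⨁ n, Y.NChains k n :=
  DirectSum.lof k ℕ (Y.NChains k) n (cell k y)

theorem cell_eq_zero {n : ℕ} {y : Y.cubes n} (h : Y.IsNegligible n y) : cell k y = 0 :=
  FreeQuotient.gen_eq_zero (P := Y.IsNegligible n) h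

/-- The linear map on normalized cubical chains of degree `n` determined by its values on cubes. -/
noncomputable def chainLift {n : ℕ} (φ : Y.cubes n → V)
    (h : ∀ y, Y.IsNegligible n y → φ y = 0) : Y.NChains k n →ₗ[k] V :=
  FreeQuotient.lift φ h

@[simp]
theorem chainLift_cell {n : ℕ} (φ : Y.cubes n → V)
    (h : ∀ y, Y.IsNegligible n y → φ y = 0) (y) : chainLift φ h (cell k y) = φ y :=
  FreeQuotient.lift_gen φ h y

theorem chain_hom_ext {n : ℕ} {f g : Y.NChains k n →ₗ[k] V}
    (h : ∀ y, f (cell k y) = g (cell k y)) : f = g :=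
  FreeQuotient.hom_ext h

theorem total_hom_ext {f g : (⨁ n, Y.NChains k n) →ₗ[k] V}
    (h : ∀ n (y : Y.cubes n), f (totalCell k y) = g (totalCell k y)) : f = g :=
  GradedFreeQuotient.hom_ext (P := Y.IsNegligible) h

end CubicalSet

end ChainMaps

/-! ### Degenerate simplices and the differential of normalized chains -/

namespace SSet

variable {X : SSet.{u}}

/-- The simplex `x ∘ f` obtained from a simplex `x` by a monotone map `f` of vertices. -/
def restrict {p n : ℕ} (x : X.obj (op (SimplexCategory.mk p)))
    (f : Fin (n + 1) →o Fin (p + 1)) : X.obj (op (SimplexCategory.mk n)) :=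
  X.map (SimplexCategory.mkHom f).op x

theorem restrict_restrict {p n m : ℕ} (x : X.obj (op (SimplexCategory.mk p)))
    (f : Fin (n + 1) →o Fin (p + 1)) (g : Fin (m + 1) →o Fin (n + 1)) :
    restrict (restrict x f) g = restrict x (f.comp g) := by
  have : SimplexCategory.mkHom (f.comp g) = SimplexCategory.mkHom g ≫ SimplexCategory.mkHom f := rfl
  rw [restrict, restrict, restrict, this, op_comp, X.map_comp]
  rfl

theorem restrict_id {p : ℕ} (x : X.obj (op (SimplexCategory.mk p))) :
    restrict x OrderHom.id = x := by
  have : SimplexCategory.mkHom (OrderHom.id : Fin (p + 1) →o Fin (p + 1)) = 𝟙 _ := rfl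
  rw [restrict, this, op_id, X.map_id]
  rfl

/-- The monotone self-map of `{0, ..., n}` moving `i` to `i + 1` and fixing all other elements.
A simplex is degenerate if and only if it is invariant under one of these maps. -/
def stepHom {n : ℕ} (i : Fin n) : Fin (n + 1) →o Fin (n + 1) where
  toFun v := if v = i.castSucc then i.succ else v
  monotone' a b h := by
    have h' : (a : ℕ) ≤ b := h
    dsimp only
    split_ifs with ha hb hb
    · exact le_rfl
    · have : (b : ℕ) ≠ i := fun e => hb (Fin.ext e)
      subst ha
      refine Fin.le_def.2 ?_
      simp only [Fin.val_castSucc, Fin.val_succ] at h' ⊢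
      omega
    · subst hb
      refine Fin.le_def.2 ?_
      simp only [Fin.val_castSucc, Fin.val_succ] at h' ⊢
      omega
    · exact h

theorem stepHom_apply {n : ℕ} (i : Fin n) (v : Fin (n + 1)) :
    stepHom i v = if v = i.castSucc then i.succ else v := rfl

theorem mem_degenerate_of_restrict_eq {n : ℕ} {x : X.obj (op (SimplexCategory.mk n))}
    (i : Fin n) (h : restrict x (stepHom i) = x) : x ∈ X.degenerate n := by
  cases n with
  | zero => exact i.elim0
  | succ n =>
    rw [SSet.degenerate_eq_iUnion_range_σ, Set.mem_iUnion]
    refine ⟨i, restrict x (i.castSucc.succAboveOrderEmb.toOrderHom), ?_⟩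
    have key : stepHom i =
        (i.castSucc.succAboveOrderEmb.toOrderHom).comp i.predAboveOrderHom := by
      ext v : 2
      rw [stepHom_apply]
      split_ifs with hv
      · subst hv
        simp
      · exact (Fin.succAbove_predAbove hv).symm
    conv_rhs => rw [← h, key]
    exact restrict_restrict x _ i.predAboveOrderHom

theorem exists_restrict_of_mem_degenerate {n : ℕ} {x : X.obj (op (SimplexCategory.mk (n + 1)))}
    (h : x ∈ X.degenerate (n + 1)) :
    ∃ (i : Fin (n + 1)) (y : X.obj (op (SimplexCategory.mk n))),
      x = restrict y i.predAboveOrderHom := by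
  rw [SSet.degenerate_eq_iUnion_range_σ, Set.mem_iUnion] at h
  obtain ⟨i, y, rfl⟩ := h
  exact ⟨i, y, rfl⟩

theorem not_mem_degenerate_zero {x : X.obj (op (SimplexCategory.mk 0))} :
    x ∉ X.degenerate 0 := by
  simp

theorem comp_stepHom {n : ℕ} {α : Type*} [PartialOrder α] (f : Fin (n + 1) →o α)
    (i : Fin n) (h : f i.castSucc = f i.succ) : f.comp (stepHom i) = f := by
  ext v : 2
  simp only [OrderHom.comp_coe, Function.comp_apply, stepHom_apply]
  split_ifs with hv
  · rw [hv, h]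
  · rfl

theorem exists_step_eq {n : ℕ} {α : Type*} [PartialOrder α] (f : Fin (n + 1) →o α)
    (h : ¬ Function.Injective f) : ∃ i : Fin n, f i.castSucc = f i.succ := by
  by_contra! hne
  exact h (Fin.strictMono_iff_lt_succ.2 fun i =>
    lt_of_le_of_ne (f.monotone i.castSucc_lt_succ.le) (hne i)).injective

theorem restrict_mem_degenerate {p n : ℕ} (x : X.obj (op (SimplexCategory.mk p)))
    (f : Fin (n + 1) →o Fin (p + 1)) (h : ¬ Function.Injective f) :
    restrict x f ∈ X.degenerate n := by
  obtain ⟨i, hi⟩ := exists_step_eq f h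
  exact mem_degenerate_of_restrict_eq i (by rw [restrict_restrict, comp_stepHom f i hi])

theorem restrict_mem_degenerate_of_mem {n : ℕ} {x : X.obj (op (SimplexCategory.mk (n + 1)))}
    {i : Fin (n + 1)} {m : ℕ} (y : X.obj (op (SimplexCategory.mk n)))
    (hx : x = restrict y i.predAboveOrderHom)
    (f : Fin (m + 1) →o Fin (n + 2)) (a b : Fin (m + 1)) (hab : a ≠ b) (ha : f a = i.castSucc)
    (hb : f b = i.succ) : restrict x f ∈ X.degenerate m := by
  rw [hx, restrict_restrict]
  refine restrict_mem_degenerate _ _ fun hinj => hab (hinj ?_)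
  simp [ha, hb]

/-- The face of a simplex opposite to the vertex `i`. -/
def dFace {n : ℕ} (x : X.obj (op (SimplexCategory.mk (n + 1)))) (i : Fin (n + 2)) :
    X.obj (op (SimplexCategory.mk n)) :=
  restrict x (i.succAboveOrderEmb.toOrderHom)

variable (k : Type v) [CommRing k]

variable (X) in
/-- The differential of normalized chains. -/
noncomputable def chainD (n : ℕ) : X.NChains k (n + 1) →ₗ[k] X.NChains k n :=
  chainLift (fun x => ∑ i : Fin (n + 2), (-1 : ℤ) ^ (i : ℕ) • cell k (dFace x i)) (by
    intro x hx
    obtain ⟨i, y, hy⟩ := exists_restrict_of_mem_degenerate hx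
    rw [← Finset.sum_subset (Finset.subset_univ {i.castSucc, i.succ})]
    · rw [Finset.sum_pair (by simp [Fin.ext_iff])]
      have h1 : dFace x i.castSucc = y := by
        rw [hy, dFace, restrict_restrict]
        conv_rhs => rw [← restrict_id y]
        congr 1
        ext v : 2
        simp
      have h2 : dFace x i.succ = y := by
        rw [hy, dFace, restrict_restrict]
        conv_rhs => rw [← restrict_id y]
        congr 1
        exact congrArg SimplexCategory.Hom.toOrderHom (SimplexCategory.δ_comp_σ_succ (i := i))
      rw [h1, h2]
      simp [pow_succ]
    · intro j _ hj
      simp only [Finset.mem_insert, Finset.mem_singleton, not_or] at hj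
      obtain ⟨a, ha⟩ := Fin.exists_succAbove_eq (Ne.symm hj.1)
      obtain ⟨b, hb⟩ := Fin.exists_succAbove_eq (Ne.symm hj.2)
      rw [cell_eq_zero, smul_zero]
      refine restrict_mem_degenerate_of_mem y hy _ a b ?_ ha hb
      rintro rfl
      rw [ha] at hb
      simp [Fin.ext_iff] at hb)

@[simp]
theorem chainD_cell {n : ℕ} (x : X.obj (op (SimplexCategory.mk (n + 1)))) :
    X.chainD k n (cell k x) = ∑ i : Fin (n + 2), (-1 : ℤ) ^ (i : ℕ) • cell k (dFace x i) :=
  chainLift_cell _ _ _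

theorem chainD_comp_chainD (n : ℕ) : X.chainD k n ∘ₗ X.chainD k (n + 1) = 0 := by
  apply chain_hom_ext
  intro x
  simp only [LinearMap.comp_apply, chainD_cell, map_sum, map_zsmul, LinearMap.zero_apply,
    Finset.smul_sum, smul_smul, ← pow_add]
  rw [← Finset.sum_product']
  refine Finset.sum_involution
    (fun p _ => (p.1.succAbove p.2, p.2.predAbove p.1)) ?_ ?_ (fun _ _ => Finset.mem_univ _) ?_
  · rintro ⟨i, j⟩ -
    have h1 : dFace (dFace x (i.succAbove j)) (j.predAbove i) = dFace (dFace x i) j := by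
      rw [dFace, dFace, dFace, dFace, restrict_restrict, restrict_restrict]
      congr 1
      ext v : 2
      exact Fin.succAbove_succAbove_succAbove_predAbove i j v
    have h2 : (-1 : ℤ) ^ ((i.succAbove j : ℕ) + (j.predAbove i : ℕ)) =
        -(-1 : ℤ) ^ ((i : ℕ) + (j : ℕ)) := by
      rcases lt_or_ge j.castSucc i with h | h
      · rw [Fin.succAbove_of_castSucc_lt _ _ h, Fin.predAbove_of_castSucc_lt _ _ h]
        have : (i : ℕ) = (i.pred (Fin.ne_zero_of_lt h) : ℕ) + 1 := by
          have := Fin.ne_zero_of_lt h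
          simp only [Fin.val_pred]
          have : (i : ℕ) ≠ 0 := fun h0 => this (Fin.ext h0)
          omega
        rw [this]
        simp only [Fin.val_castSucc]
        ring
      · rw [Fin.succAbove_of_le_castSucc _ _ h, Fin.predAbove_of_le_castSucc _ _ h]
        simp only [Fin.val_succ, Fin.coe_castPred]
        ring
    rw [h1, h2, neg_smul, add_neg_cancel]
  · rintro ⟨i, j⟩ - - h
    exact Fin.succAbove_ne i j (congrArg Prod.fst h)
  · rintro ⟨i, j⟩ -
    exact Prod.ext (Fin.succAbove_succAbove_predAbove i j) (Fin.predAbove_predAbove_succAbove i j)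

end SSet

/-! ### Singular cubes of a simplicial set -/

/-- The monotone map underlying a morphism of the cube category. -/
def Cube.toOrderHom {m n : ℕ} (l : (⟨m⟩ : Cube) ⟶ ⟨n⟩) : (Fin m → Fin 2) →o (Fin n → Fin 2) :=
  ⟨l.1, l.2.monotone⟩

/-- A singular `n`-cube of a simplicial set `X`, i.e. a map of simplicial sets `𝕀^n → X`. -/
structure SingularCube (X : SSet.{u}) (n : ℕ) where
  /-- The map on `m`-simplices. -/
  toFun : ∀ {m : ℕ}, CubeSimplex n m → X.obj (op (SimplexCategory.mk m))
  toFun_comp : ∀ {m l : ℕ} (s : CubeSimplex n m) (f : Fin (l + 1) →o Fin (m + 1)),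
    toFun (s.comp f) = SSet.restrict (toFun s) f

namespace SingularCube

variable {X : SSet.{u}} {n : ℕ}

/-- The composition of a singular cube with a monotone map of cubes. -/
def comp {m : ℕ} (c : SingularCube X n) (f : (Fin m → Fin 2) →o (Fin n → Fin 2)) :
    SingularCube X m where
  toFun s := c.toFun (f.comp s)
  toFun_comp s g := c.toFun_comp (f.comp s) g

theorem comp_comp {m l : ℕ} (c : SingularCube X n) (f : (Fin m → Fin 2) →o (Fin n → Fin 2))
    (g : (Fin l → Fin 2) →o (Fin m → Fin 2)) : (c.comp f).comp g = c.comp (f.comp g) := rfl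

theorem toFun_mem_degenerate (c : SingularCube X n) {m : ℕ} (s : CubeSimplex n m)
    (h : ¬ Function.Injective s) : c.toFun s ∈ X.degenerate m := by
  obtain ⟨i, hi⟩ := SSet.exists_step_eq s h
  exact SSet.mem_degenerate_of_restrict_eq i (by rw [← c.toFun_comp, SSet.comp_stepHom s i hi])

variable (k : Type v) [CommRing k]

/-- The normalized chain carried by a singular cube: the signed sum over the maximal simplices
of the triangulated cube. -/
noncomputable def chain (c : SingularCube X n) : X.NChains k n :=
  ∑ π : Equiv.Perm (Fin n), (Equiv.Perm.sign π : ℤ) • SSet.cell k (c.toFun (CubeSimplex.ofPerm π))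

/-- The chain carried by a singular cube, in the total module of normalized chains. -/
noncomputable def totalChain (c : SingularCube X n) : ⨁ n, X.NChains k n :=
  DirectSum.lof k ℕ (X.NChains k) n (c.chain k)

theorem totalChain_eq_sum (c : SingularCube X n) : c.totalChain k =
    ∑ π : Equiv.Perm (Fin n), (Equiv.Perm.sign π : ℤ) •
      SSet.totalCell k (c.toFun (CubeSimplex.ofPerm π)) := by
  rw [totalChain, chain, map_sum]
  exact Finset.sum_congr rfl fun π _ => map_zsmul _ _ _

variable {k} in
theorem totalChain_congr {a b : ℕ} (h : a = b) (c : SingularCube X a) (c' : SingularCube X b)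
    (hc : ∀ (m : ℕ) (s : CubeSimplex b m) (s' : CubeSimplex a m),
      (∀ v i, s' v i = s v (Fin.cast h i)) → c.toFun s' = c'.toFun s) :
    c.totalChain k = c'.totalChain k := by
  subst h
  rw [totalChain_eq_sum, totalChain_eq_sum]
  exact Finset.sum_congr rfl fun π _ => by rw [hc _ _ _ fun _ _ => rfl]

/-! ### The boundary of a singular cube -/

theorem ofPerm_apply (π : Equiv.Perm (Fin n)) (v : Fin (n + 1)) (i : Fin n) :
    CubeSimplex.ofPerm π v i = if (π.symm i : ℕ) < v then 1 else 0 := rfl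

variable {k} in
/-- Exchanging two consecutive steps of a maximal simplex of the cube does not change the face
opposite to the vertex between them. Hence the inner faces of the maximal simplices cancel. -/
theorem sum_dFace_inner (c : SingularCube X (n + 1)) (j : Fin (n + 2)) (h0 : j ≠ 0)
    (hl : j ≠ Fin.last _) :
    ∑ π : Equiv.Perm (Fin (n + 1)), (Equiv.Perm.sign π : ℤ) •
      SSet.cell k (SSet.dFace (c.toFun (CubeSimplex.ofPerm π)) j) = 0 := by
  have hj0 : (j : ℕ) ≠ 0 := fun h => h0 (Fin.ext h)
  have hjl : (j : ℕ) ≠ n + 1 := fun h => hl (Fin.ext h)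
  have hj := j.2
  set a : Fin (n + 1) := ⟨j - 1, by omega⟩ with ha
  set b : Fin (n + 1) := ⟨j, by omega⟩ with hb
  have hab : a ≠ b := by
    simp only [ha, hb, ne_eq, Fin.mk.injEq]
    omega
  refine Finset.sum_involution (fun π _ => π * Equiv.swap a b) ?_ ?_
    (fun _ _ => Finset.mem_univ _) (fun π _ => by simp [mul_assoc])
  · intro π _
    have : SSet.dFace (c.toFun (CubeSimplex.ofPerm (π * Equiv.swap a b))) j =
        SSet.dFace (c.toFun (CubeSimplex.ofPerm π)) j := by
      rw [SSet.dFace, SSet.dFace, ← c.toFun_comp, ← c.toFun_comp]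
      congr 1
      ext v i : 3
      simp only [OrderHom.comp_coe, Function.comp_apply, ofPerm_apply]
      have hv : (j.succAboveOrderEmb.toOrderHom v : ℕ) ≠ j := fun h =>
        Fin.succAbove_ne j v (Fin.ext h)
      have hsymm : (π * Equiv.swap a b).symm i = Equiv.swap a b (π.symm i) := by
        rw [Equiv.symm_apply_eq]
        simp
      rw [hsymm]
      refine if_congr ?_ rfl rfl
      rcases eq_or_ne (π.symm i) a with h | h
      · rw [h, Equiv.swap_apply_left]
        simp only [ha, hb]
        omega
      rcases eq_or_ne (π.symm i) b with h' | h'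
      · rw [h', Equiv.swap_apply_right]
        simp only [ha, hb]
        omega
      · rw [Equiv.swap_apply_of_ne_of_ne h h']
    rw [this, Equiv.Perm.sign_mul, Equiv.Perm.sign_swap hab]
    simp
  · intro π _ _ h
    have := mul_left_cancel (h.trans (mul_one π).symm)
    exact hab (by simpa using congrArg (fun σ => σ b) this)

/-- The permutation sending `0` to `i` and restricting to `π` on the remaining elements. -/
def insertPerm (i : Fin (n + 1)) (π : Equiv.Perm (Fin n)) : Equiv.Perm (Fin (n + 1)) :=
  i.cycleRange.symm * Equiv.Perm.decomposeFin.symm (0, π)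

theorem insertPerm_zero (i : Fin (n + 1)) (π : Equiv.Perm (Fin n)) : insertPerm i π 0 = i := by
  simp [insertPerm]

theorem insertPerm_succ (i : Fin (n + 1)) (π : Equiv.Perm (Fin n)) (j : Fin n) :
    insertPerm i π j.succ = i.succAbove (π j) := by
  simp [insertPerm]

theorem sign_insertPerm (i : Fin (n + 1)) (π : Equiv.Perm (Fin n)) :
    (Equiv.Perm.sign (insertPerm i π) : ℤ) = (-1) ^ (i : ℕ) * Equiv.Perm.sign π := by
  simp [insertPerm, Fin.sign_cycleRange]

theorem insertPerm_bijective :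
    Function.Bijective fun p : Fin (n + 1) × Equiv.Perm (Fin n) => insertPerm p.1 p.2 := by
  rw [Fintype.bijective_iff_injective_and_card]
  constructor
  · rintro ⟨i, π⟩ ⟨i', π'⟩ h
    dsimp only at h
    have h0 := congrArg (fun σ => σ 0) h
    simp only [insertPerm_zero] at h0
    subst h0
    refine Prod.ext rfl (Equiv.ext fun j => ?_)
    have := congrArg (fun σ => σ j.succ) h
    simp only [insertPerm_succ] at this
    exact Fin.succAbove_right_injective this
  · simp [Fintype.card_perm, Nat.factorial_succ]

theorem sum_perm_succ {A : Type*} [AddCommMonoid A] (F : Equiv.Perm (Fin (n + 1)) → A) :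
    ∑ π, F π = ∑ i, ∑ π, F (insertPerm i π) := by
  rw [← Fintype.sum_prod_type', ← insertPerm_bijective.sum_comp]

/-- The face map of cubes as a monotone map. -/
def faceHom (ε : Fin 2) (i : Fin (n + 1)) : (Fin n → Fin 2) →o (Fin (n + 1) → Fin 2) :=
  Cube.toOrderHom (Cube.face ε i)

theorem insertPerm_symm_self (i : Fin (n + 1)) (π : Equiv.Perm (Fin n)) :
    (insertPerm i π).symm i = 0 := by
  rw [Equiv.symm_apply_eq, insertPerm_zero]

theorem insertPerm_symm_succAbove (i : Fin (n + 1)) (π : Equiv.Perm (Fin n)) (j : Fin n) :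
    (insertPerm i π).symm (i.succAbove j) = (π.symm j).succ := by
  rw [Equiv.symm_apply_eq, insertPerm_succ, Equiv.apply_symm_apply]

theorem dFace_zero_insertPerm (c : SingularCube X (n + 1)) (i : Fin (n + 1))
    (π : Equiv.Perm (Fin n)) :
    SSet.dFace (c.toFun (CubeSimplex.ofPerm (insertPerm i π))) 0 =
      (c.comp (faceHom 1 i)).toFun (CubeSimplex.ofPerm π) := by
  rw [SSet.dFace, ← c.toFun_comp, comp]
  congr 1
  ext v : 2
  refine (CubeMap.face_eq 1 i _ _ ?_ fun j => ?_).symm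
  · simp [ofPerm_apply, insertPerm_symm_self]
  · simp [ofPerm_apply, insertPerm_symm_succAbove]

theorem dFace_last_insertPerm (c : SingularCube X (n + 1)) (i : Fin (n + 1))
    (π : Equiv.Perm (Fin n)) :
    SSet.dFace (c.toFun (CubeSimplex.ofPerm (insertPerm i π * finRotate (n + 1)))) (Fin.last _) =
      (c.comp (faceHom 0 i)).toFun (CubeSimplex.ofPerm π) := by
  have h0 : (finRotate (n + 1)).symm 0 = Fin.last n := by
    rw [Equiv.symm_apply_eq, finRotate_last]
  have hs (j : Fin n) : (finRotate (n + 1)).symm j.succ = j.castSucc := by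
    rw [Equiv.symm_apply_eq, finRotate_apply]
    simp
  have hm (x : Fin (n + 1)) : (insertPerm i π * finRotate (n + 1)).symm x =
      (finRotate (n + 1)).symm ((insertPerm i π).symm x) := rfl
  rw [SSet.dFace, ← c.toFun_comp, comp]
  congr 1
  ext v : 2
  refine (CubeMap.face_eq 0 i _ _ ?_ fun j => ?_).symm
  · simp only [OrderHom.comp_coe, Function.comp_apply, ofPerm_apply, hm, insertPerm_symm_self, h0]
    simp [Nat.not_lt.2 v.is_le]
  · simp [ofPerm_apply, insertPerm_symm_succAbove, hm, hs]

/-- The boundary of the chain of a singular cube. The faces opposite to the first and last vertex of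
the maximal simplices are the maximal simplices of the faces of the cube. -/
theorem chainD_chain (c : SingularCube X (n + 1)) : X.chainD k n (c.chain k) =
    ∑ i : Fin (n + 1), (-1 : ℤ) ^ ((i : ℕ) + 1) •
      ((c.comp (faceHom 0 i)).chain k - (c.comp (faceHom 1 i)).chain k) := by
  simp only [chain, map_sum, map_zsmul, SSet.chainD_cell, Finset.smul_sum]
  rw [Finset.sum_comm]
  simp only [smul_comm _ ((-1 : ℤ) ^ _) , ← Finset.smul_sum]
  rw [← Finset.sum_subset (Finset.subset_univ {0, Fin.last _}),
    Finset.sum_pair (by simp [Fin.ext_iff])]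
  -- A permutation is split by its first value for the first vertices, and by its last value, moved
  -- to the front by a cyclic rotation of sign `(-1) ^ n`, for the last vertices.
  · rw [sum_perm_succ, ← Equiv.sum_comp (Equiv.mulRight (finRotate (n + 1))), sum_perm_succ]
    simp only [Equiv.coe_mulRight, dFace_zero_insertPerm, dFace_last_insertPerm,
      Equiv.Perm.sign_mul, sign_finRotate, Units.val_mul, sign_insertPerm, Finset.smul_sum,
      smul_sub, smul_smul, Finset.sum_sub_distrib]
    rw [sub_eq_neg_add, ← Finset.sum_neg_distrib]
    congr 1
    · refine Finset.sum_congr rfl fun i _ => ?_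
      rw [← Finset.sum_neg_distrib]
      refine Finset.sum_congr rfl fun π _ => ?_
      rw [← neg_smul]
      congr 1
      simp [pow_succ]
    · refine Finset.sum_congr rfl fun i _ => Finset.sum_congr rfl fun π _ => ?_
      congr 1
      have : (-1 : ℤ) ^ n * (-1) ^ n = 1 := by rw [← mul_pow]; simp
      simp only [Fin.val_last, add_tsub_cancel_right, Units.val_pow_eq_pow_val, Units.val_neg,
        Units.val_one, pow_succ]
      linear_combination (-1) * (-1 : ℤ) ^ (i : ℕ) * (Equiv.Perm.sign π : ℤ) * this
  · intro j _ hj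
    simp only [Finset.mem_insert, Finset.mem_singleton, not_or] at hj
    rw [sum_dFace_inner c j hj.1 hj.2, smul_zero]

end SingularCube

/-! ### Shuffles and permutations -/

/-- The permutation that puts the positions `0, ..., p - 1` into the set `α`, ordered according
to `ρ`, and the remaining `q` positions into its complement, ordered according to `τ`. -/
def shufflePerm {n p q : ℕ} (hn : p + q = n) (α : Finset (Fin n)) (h : α.card = p)
    (hc : αᶜ.card = q) (ρ : Equiv.Perm (Fin p)) (τ : Equiv.Perm (Fin q)) : Equiv.Perm (Fin n) :=
  (finCongr hn.symm).trans (finSumFinEquiv.symm.trans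
    ((Equiv.sumCongr ρ τ).trans (finSumEquivOfFinset h hc)))

section Shuffle

variable {n p q : ℕ} (hn : p + q = n) (α : Finset (Fin n)) (h : α.card = p)
  (hc : αᶜ.card = q) (ρ : Equiv.Perm (Fin p)) (τ : Equiv.Perm (Fin q))

theorem sign_shufflePerm : (Equiv.Perm.sign (shufflePerm hn α h hc ρ τ) : ℤ) =
    shuffleSign α * (Equiv.Perm.sign ρ * Equiv.Perm.sign τ) := by
  subst h
  subst hc
  have key : shufflePerm hn α rfl rfl ρ τ =
      ((((finCongr hn.symm).trans finSumFinEquiv.symm).trans (Equiv.Perm.sumCongr ρ τ)).trans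
        ((finCongr hn.symm).trans finSumFinEquiv.symm).symm).trans
          (shufflePerm hn α rfl rfl 1 1) := by
    ext x
    simp [shufflePerm]
  rw [key, Equiv.Perm.sign_trans, Equiv.Perm.sign_trans_trans_symm, Equiv.Perm.sign_sumCongr,
    Units.val_mul, Units.val_mul]
  have h1 : shufflePerm hn α rfl rfl 1 1 = (finCongr hn.symm).trans
      (finSumFinEquiv.symm.trans (finSumEquivOfFinset rfl rfl)) := by
    ext x
    simp [shufflePerm]
  rw [h1]
  rfl

theorem shufflePerm_castAdd (j : Fin p) :
    shufflePerm hn α h hc ρ τ (Fin.cast hn (Fin.castAdd q j)) = α.orderEmbOfFin h (ρ j) := by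
  simp [shufflePerm]

theorem shufflePerm_natAdd (j : Fin q) :
    shufflePerm hn α h hc ρ τ (Fin.cast hn (Fin.natAdd p j)) = αᶜ.orderEmbOfFin hc (τ j) := by
  simp [shufflePerm]

theorem shufflePerm_symm_orderEmb (j : Fin p) :
    (shufflePerm hn α h hc ρ τ).symm (α.orderEmbOfFin h j) =
      Fin.cast hn (Fin.castAdd q (ρ.symm j)) := by
  rw [Equiv.symm_apply_eq, shufflePerm_castAdd, Equiv.apply_symm_apply]

theorem shufflePerm_symm_orderEmb_compl (j : Fin q) :
    (shufflePerm hn α h hc ρ τ).symm (αᶜ.orderEmbOfFin hc j) =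
      Fin.cast hn (Fin.natAdd p (τ.symm j)) := by
  rw [Equiv.symm_apply_eq, shufflePerm_natAdd, Equiv.apply_symm_apply]

theorem exists_orderEmbOfFin {α : Finset (Fin n)} (h : α.card = p) {x : Fin n} (hx : x ∈ α) :
    ∃ j, α.orderEmbOfFin h j = x := by
  have : x ∈ Set.range (α.orderEmbOfFin h) := by simpa using hx
  exact this

theorem shufflePerm_symm_lt_iff (x : Fin n) :
    ((shufflePerm hn α h hc ρ τ).symm x : ℕ) < p ↔ x ∈ α := by
  by_cases hx : x ∈ α
  · obtain ⟨j, rfl⟩ := exists_orderEmbOfFin h hx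
    simp [shufflePerm_symm_orderEmb]
  · obtain ⟨j, rfl⟩ := exists_orderEmbOfFin hc (Finset.mem_compl.2 hx)
    simp [shufflePerm_symm_orderEmb_compl, hx]

end Shuffle

theorem card_compl_eq_of_card_eq {n p q : ℕ} (hn : p + q = n) {α : Finset (Fin n)}
    (h : α.card = p) : αᶜ.card = q := by
  rw [Finset.card_compl, h, Fintype.card_fin]
  omega

theorem shufflePerm_bijective {n p q : ℕ} (hn : p + q = n) :
    Function.Bijective
      fun x : {α : Finset (Fin n) // α.card = p} × Equiv.Perm (Fin p) × Equiv.Perm (Fin q) =>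
        shufflePerm hn x.1.1 x.1.2 (card_compl_eq_of_card_eq hn x.1.2) x.2.1 x.2.2 := by
  rw [Fintype.bijective_iff_injective_and_card]
  constructor
  · rintro ⟨⟨α, h⟩, ρ, τ⟩ ⟨⟨α', h'⟩, ρ', τ'⟩ heq
    dsimp only at heq
    have hα : α = α' := by
      ext x
      rw [← shufflePerm_symm_lt_iff hn α h (card_compl_eq_of_card_eq hn h) ρ τ x, heq,
        shufflePerm_symm_lt_iff]
    subst hα
    refine Prod.ext rfl (Prod.ext (Equiv.ext fun j => ?_) (Equiv.ext fun j => ?_))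
    · have := congrArg (fun σ => σ (Fin.cast hn (Fin.castAdd q j))) heq
      simpa [shufflePerm_castAdd] using this
    · have := congrArg (fun σ => σ (Fin.cast hn (Fin.natAdd p j))) heq
      simpa [shufflePerm_natAdd] using this
  · subst hn
    have : Fintype.card {α : Finset (Fin (p + q)) // α.card = p} = (p + q).choose p := by
      simp
    simp only [Fintype.card_prod, this, Fintype.card_perm, Fintype.card_fin]
    rw [← Nat.add_choose_mul_factorial_mul_factorial p q, mul_assoc, Nat.choose_symm_add]

/-- Every permutation is uniquely composed of a shuffle and permutations of the two blocks. -/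
theorem sum_perm_eq_sum_shuffle {n p q : ℕ} (hn : p + q = n) {A : Type*} [AddCommMonoid A]
    (F : Equiv.Perm (Fin n) → A) :
    ∑ π, F π = ∑ α : {α : Finset (Fin n) // α.card = p}, ∑ ρ, ∑ τ,
      F (shufflePerm hn α.1 α.2 (card_compl_eq_of_card_eq hn α.2) ρ τ) := by
  rw [← (shufflePerm_bijective hn).sum_comp, Fintype.sum_prod_type]
  exact Finset.sum_congr rfl fun α _ => Fintype.sum_prod_type _

/-- The `j`-th element of `α` is smaller than `v` if and only if `α` has more than `j` elements
smaller than `v`. In this way the maps of simplices in the shuffle product, which count elements of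
`α`, are compared with vertices of maximal simplices. -/
theorem orderEmbOfFin_lt_iff {n p : ℕ} {α : Finset (Fin n)} (h : α.card = p) (j : Fin p) (v : ℕ) :
    (α.orderEmbOfFin h j : ℕ) < v ↔ (j : ℕ) < (α.filter fun i : Fin n => (i : ℕ) < v).card := by
  constructor
  · intro hj
    have hsub : (Finset.Iic j).map (α.orderEmbOfFin h).toEmbedding ⊆
        α.filter fun i : Fin n => (i : ℕ) < v := by
      intro x hx
      simp only [Finset.mem_map, Finset.mem_Iic, RelEmbedding.coe_toEmbedding] at hx
      obtain ⟨i, hi, rfl⟩ := hx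
      simp only [Finset.mem_filter, Finset.orderEmbOfFin_mem, true_and]
      exact lt_of_le_of_lt ((α.orderEmbOfFin h).monotone hi) hj
    have := Finset.card_le_card hsub
    rw [Finset.card_map, Fin.card_Iic] at this
    omega
  · intro hj
    by_contra hv
    have hsub : (α.filter fun i : Fin n => (i : ℕ) < v) ⊆
        (Finset.Iio j).map (α.orderEmbOfFin h).toEmbedding := by
      intro x hx
      simp only [Finset.mem_filter] at hx
      obtain ⟨i, rfl⟩ := exists_orderEmbOfFin h hx.1
      simp only [Finset.mem_map, Finset.mem_Iio, RelEmbedding.coe_toEmbedding,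
        EmbeddingLike.apply_eq_iff_eq, exists_eq_right]
      by_contra hij
      have := (α.orderEmbOfFin h).monotone (not_lt.1 hij)
      have h2 : (α.orderEmbOfFin h j : ℕ) ≤ α.orderEmbOfFin h i := this
      omega
    have := Finset.card_le_card hsub
    rw [Finset.card_map, Fin.card_Iio] at this
    omega

/-! ### The Alexander-Whitney diagonal of a singular cube -/

namespace SSet

variable {X : SSet.{u}}

/-- The simplex spanned by the vertices `j, ..., j + l` of `x`. -/
def interval {n : ℕ} (x : X.obj (op (SimplexCategory.mk n))) (j l : ℕ) (h : j + l ≤ n) :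
    X.obj (op (SimplexCategory.mk l)) :=
  restrict x (SimplexCategory.subinterval j l h).toOrderHom

end SSet

namespace SingularCube

variable {X : SSet.{u}} {n : ℕ} (k : Type v) [CommRing k]

/-- The inclusion of cubes filling in the coordinates outside of `α` with `ε`, as a
monotone map. -/
noncomputable def inclHom (α : Finset (Fin n)) (ε : Fin 2) :
    (Fin α.card → Fin 2) →o (Fin n → Fin 2) :=
  Cube.toOrderHom (Cube.incl α ε)

theorem inclHom_orderEmb (α : Finset (Fin n)) (ε : Fin 2) (t : Fin α.card → Fin 2) (j) :
    inclHom α ε t (α.orderEmbOfFin rfl j) = t j :=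
  (α.orderEmbOfFin rfl).injective.extend_apply t (fun _ => ε) j

theorem inclHom_of_notMem (α : Finset (Fin n)) (ε : Fin 2) (t : Fin α.card → Fin 2) {x : Fin n}
    (hx : x ∉ α) : inclHom α ε t x = ε := by
  refine Function.extend_apply' t (fun _ => ε) x ?_
  rintro ⟨j, rfl⟩
  exact hx (Finset.orderEmbOfFin_mem _ _ _)

/-- In the first steps only the coordinates in `α` change, the others still being `0`. -/
theorem interval_front_shufflePerm (c : SingularCube X n) (α : Finset (Fin n))
    (hn : α.card + αᶜ.card = n) (h : 0 + α.card ≤ n) (ρ τ) :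
    SSet.interval (c.toFun (CubeSimplex.ofPerm (shufflePerm hn α rfl rfl ρ τ))) 0 α.card h =
      (c.comp (inclHom α 0)).toFun (CubeSimplex.ofPerm ρ) := by
  rw [SSet.interval, ← c.toFun_comp, comp]
  congr 1
  ext v x : 3
  simp only [OrderHom.comp_coe, Function.comp_apply, ofPerm_apply]
  have hv : ((SimplexCategory.subinterval 0 α.card h).toOrderHom v : ℕ) = v := rfl
  have := v.is_le
  by_cases hx : x ∈ α
  · obtain ⟨j, rfl⟩ := exists_orderEmbOfFin rfl hx
    rw [shufflePerm_symm_orderEmb, inclHom_orderEmb, hv]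
    rfl
  · rw [inclHom_of_notMem _ _ _ hx, if_neg]
    have := (shufflePerm_symm_lt_iff hn α rfl rfl ρ τ x).not.2 hx
    omega

/-- In the last steps only the coordinates outside of `α` change, the others already being `1`. -/
theorem interval_back_shufflePerm (c : SingularCube X n) (α : Finset (Fin n))
    (hn : α.card + αᶜ.card = n) (ρ τ) :
    SSet.interval (c.toFun (CubeSimplex.ofPerm (shufflePerm hn α rfl rfl ρ τ))) α.card αᶜ.card
        hn.le =
      (c.comp (inclHom αᶜ 1)).toFun (CubeSimplex.ofPerm τ) := by
  rw [SSet.interval, ← c.toFun_comp, comp]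
  congr 1
  ext v x : 3
  simp only [OrderHom.comp_coe, Function.comp_apply, ofPerm_apply]
  have hv : ((SimplexCategory.subinterval α.card αᶜ.card hn.le).toOrderHom v : ℕ) =
    v + α.card := rfl
  by_cases hx : x ∈ α
  · rw [inclHom_of_notMem _ _ _ (by simpa using hx), if_pos]
    have := (shufflePerm_symm_lt_iff hn α rfl rfl ρ τ x).2 hx
    omega
  · obtain ⟨j, rfl⟩ := exists_orderEmbOfFin rfl (Finset.mem_compl.2 hx)
    rw [shufflePerm_symm_orderEmb_compl, inclHom_orderEmb, hv]
    refine if_congr ?_ rfl rfl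
    simp only [Fin.val_cast, Fin.val_natAdd]
    omega

/-- The part of the Alexander-Whitney diagonal of the chain of a singular cube that is given by the
maximal simplices whose first `p` steps change the coordinates in `α`. -/
theorem sum_shuffle_interval (c : SingularCube X n) {p q : ℕ} (hn : p + q = n)
    (α : Finset (Fin n)) (h : α.card = p) (hc : αᶜ.card = q) :
    ∑ ρ, ∑ τ, (Equiv.Perm.sign (shufflePerm hn α h hc ρ τ) : ℤ) •
      (SSet.totalCell k (SSet.interval (c.toFun (CubeSimplex.ofPerm
        (shufflePerm hn α h hc ρ τ))) 0 p (by omega)) ⊗ₜ[k]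
      SSet.totalCell k (SSet.interval (c.toFun (CubeSimplex.ofPerm
        (shufflePerm hn α h hc ρ τ))) p q (by omega))) =
    shuffleSign α • ((c.comp (inclHom α 0)).totalChain k ⊗ₜ[k]
      (c.comp (inclHom αᶜ 1)).totalChain k) := by
  subst h
  subst hc
  simp only [interval_front_shufflePerm, interval_back_shufflePerm, sign_shufflePerm,
    totalChain_eq_sum, TensorProduct.sum_tmul, TensorProduct.tmul_sum, Finset.smul_sum,
    mul_smul]
  rw [Finset.sum_comm]
  refine Finset.sum_congr rfl fun ρ _ => Finset.sum_congr rfl fun τ _ => ?_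
  congr 1
  rw [← TensorProduct.smul_tmul', TensorProduct.tmul_smul]

theorem sum_eq_sum_card {A : Type*} [AddCommMonoid A] (g : Finset (Fin n) → A) :
    ∑ i : Fin (n + 1), ∑ α : {α : Finset (Fin n) // α.card = i}, g α = ∑ α, g α := by
  have h1 (i : Fin (n + 1)) : ∑ α : {α : Finset (Fin n) // α.card = i}, g α =
      ∑ α : Finset (Fin n), if α.card = i then g α else 0 := by
    rw [← Finset.sum_filter]
    exact (Finset.sum_subtype _ (by simp) g).symm
  simp only [h1]
  rw [Finset.sum_comm]
  refine Finset.sum_congr rfl fun α _ => ?_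
  have hα : α.card < n + 1 := by
    have := Finset.card_le_univ α
    simp at this
    omega
  rw [Finset.sum_eq_single ⟨α.card, hα⟩]
  · simp
  · intro i _ hi
    rw [if_neg]
    intro h
    exact hi (Fin.ext h.symm)
  · simp

/-- The Alexander-Whitney diagonal of the chain of a singular cube is given by the Serre
diagonal. -/
theorem sum_interval_tmul_interval (c : SingularCube X n) :
    ∑ π : Equiv.Perm (Fin n), (Equiv.Perm.sign π : ℤ) • ∑ i : Fin (n + 1),
      SSet.totalCell k (SSet.interval (c.toFun (CubeSimplex.ofPerm π)) 0 i (by omega)) ⊗ₜ[k]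
      SSet.totalCell k (SSet.interval (c.toFun (CubeSimplex.ofPerm π)) i (n - i) (by omega)) =
    ∑ α : Finset (Fin n), shuffleSign α • ((c.comp (inclHom α 0)).totalChain k ⊗ₜ[k]
      (c.comp (inclHom αᶜ 1)).totalChain k) := by
  simp only [Finset.smul_sum]
  rw [Finset.sum_comm, ← sum_eq_sum_card]
  refine Finset.sum_congr rfl fun i _ => ?_
  have hn : (i : ℕ) + (n - i) = n := by omega
  rw [sum_perm_eq_sum_shuffle hn]
  refine Finset.sum_congr rfl fun α _ => ?_
  exact sum_shuffle_interval k c hn α.1 α.2 _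

end SingularCube

/-! ### The shuffle product of normalized chains -/

section Collapse

variable {n p : ℕ} {α : Finset (Fin n)} (h : α.card = p)

theorem collapse_apply_val (v : Fin (n + 1)) : ((collapse α h).toOrderHom v : ℕ) =
    (α.filter fun i : Fin n => (i : ℕ) < v).card := rfl

theorem card_filter_lt_succ_le (α : Finset (Fin n)) (a : Fin n) :
    (α.filter fun i : Fin n => (i : ℕ) < (a : ℕ) + 1).card ≤
      (α.filter fun i : Fin n => (i : ℕ) < (a : ℕ)).card + 1 := by
  refine (Finset.card_le_card (t := insert a (α.filter fun i : Fin n => (i : ℕ) < (a : ℕ)))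
    fun x => ?_).trans (Finset.card_insert_le _ _)
  simp only [Finset.mem_filter, Finset.mem_insert, Fin.ext_iff]
  rintro ⟨hx, hxa⟩
  rcases (Nat.lt_succ_iff_lt_or_eq.1 hxa) with h' | h'
  · exact Or.inr ⟨hx, h'⟩
  · exact Or.inl h'

theorem collapse_castSucc_orderEmb (j : Fin p) :
    (collapse α h).toOrderHom (α.orderEmbOfFin h j).castSucc = j.castSucc := by
  have h1 := (orderEmbOfFin_lt_iff h j (α.orderEmbOfFin h j)).not.1 (lt_irrefl _)
  have h2 := (orderEmbOfFin_lt_iff h j (α.orderEmbOfFin h j + 1)).1 (Nat.lt_succ_self _)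
  have h3 := card_filter_lt_succ_le α (α.orderEmbOfFin h j)
  apply Fin.ext
  rw [collapse_apply_val]
  simp only [Fin.val_castSucc]
  omega

theorem collapse_step_of_notMem {s : Fin n} (hs : s ∉ α) :
    (collapse α h).toOrderHom s.castSucc = (collapse α h).toOrderHom s.succ := by
  apply Fin.ext
  rw [collapse_apply_val, collapse_apply_val]
  congr 1
  ext x
  simp only [Finset.mem_filter, Fin.val_castSucc, Fin.val_succ]
  refine and_congr_right fun hx => ?_
  have : (x : ℕ) ≠ s := fun e => hs (by rwa [← Fin.ext e])
  omega

theorem collapse_succ_orderEmb (j : Fin p) :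
    (collapse α h).toOrderHom (α.orderEmbOfFin h j).succ = j.succ := by
  have h0 := congrArg Fin.val (collapse_castSucc_orderEmb h j)
  have h2 := (orderEmbOfFin_lt_iff h j (α.orderEmbOfFin h j + 1)).1 (Nat.lt_succ_self _)
  have h3 := card_filter_lt_succ_le α (α.orderEmbOfFin h j)
  apply Fin.ext
  rw [collapse_apply_val] at h0 ⊢
  simp only [Fin.val_castSucc, Fin.val_succ] at h0 ⊢
  omega

end Collapse

namespace SimplicialMonoid

variable {X : SSet.{u}} (G : SimplicialMonoid X)

theorem restrict_mul {p n : ℕ} (x y : X.obj (op (SimplexCategory.mk p)))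
    (f : Fin (n + 1) →o Fin (p + 1)) :
    SSet.restrict (G.mul x y) f = G.mul (SSet.restrict x f) (SSet.restrict y f) :=
  G.map_mul _ _ _

theorem mul_restrict_mem_degenerate {p q n : ℕ} (x : X.obj (op (SimplexCategory.mk p)))
    (y : X.obj (op (SimplexCategory.mk q))) (f : Fin (n + 1) →o Fin (p + 1))
    (g : Fin (n + 1) →o Fin (q + 1)) (i : Fin n) (hf : f i.castSucc = f i.succ)
    (hg : g i.castSucc = g i.succ) :
    G.mul (SSet.restrict x f) (SSet.restrict y g) ∈ X.degenerate n := by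
  refine SSet.mem_degenerate_of_restrict_eq i ?_
  rw [restrict_mul, SSet.restrict_restrict, SSet.restrict_restrict, SSet.comp_stepHom f i hf,
    SSet.comp_stepHom g i hg]

/-- The shuffle term of two simplices given by the set `α` of steps. -/
def shuffleTerm {p q n : ℕ} (x : X.obj (op (SimplexCategory.mk p)))
    (y : X.obj (op (SimplexCategory.mk q))) (α : Finset (Fin n)) (h : α.card = p)
    (hc : αᶜ.card = q) : X.obj (op (SimplexCategory.mk n)) :=
  G.mul (SSet.restrict x (collapse α h).toOrderHom) (SSet.restrict y (collapse αᶜ hc).toOrderHom)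

theorem shuffleTerm_mem_degenerate_left {p q n : ℕ} {x : X.obj (op (SimplexCategory.mk p))}
    (y : X.obj (op (SimplexCategory.mk q))) (α : Finset (Fin n)) (h : α.card = p)
    (hc : αᶜ.card = q) (hx : x ∈ X.degenerate p) : G.shuffleTerm x y α h hc ∈ X.degenerate n := by
  cases p with
  | zero => exact (SSet.not_mem_degenerate_zero hx).elim
  | succ p =>
    obtain ⟨a, x', rfl⟩ := SSet.exists_restrict_of_mem_degenerate hx
    rw [shuffleTerm, SSet.restrict_restrict]
    refine G.mul_restrict_mem_degenerate _ _ _ _ (α.orderEmbOfFin h a) ?_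
      (collapse_step_of_notMem _ (by simp))
    rw [OrderHom.comp_coe, Function.comp_apply, Function.comp_apply, collapse_castSucc_orderEmb,
      collapse_succ_orderEmb]
    simp

theorem shuffleTerm_mem_degenerate_right {p q n : ℕ} (x : X.obj (op (SimplexCategory.mk p)))
    {y : X.obj (op (SimplexCategory.mk q))} (α : Finset (Fin n)) (h : α.card = p)
    (hc : αᶜ.card = q) (hy : y ∈ X.degenerate q) : G.shuffleTerm x y α h hc ∈ X.degenerate n := by
  cases q with
  | zero => exact (SSet.not_mem_degenerate_zero hy).elim
  | succ q =>
    obtain ⟨a, y', rfl⟩ := SSet.exists_restrict_of_mem_degenerate hy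
    rw [shuffleTerm, SSet.restrict_restrict]
    have hmem := Finset.orderEmbOfFin_mem αᶜ hc a
    refine G.mul_restrict_mem_degenerate _ _ _ _ (αᶜ.orderEmbOfFin hc a)
      (collapse_step_of_notMem _ (Finset.mem_compl.1 hmem)) ?_
    rw [OrderHom.comp_coe, Function.comp_apply, Function.comp_apply, collapse_castSucc_orderEmb,
      collapse_succ_orderEmb]
    simp

variable (k : Type v) [CommRing k]

/-- The shuffle product of two simplices. -/
noncomputable def shuffle {p q : ℕ} (x : X.obj (op (SimplexCategory.mk p)))
    (y : X.obj (op (SimplexCategory.mk q))) : ⨁ n, X.NChains k n :=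
  ∑ α : {α : Finset (Fin (p + q)) // α.card = p}, shuffleSign α.1 •
    SSet.totalCell k (G.shuffleTerm x y α.1 α.2 (card_compl_eq_of_card_eq rfl α.2))

theorem shuffle_eq_zero_left {p q : ℕ} {x : X.obj (op (SimplexCategory.mk p))}
    (y : X.obj (op (SimplexCategory.mk q))) (hx : x ∈ X.degenerate p) : G.shuffle k x y = 0 :=
  Finset.sum_eq_zero fun α _ => by
    rw [SSet.totalCell_eq_zero (G.shuffleTerm_mem_degenerate_left _ _ _ _ hx), smul_zero]

theorem shuffle_eq_zero_right {p q : ℕ} (x : X.obj (op (SimplexCategory.mk p)))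
    {y : X.obj (op (SimplexCategory.mk q))} (hy : y ∈ X.degenerate q) : G.shuffle k x y = 0 :=
  Finset.sum_eq_zero fun α _ => by
    rw [SSet.totalCell_eq_zero (G.shuffleTerm_mem_degenerate_right _ _ _ _ hy), smul_zero]

/-- The product of normalized chains: the shuffle map followed by the product of the simplicial
monoid. -/
noncomputable def chainMul :
    (⨁ n, X.NChains k n) →ₗ[k] (⨁ n, X.NChains k n) →ₗ[k] ⨁ n, X.NChains k n :=
  SSet.totalLift (fun p x => SSet.totalLift (fun q y => G.shuffle k x y)
      fun q y hy => G.shuffle_eq_zero_right k x hy) (by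
    intro p x hx
    apply SSet.total_hom_ext
    intro q y
    rw [SSet.totalLift_totalCell, LinearMap.zero_apply, G.shuffle_eq_zero_left k y hx])

theorem chainMul_totalCell {p q : ℕ} (x : X.obj (op (SimplexCategory.mk p)))
    (y : X.obj (op (SimplexCategory.mk q))) :
    G.chainMul k (SSet.totalCell k x) (SSet.totalCell k y) = G.shuffle k x y := by
  rw [chainMul, SSet.totalLift_totalCell, SSet.totalLift_totalCell]

/-! ### The product of singular cubes -/

/-- The projection of `2^{p+q}` to the first `p` coordinates. -/
def _root_.CubeMap.fstHom (p q : ℕ) : (Fin (p + q) → Fin 2) →o (Fin p → Fin 2) :=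
  ⟨fun t i => t (Fin.castAdd q i), fun _ _ h _ => h _⟩

/-- The projection of `2^{p+q}` to the last `q` coordinates. -/
def _root_.CubeMap.sndHom (p q : ℕ) : (Fin (p + q) → Fin 2) →o (Fin q → Fin 2) :=
  ⟨fun t i => t (Fin.natAdd p i), fun _ _ h _ => h _⟩

/-- The product of two singular cubes of a simplicial monoid. -/
def cubeMul {p q : ℕ} (c : SingularCube X p) (c' : SingularCube X q) : SingularCube X (p + q) where
  toFun s := G.mul (c.toFun ((CubeMap.fstHom p q).comp s)) (c'.toFun ((CubeMap.sndHom p q).comp s))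
  toFun_comp s f := by
    rw [restrict_mul, ← c.toFun_comp, ← c'.toFun_comp]
    rfl

/-- A shuffle of maximal simplices of two cubes is a maximal simplex of the product cube. The
shuffle prescribes the positions at which the steps of the first factor are taken, so it acts on the
side of the positions, which is why inverses of permutations appear. -/
theorem shuffleTerm_ofPerm {p q : ℕ} (c : SingularCube X p) (c' : SingularCube X q)
    (α : Finset (Fin (p + q))) (h : α.card = p) (hc : αᶜ.card = q) (ρ : Equiv.Perm (Fin p))
    (τ : Equiv.Perm (Fin q)) :
    G.shuffleTerm (c.toFun (CubeSimplex.ofPerm ρ⁻¹)) (c'.toFun (CubeSimplex.ofPerm τ⁻¹)) α h hc =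
      (G.cubeMul c c').toFun (CubeSimplex.ofPerm (shufflePerm rfl α h hc ρ τ)⁻¹) := by
  rw [shuffleTerm, cubeMul, ← c.toFun_comp, ← c'.toFun_comp]
  congr 2
  · ext v j : 3
    simp only [OrderHom.comp_coe, Function.comp_apply, SingularCube.ofPerm_apply]
    refine if_congr ?_ rfl rfl
    rw [collapse_apply_val, ← orderEmbOfFin_lt_iff h]
    have := shufflePerm_castAdd rfl α h hc ρ τ j
    rw [Fin.cast_refl] at this
    exact Iff.of_eq (congrArg (fun x : Fin (p + q) => (x : ℕ) < v) this.symm)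
  · ext v j : 3
    simp only [OrderHom.comp_coe, Function.comp_apply, SingularCube.ofPerm_apply]
    refine if_congr ?_ rfl rfl
    rw [collapse_apply_val, ← orderEmbOfFin_lt_iff hc]
    have := shufflePerm_natAdd rfl α h hc ρ τ j
    rw [Fin.cast_refl] at this
    exact Iff.of_eq (congrArg (fun x : Fin (p + q) => (x : ℕ) < v) this.symm)

/-- The shuffle product of the chains of two singular cubes is the chain of their product, because a
permutation of `p + q` elements is a shuffle together with permutations of the two blocks. -/
theorem chainMul_totalChain {p q : ℕ} (c : SingularCube X p) (c' : SingularCube X q) :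
    G.chainMul k (c.totalChain k) (c'.totalChain k) = (G.cubeMul c c').totalChain k := by
  have h1 : c.totalChain k = ∑ ρ : Equiv.Perm (Fin p), (Equiv.Perm.sign ρ : ℤ) •
      SSet.totalCell k (c.toFun (CubeSimplex.ofPerm ρ⁻¹)) := by
    rw [c.totalChain_eq_sum k, ← Equiv.sum_comp (Equiv.inv _)]
    simp
  have h2 : c'.totalChain k = ∑ τ : Equiv.Perm (Fin q), (Equiv.Perm.sign τ : ℤ) •
      SSet.totalCell k (c'.toFun (CubeSimplex.ofPerm τ⁻¹)) := by
    rw [c'.totalChain_eq_sum k, ← Equiv.sum_comp (Equiv.inv _)]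
    simp
  have h3 : (G.cubeMul c c').totalChain k =
      ∑ π : Equiv.Perm (Fin (p + q)), (Equiv.Perm.sign π : ℤ) •
        SSet.totalCell k ((G.cubeMul c c').toFun (CubeSimplex.ofPerm π⁻¹)) := by
    rw [(G.cubeMul c c').totalChain_eq_sum k, ← Equiv.sum_comp (Equiv.inv _)]
    simp
  rw [h1, h2, h3, sum_perm_eq_sum_shuffle (p := p) (q := q) rfl]
  simp only [map_sum, map_zsmul, LinearMap.sum_apply, LinearMap.smul_apply, chainMul_totalCell,
    shuffle, shuffleTerm_ofPerm, Finset.smul_sum, sign_shufflePerm]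
  rw [Finset.sum_comm, Finset.sum_comm (s := (Finset.univ :
    Finset {α : Finset (Fin (p + q)) // α.card = p}))]
  refine Finset.sum_congr rfl fun ρ _ => ?_
  rw [Finset.sum_comm]
  refine Finset.sum_congr rfl fun α _ => Finset.sum_congr rfl fun τ _ => ?_
  rw [smul_smul, smul_smul]
  congr 1
  ring

end SimplicialMonoid

/-! ### Every simplex is the chain of a singular cube -/

namespace SSet

variable {X : SSet.{u}}

/-- The map from the cube to the simplex that sends a vertex to its number of leading ones. -/
def leadingOnes (p : ℕ) : (Fin p → Fin 2) →o Fin (p + 1) where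
  toFun t := ⟨(Finset.univ.filter fun j : Fin p => ∀ i ≤ j, t i = 1).card,
    Nat.lt_succ_of_le ((Finset.card_le_univ _).trans (by simp))⟩
  monotone' t t' h := by
    have hsub : (Finset.univ.filter fun j : Fin p => ∀ i ≤ j, t i = 1) ⊆
        Finset.univ.filter fun j : Fin p => ∀ i ≤ j, t' i = 1 := by
      intro j hj
      simp only [Finset.mem_filter, Finset.mem_univ, true_and] at hj ⊢
      intro i hi
      have h1 := h i
      rw [hj i hi] at h1
      exact le_antisymm (Fin.le_last _) h1
    exact Finset.card_le_card hsub

theorem lt_leadingOnes_iff {p : ℕ} (t : Fin p → Fin 2) (j : Fin p) :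
    (j : ℕ) < leadingOnes p t ↔ ∀ i ≤ j, t i = 1 := by
  constructor
  · intro h
    by_contra hj
    have hsub : (Finset.univ.filter fun j : Fin p => ∀ i ≤ j, t i = 1) ⊆ Finset.Iio j := by
      intro x hx
      simp only [Finset.mem_filter, Finset.mem_univ, true_and] at hx
      rw [Finset.mem_Iio]
      by_contra hxj
      exact hj fun i hi => hx i (hi.trans (not_lt.1 hxj))
    have := Finset.card_le_card hsub
    rw [Fin.card_Iio] at this
    exact absurd h (not_lt.2 this)
  · intro h
    have hsub : Finset.Iic j ⊆ (Finset.univ.filter fun j : Fin p => ∀ i ≤ j, t i = 1) := by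
      intro x hx
      simp only [Finset.mem_filter, Finset.mem_univ, true_and]
      exact fun i hi => h i (hi.trans (Finset.mem_Iic.1 hx))
    have := Finset.card_le_card hsub
    rw [Fin.card_Iic] at this
    exact this

/-- The singular cube obtained from a simplex by composition with `SSet.leadingOnes`. -/
def toCube {p : ℕ} (x : X.obj (op (SimplexCategory.mk p))) : SingularCube X p where
  toFun s := restrict x ((leadingOnes p).comp s)
  toFun_comp s f := (restrict_restrict x ((leadingOnes p).comp s) f).symm

theorem leadingOnes_ofPerm_one (p : ℕ) :
    (leadingOnes p).comp (CubeSimplex.ofPerm 1) = OrderHom.id := by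
  ext v : 2
  have key (j : Fin p) : (j : ℕ) < leadingOnes p (CubeSimplex.ofPerm 1 v) ↔ (j : ℕ) < v := by
    rw [lt_leadingOnes_iff]
    constructor
    · intro h
      have h1 := h j le_rfl
      rw [SingularCube.ofPerm_apply] at h1
      by_contra hj
      exact absurd ((if_neg hj).symm.trans h1) (by decide)
    · intro h i hi
      rw [SingularCube.ofPerm_apply]
      exact if_pos (lt_of_le_of_lt (show (i : ℕ) ≤ j from hi) h)
  have h1 := (leadingOnes p (CubeSimplex.ofPerm 1 v)).is_le
  have h2 := v.is_le
  apply Fin.ext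
  change (leadingOnes p (CubeSimplex.ofPerm 1 v) : ℕ) = v
  by_contra hne
  rcases lt_or_gt_of_ne hne with h | h
  · exact absurd ((key ⟨_, lt_of_lt_of_le h h2⟩).2 h) (lt_irrefl _)
  · exact absurd ((key ⟨_, lt_of_lt_of_le h h1⟩).1 h) (lt_irrefl _)

/-- Counting leading ones collapses every maximal simplex of the cube but the one that changes the
coordinates in their order. -/
theorem eq_one_of_injective {p : ℕ} (π : Equiv.Perm (Fin p))
    (h : Function.Injective ((leadingOnes p).comp (CubeSimplex.ofPerm π))) : π = 1 := by
  have hm := (((leadingOnes p).comp (CubeSimplex.ofPerm π)).monotone.strictMono_of_injective h)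
  have hid : ∀ v, leadingOnes p (CubeSimplex.ofPerm π v) = v := by
    intro v
    have hs := Finite.surjective_of_injective h
    have := Subsingleton.elim (hm.orderIsoOfSurjective _ hs) (OrderIso.refl _)
    exact DFunLike.congr_fun this v
  -- The first `j + 1` coordinates of the vertex `j + 1` are ones, so they have been changed.
  have hle : ∀ j, π.symm j ≤ j := by
    intro j
    have h1 := (lt_leadingOnes_iff (CubeSimplex.ofPerm π j.succ) j).1 (by rw [hid]; simp) j le_rfl
    rw [SingularCube.ofPerm_apply] at h1
    by_contra hj
    rw [if_neg] at h1
    · exact absurd h1 (by decide)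
    · rw [Fin.val_succ]
      have : (j : ℕ) < π.symm j := not_le.1 hj
      omega
  -- A permutation which does not increase any element is the identity, by comparison of sums.
  have hsum : ∑ j, (π.symm j : ℕ) = ∑ j : Fin p, (j : ℕ) :=
    Equiv.sum_comp π.symm fun j : Fin p => (j : ℕ)
  have heq := (Finset.sum_eq_sum_iff_of_le (f := fun j => (π.symm j : ℕ))
    (g := fun j => (j : ℕ)) fun j _ => hle j).1 hsum
  refine Equiv.ext fun j => ?_
  rw [Equiv.Perm.one_apply, ← Equiv.eq_symm_apply]
  exact (Fin.ext (heq j (Finset.mem_univ j))).symm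

variable (k : Type v) [CommRing k]

/-- Every simplex represents the chain of a singular cube, since all maximal simplices of the cube
but one become degenerate. -/
theorem totalChain_toCube {p : ℕ} (x : X.obj (op (SimplexCategory.mk p))) :
    (toCube x).totalChain k = totalCell k x := by
  rw [SingularCube.totalChain_eq_sum, Finset.sum_eq_single 1]
  · have : (toCube x).toFun (CubeSimplex.ofPerm 1) = x := by
      change restrict x ((leadingOnes p).comp (CubeSimplex.ofPerm 1)) = x
      rw [leadingOnes_ofPerm_one, restrict_id]
    rw [this]
    simp
  · intro π _ hπ
    rw [totalCell_eq_zero, smul_zero]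
    exact restrict_mem_degenerate x _ fun h => hπ (eq_one_of_injective π h)
  · simp

variable {k} in
/-- Linear maps on normalized chains agree if they do so on the chains of singular cubes. -/
theorem total_hom_ext_cube {V : Type w} [AddCommGroup V] [Module k V]
    {f g : (⨁ n, X.NChains k n) →ₗ[k] V}
    (h : ∀ n (c : SingularCube X n), f (c.totalChain k) = g (c.totalChain k)) : f = g :=
  total_hom_ext fun n x => by simpa only [totalChain_toCube] using h n (toCube x)

end SSet

/-! ### The coalgebra of normalized chains -/

section Graded

variable {k : Type v} [CommRing k] {A : ℕ → Type w} [∀ n, AddCommGroup (A n)]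
  [∀ n, Module k (A n)]

theorem totalDifferential_lof_zero (d : ∀ n, A (n + 1) →ₗ[k] A n) (a : A 0) :
    totalDifferential k d (DirectSum.lof k ℕ A 0 a) = 0 := by
  simp [totalDifferential]

theorem totalDifferential_lof_succ (d : ∀ n, A (n + 1) →ₗ[k] A n) (n : ℕ) (a : A (n + 1)) :
    totalDifferential k d (DirectSum.lof k ℕ A (n + 1) a) = DirectSum.lof k ℕ A n (d n a) := by
  simp [totalDifferential]

theorem signInvolution_lof (n : ℕ) (a : A n) :
    signInvolution k A (DirectSum.lof k ℕ A n a) =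
      ((-1 : ℤ) ^ n) • DirectSum.lof k ℕ A n a := by
  rw [signInvolution, DirectSum.lmap_lof, LinearMap.smul_apply, LinearMap.id_apply, map_smul,
    ← Int.cast_smul_eq_zsmul k]
  push_cast
  rfl

theorem zsmul_tmul (z : ℤ) (a b : ⨁ n, A n) : (z • a) ⊗ₜ[k] b = z • (a ⊗ₜ[k] b) :=
  (TensorProduct.smul_tmul' _ _ _).symm

theorem tmul_zsmul (z : ℤ) (a b : ⨁ n, A n) : a ⊗ₜ[k] (z • b) = z • (a ⊗ₜ[k] b) :=
  TensorProduct.tmul_smul _ _ _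

end Graded

namespace SSet

variable {X : SSet.{u}}

/-- The map of vertices induced by a monotone self-map of the natural numbers, capped at `n`.
With natural numbers as vertices, iterated faces of simplices of varying dimension can be compared
without transport along equalities of dimensions. -/
def vertexHom (n l : ℕ) (θ : ℕ →o ℕ) : Fin (l + 1) →o Fin (n + 1) :=
  ⟨fun v => ⟨min (θ v) n, by omega⟩, fun _ _ h => min_le_min_right _ (θ.monotone h)⟩

/-- The order embedding of the natural numbers omitting the value `i`. -/
def skip (i : ℕ) : ℕ →o ℕ := ⟨fun v => if v < i then v else v + 1, fun a b h => by
  dsimp only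
  split_ifs <;> omega⟩

/-- The translation of the natural numbers by `j`. -/
def shift (j : ℕ) : ℕ →o ℕ := ⟨fun v => v + j, fun _ _ h => Nat.add_le_add_right h j⟩

theorem skip_apply (i v : ℕ) : skip i v = if v < i then v else v + 1 := rfl

theorem shift_apply (j v : ℕ) : shift j v = v + j := rfl

variable (k : Type v) [CommRing k]

/-- The chain of the simplex with vertices `x (θ 0), ..., x (θ l)`. -/
noncomputable def vertexCell {n : ℕ} (x : X.obj (op (SimplexCategory.mk n))) (l : ℕ)
    (θ : ℕ →o ℕ) : ⨁ n, X.NChains k n :=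
  totalCell k (restrict x (vertexHom n l θ))

theorem vertexCell_congr {n : ℕ} (x : X.obj (op (SimplexCategory.mk n))) {l l' : ℕ} (h : l = l')
    {θ θ' : ℕ →o ℕ} (hθ : ∀ v ≤ l, min (θ v) n = min (θ' v) n) :
    vertexCell k x l θ = vertexCell k x l' θ' := by
  subst h
  rw [vertexCell, vertexCell]
  congr 2
  ext v
  exact hθ v v.is_le

theorem vertexCell_restrict {n l m : ℕ} (x : X.obj (op (SimplexCategory.mk n))) (θ η : ℕ →o ℕ)
    (hη : ∀ v ≤ m, η v ≤ l) :
    vertexCell k (restrict x (vertexHom n l θ)) m η = vertexCell k x m (θ.comp η) := by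
  rw [vertexCell, vertexCell, restrict_restrict]
  congr 2
  ext v
  change min (θ (min (η v) l)) n = min (θ (η v)) n
  rw [min_eq_left (hη v v.is_le)]

theorem totalCell_eq_vertexCell {n : ℕ} (x : X.obj (op (SimplexCategory.mk n))) :
    totalCell k x = vertexCell k x n OrderHom.id := by
  rw [vertexCell]
  conv_lhs => rw [← restrict_id x]
  congr 2
  ext v
  exact (min_eq_left v.is_le).symm

theorem totalCell_interval {n : ℕ} (x : X.obj (op (SimplexCategory.mk n))) (j l : ℕ)
    (h : j + l ≤ n) : totalCell k (interval x j l h) = vertexCell k x l (shift j) := by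
  rw [vertexCell, interval]
  congr 2
  ext v
  have : (v : ℕ) ≤ l := v.is_le
  exact (min_eq_left (show (v : ℕ) + j ≤ n by omega)).symm

theorem totalCell_dFace {n : ℕ} (x : X.obj (op (SimplexCategory.mk (n + 1)))) (i : Fin (n + 2)) :
    totalCell k (dFace x i) = vertexCell k x n (skip i) := by
  rw [vertexCell, dFace]
  congr 2
  ext v
  have := v.is_le
  change (i.succAbove v : ℕ) = min (skip i v) (n + 1)
  rw [CubeMap.val_succAbove, skip_apply]
  split_ifs <;> omega

variable (X) in
/-- The differential on the total module of normalized chains. -/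
noncomputable abbrev totalD : (⨁ n, X.NChains k n) →ₗ[k] ⨁ n, X.NChains k n :=
  totalDifferential k (X.chainD k)

theorem totalD_totalCell_zero (x : X.obj (op (SimplexCategory.mk 0))) :
    totalD X k (totalCell k x) = 0 :=
  totalDifferential_lof_zero _ _

theorem totalD_totalCell_succ {n : ℕ} (x : X.obj (op (SimplexCategory.mk (n + 1)))) :
    totalD X k (totalCell k x) =
      ∑ i ∈ Finset.range (n + 2), (-1 : ℤ) ^ i • vertexCell k x n (skip i) := by
  rw [totalCell, totalDifferential_lof_succ, chainD_cell, map_sum, Finset.sum_range]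
  refine Finset.sum_congr rfl fun i _ => ?_
  rw [map_zsmul, ← totalCell_dFace]
  rfl

theorem totalD_vertexCell_zero {n : ℕ} (x : X.obj (op (SimplexCategory.mk n))) (θ : ℕ →o ℕ) :
    totalD X k (vertexCell k x 0 θ) = 0 :=
  totalD_totalCell_zero k _

theorem totalD_vertexCell_succ {n : ℕ} (x : X.obj (op (SimplexCategory.mk n))) (l : ℕ)
    (θ : ℕ →o ℕ) : totalD X k (vertexCell k x (l + 1) θ) =
      ∑ i ∈ Finset.range (l + 2), (-1 : ℤ) ^ i • vertexCell k x l (θ.comp (skip i)) := by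
  rw [vertexCell, totalD_totalCell_succ]
  refine Finset.sum_congr rfl fun i hi => ?_
  rw [vertexCell_restrict]
  intro v hv
  rw [skip_apply]
  have := Finset.mem_range.1 hi
  split_ifs <;> omega

variable (X) in
/-- The Alexander-Whitney diagonal of normalized chains. -/
noncomputable def chainComul :
    (⨁ n, X.NChains k n) →ₗ[k] (⨁ n, X.NChains k n) ⊗[k] ⨁ n, X.NChains k n :=
  totalLift (fun n x => ∑ i : Fin (n + 1), totalCell k (interval x 0 i (by omega)) ⊗ₜ[k]
      totalCell k (interval x i (n - i) (by omega))) (by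
    intro n x hx
    refine Finset.sum_eq_zero fun i _ => ?_
    cases n with
    | zero => exact (not_mem_degenerate_zero hx).elim
    | succ n =>
      obtain ⟨a, y, hy⟩ := exists_restrict_of_mem_degenerate hx
      by_cases h : (a : ℕ) < i
      · rw [totalCell_eq_zero, TensorProduct.zero_tmul]
        refine restrict_mem_degenerate_of_mem y hy _ ⟨a, by omega⟩ ⟨a + 1, by omega⟩ ?_ ?_ ?_
        · simp
        · rfl
        · rfl
      · rw [totalCell_eq_zero (k := k) (x := interval x i _ _), TensorProduct.tmul_zero]
        refine restrict_mem_degenerate_of_mem y hy _ ⟨a - i, by omega⟩ ⟨a + 1 - i, by omega⟩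
          ?_ ?_ ?_
        · simp only [ne_eq, Fin.mk.injEq]
          omega
        · apply Fin.ext
          change (a : ℕ) - i + i = a
          omega
        · apply Fin.ext
          change (a : ℕ) + 1 - i + i = a + 1
          omega)

theorem chainComul_totalCell {n : ℕ} (x : X.obj (op (SimplexCategory.mk n))) :
    chainComul X k (totalCell k x) = ∑ i : Fin (n + 1),
      totalCell k (interval x 0 i (by omega)) ⊗ₜ[k]
      totalCell k (interval x i (n - i) (by omega)) := by
  rw [chainComul, totalLift_totalCell]

theorem shift_zero : shift 0 = OrderHom.id := rfl

theorem chainComul_totalCell' {n : ℕ} (x : X.obj (op (SimplexCategory.mk n))) :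
    chainComul X k (totalCell k x) = ∑ i ∈ Finset.range (n + 1),
      vertexCell k x i OrderHom.id ⊗ₜ[k] vertexCell k x (n - i) (shift i) := by
  rw [chainComul_totalCell, Finset.sum_range]
  simp only [totalCell_interval, shift_zero]

theorem chainComul_vertexCell {n : ℕ} (x : X.obj (op (SimplexCategory.mk n))) (l : ℕ)
    (θ : ℕ →o ℕ) : chainComul X k (vertexCell k x l θ) = ∑ i ∈ Finset.range (l + 1),
      vertexCell k x i θ ⊗ₜ[k] vertexCell k x (l - i) (θ.comp (shift i)) := by
  rw [vertexCell, chainComul_totalCell']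
  refine Finset.sum_congr rfl fun i hi => ?_
  have := Finset.mem_range.1 hi
  rw [vertexCell_restrict, vertexCell_restrict]
  · rfl
  · intro v hv
    rw [shift_apply]
    omega
  · intro v hv
    simp only [OrderHom.id_coe, id_eq]
    omega

theorem chainComul_coassoc (a : ⨁ n, X.NChains k n) :
    TensorProduct.assoc k _ _ _ ((chainComul X k).rTensor _ (chainComul X k a)) =
      (chainComul X k).lTensor _ (chainComul X k a) := by
  suffices h : (TensorProduct.assoc k _ _ _).toLinearMap ∘ₗ
      (chainComul X k).rTensor _ ∘ₗ chainComul X k =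
      (chainComul X k).lTensor _ ∘ₗ chainComul X k from LinearMap.congr_fun h a
  apply total_hom_ext
  intro n x
  simp only [LinearMap.comp_apply, chainComul_totalCell', map_sum, LinearMap.rTensor_tmul,
    LinearMap.lTensor_tmul, chainComul_vertexCell, TensorProduct.sum_tmul, TensorProduct.tmul_sum,
    LinearEquiv.coe_coe, TensorProduct.assoc_tmul]
  rw [Finset.sum_sigma', Finset.sum_sigma']
  -- Both sides are sums over the pairs of cut points, which are described either as the end of a
  -- front face of a front face, or relative to the start of a back face.
  refine Finset.sum_bij' (fun p _ => ⟨p.2, p.1 - p.2⟩) (fun p _ => ⟨p.1 + p.2, p.1⟩)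
    ?_ ?_ ?_ ?_ ?_
  · rintro ⟨i, j⟩ h
    simp only [Finset.mem_sigma, Finset.mem_range] at h ⊢
    omega
  · rintro ⟨i, j⟩ h
    simp only [Finset.mem_sigma, Finset.mem_range] at h ⊢
    omega
  · rintro ⟨i, j⟩ h
    simp only [Finset.mem_sigma, Finset.mem_range] at h
    simp only [Sigma.mk.injEq, heq_eq_eq, and_true]
    omega
  · rintro ⟨i, j⟩ h
    simp only [Sigma.mk.injEq, heq_eq_eq, true_and]
    omega
  · rintro ⟨i, j⟩ h
    simp only [Finset.mem_sigma, Finset.mem_range] at h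
    dsimp only
    congr 1
    congr 1
    refine vertexCell_congr k x (by omega) fun v hv => ?_
    simp only [OrderHom.comp_coe, Function.comp_apply, shift_apply]
    congr 1
    omega

/-- The Alexander-Whitney diagonal is a chain map. -/
theorem chainComul_totalD (a : ⨁ n, X.NChains k n) :
    chainComul X k (totalD X k a) =
      (totalD X k).rTensor _ (chainComul X k a) +
        TensorProduct.map (signInvolution k (X.NChains k)) (totalD X k) (chainComul X k a) := by
  suffices h : chainComul X k ∘ₗ totalD X k = (totalD X k).rTensor _ ∘ₗ chainComul X k +
      TensorProduct.map (signInvolution k (X.NChains k)) (totalD X k) ∘ₗ chainComul X k from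
    LinearMap.congr_fun h a
  apply total_hom_ext
  intro n x
  have hsign (i : ℕ) : signInvolution k (X.NChains k) (vertexCell k x i OrderHom.id) =
      (-1 : ℤ) ^ i • vertexCell k x i OrderHom.id := signInvolution_lof _ _
  simp only [LinearMap.comp_apply, LinearMap.add_apply, chainComul_totalCell', map_sum,
    LinearMap.rTensor_tmul, TensorProduct.map_tmul, hsign, zsmul_tmul]
  cases n with
  | zero =>
    simp [totalD_totalCell_zero, totalD_vertexCell_zero]
  | succ n =>
    rw [Finset.sum_range_succ' _ (n + 1), Finset.sum_range_succ (fun i => (-1 : ℤ) ^ i • _),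
      totalD_totalCell_succ]
    simp only [Nat.sub_self, totalD_vertexCell_zero, TensorProduct.zero_tmul,
      TensorProduct.tmul_zero, smul_zero, add_zero, map_sum, map_zsmul, chainComul_vertexCell,
      Finset.smul_sum]
    -- For a fixed front dimension `j`, the faces omitting a vertex up to `j` differentiate the
    -- front factor, the others the back factor. The differential of the front factor of dimension
    -- `j + 1` has one more term, from its last vertex, which cancels against the one from the first
    -- vertex of the back factor.
    rw [Finset.sum_comm, ← Finset.sum_add_distrib]
    refine Finset.sum_congr rfl fun j hj => ?_
    have hj' := Finset.mem_range.1 hj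
    obtain ⟨m, rfl⟩ : ∃ m, n = j + m := ⟨n - j, by omega⟩
    have e1 : j + m + 1 - (j + 1) = m := by omega
    have e2 : j + m + 1 - j = m + 1 := by omega
    have e3 : j + m - j = m := by omega
    rw [e1, e2, e3, totalD_vertexCell_succ, totalD_vertexCell_succ,
      show j + m + 2 = (j + 1) + (m + 1) by omega, Finset.sum_range_add,
      Finset.sum_range_succ _ (j + 1), Finset.sum_range_succ' _ (m + 1)]
    simp only [TensorProduct.add_tmul, TensorProduct.tmul_add, TensorProduct.sum_tmul,
      TensorProduct.tmul_sum, zsmul_tmul, tmul_zsmul, smul_add, Finset.smul_sum, smul_smul,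
      pow_zero, one_smul]
    have h1 : vertexCell k x j (OrderHom.id.comp (skip (j + 1))) = vertexCell k x j OrderHom.id :=
      vertexCell_congr k x rfl fun v hv => by
        simp only [OrderHom.comp_coe, Function.comp_apply, skip_apply, OrderHom.id_coe, id_eq]
        rw [if_pos (by omega)]
    have h2 : vertexCell k x m ((shift j).comp (skip 0)) = vertexCell k x m (shift (j + 1)) :=
      vertexCell_congr k x rfl fun v hv => by
        simp only [OrderHom.comp_coe, Function.comp_apply, skip_apply, shift_apply]
        rw [if_neg (by omega)]
        congr 1
        omega
    rw [h1, h2]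
    have h3 : ∀ i ∈ Finset.range (j + 1), (-1 : ℤ) ^ i • vertexCell k x j (skip i) ⊗ₜ[k]
        vertexCell k x m ((skip i).comp (shift j)) =
        (-1 : ℤ) ^ i • vertexCell k x j (OrderHom.id.comp (skip i)) ⊗ₜ[k]
          vertexCell k x m (shift (j + 1)) := fun i hi => by
      have hi' := Finset.mem_range.1 hi
      rw [vertexCell_congr k x rfl (θ := (skip i).comp (shift j)) (θ' := shift (j + 1))]
      · rfl
      · intro v hv
        simp only [OrderHom.comp_coe, Function.comp_apply, skip_apply, shift_apply]
        rw [if_neg (by omega)]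
        congr 1
    have h4 : ∀ i ∈ Finset.range (m + 1), (-1 : ℤ) ^ (j + 1 + i) •
        vertexCell k x j (skip (j + 1 + i)) ⊗ₜ[k]
          vertexCell k x m ((skip (j + 1 + i)).comp (shift j)) =
        ((-1 : ℤ) ^ j * (-1) ^ (i + 1)) • vertexCell k x j OrderHom.id ⊗ₜ[k]
          vertexCell k x m ((shift j).comp (skip (i + 1))) := fun i hi => by
      rw [vertexCell_congr k x rfl (θ := (skip (j + 1 + i)).comp (shift j))
        (θ' := (shift j).comp (skip (i + 1))),
        vertexCell_congr k x rfl (θ := skip (j + 1 + i)) (θ' := OrderHom.id)]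
      · congr 1
        ring
      · intro v hv
        simp only [skip_apply, OrderHom.id_coe, id_eq]
        rw [if_pos (by omega)]
      · intro v hv
        simp only [OrderHom.comp_coe, Function.comp_apply, skip_apply, shift_apply]
        split_ifs <;> congr 1 <;> omega
    rw [Finset.sum_congr rfl h3, Finset.sum_congr rfl h4, pow_succ]
    simp only [mul_neg, mul_one, neg_smul]
    abel

variable (X) in
/-- The augmentation of normalized chains. -/
noncomputable def chainCounit : (⨁ n, X.NChains k n) →ₗ[k] k :=
  totalLift (fun n _ => if n = 0 then 1 else 0) (by
    intro n x hx
    rw [if_neg]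
    rintro rfl
    exact not_mem_degenerate_zero hx)

theorem chainCounit_totalCell {n : ℕ} (x : X.obj (op (SimplexCategory.mk n))) :
    chainCounit X k (totalCell k x) = if n = 0 then 1 else 0 := by
  rw [chainCounit, totalLift_totalCell]

theorem chainCounit_vertexCell {n : ℕ} (x : X.obj (op (SimplexCategory.mk n))) (l : ℕ)
    (θ : ℕ →o ℕ) : chainCounit X k (vertexCell k x l θ) = if l = 0 then 1 else 0 :=
  chainCounit_totalCell k _

theorem chainCounit_rTensor_chainComul (a : ⨁ n, X.NChains k n) :
    (chainCounit X k).rTensor _ (chainComul X k a) = 1 ⊗ₜ[k] a := by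
  suffices h : (chainCounit X k).rTensor _ ∘ₗ chainComul X k = TensorProduct.mk k k _ 1 from
    LinearMap.congr_fun h a
  apply total_hom_ext
  intro n x
  simp only [LinearMap.comp_apply, chainComul_totalCell', map_sum, LinearMap.rTensor_tmul,
    chainCounit_vertexCell, TensorProduct.mk_apply]
  rw [Finset.sum_eq_single 0]
  · rw [if_pos rfl, totalCell_eq_vertexCell]
    rfl
  · intro i _ hi
    rw [if_neg hi, TensorProduct.zero_tmul]
  · simp

theorem chainCounit_lTensor_chainComul (a : ⨁ n, X.NChains k n) :
    (chainCounit X k).lTensor _ (chainComul X k a) = a ⊗ₜ[k] 1 := by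
  suffices h : (chainCounit X k).lTensor _ ∘ₗ chainComul X k =
      (TensorProduct.mk k _ k).flip 1 from LinearMap.congr_fun h a
  apply total_hom_ext
  intro n x
  simp only [LinearMap.comp_apply, chainComul_totalCell', map_sum, LinearMap.lTensor_tmul,
    chainCounit_vertexCell, LinearMap.flip_apply, TensorProduct.mk_apply]
  rw [Finset.sum_eq_single n]
  · rw [if_pos (Nat.sub_self n), totalCell_eq_vertexCell]
  · intro i hi hin
    have := Finset.mem_range.1 hi
    rw [if_neg (by omega), TensorProduct.tmul_zero]
  · simp

theorem chainCounit_totalD (a : ⨁ n, X.NChains k n) : chainCounit X k (totalD X k a) = 0 := by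
  suffices h : chainCounit X k ∘ₗ totalD X k = 0 from LinearMap.congr_fun h a
  apply total_hom_ext
  intro n x
  cases n with
  | zero => simp [totalD_totalCell_zero]
  | succ n =>
    simp only [LinearMap.comp_apply, totalD_totalCell_succ, map_sum, map_zsmul,
      chainCounit_vertexCell, LinearMap.zero_apply]
    split_ifs with h
    · subst h
      simp [Finset.sum_range_succ]
    · simp

end SSet

/-! ### Multiplicativity of shuffle signs -/

/-- The sign of a shuffle counts the pairs `y < x` with `x` in `α` and `y` outside of `α`. -/
theorem shuffleSign_eq_prod {n : ℕ} (α : Finset (Fin n)) :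
    shuffleSign α = ∏ y, ∏ x, if x ∈ α ∧ y ∉ α ∧ y < x then -1 else 1 := by
  have hn : α.card + αᶜ.card = n := by simp
  set σ := shufflePerm hn α rfl rfl 1 1 with hσ
  have h1 : shuffleSign α = (Equiv.Perm.sign σ : ℤ) := by
    rw [hσ, sign_shufflePerm]
    simp
  rw [h1, Equiv.Perm.sign_eq_prod_prod_Iio]
  push_cast
  have key (x y : Fin n) : (σ.symm x < σ.symm y ∧ ¬ x < y) ↔ (x ∈ α ∧ y ∉ α ∧ y < x) := by
    have hx := shufflePerm_symm_lt_iff (hn := hn) (α := α) (h := rfl) (hc := rfl) (ρ := 1)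
      (τ := 1) x
    have hy := shufflePerm_symm_lt_iff (hn := hn) (α := α) (h := rfl) (hc := rfl) (ρ := 1)
      (τ := 1) y
    rw [← hσ] at hx hy
    by_cases hxα : x ∈ α <;> by_cases hyα : y ∈ α
    · obtain ⟨i, rfl⟩ := exists_orderEmbOfFin rfl hxα
      obtain ⟨j, rfl⟩ := exists_orderEmbOfFin rfl hyα
      simp only [hyα, not_true, false_and, and_false, iff_false, not_and, not_not]
      rw [hσ, shufflePerm_symm_orderEmb, shufflePerm_symm_orderEmb, OrderEmbedding.lt_iff_lt]
      exact fun h => h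
    · have : x ≠ y := fun h => hyα (h ▸ hxα)
      have : (x : ℕ) ≠ y := fun h => this (Fin.ext h)
      simp only [hxα, hyα, iff_true, iff_false, not_lt] at hx hy
      simp only [hxα, hyα, not_false_eq_true, true_and, Fin.lt_def]
      omega
    · simp only [hxα, hyα, iff_true, iff_false, not_lt] at hx hy
      simp only [hxα, false_and, iff_false, Fin.lt_def]
      omega
    · obtain ⟨i, rfl⟩ := exists_orderEmbOfFin rfl (Finset.mem_compl.2 hxα)
      obtain ⟨j, rfl⟩ := exists_orderEmbOfFin rfl (Finset.mem_compl.2 hyα)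
      simp only [hxα, false_and, iff_false, not_and, not_not]
      rw [hσ, shufflePerm_symm_orderEmb_compl, shufflePerm_symm_orderEmb_compl,
        OrderEmbedding.lt_iff_lt]
      exact fun h => Nat.lt_of_add_lt_add_left h
  rw [← Equiv.prod_comp σ (fun y => ∏ x, if x ∈ α ∧ y ∉ α ∧ y < x then (-1 : ℤ) else 1)]
  refine Finset.prod_congr rfl fun j _ => ?_
  rw [← Equiv.prod_comp σ (fun x => if x ∈ α ∧ σ j ∉ α ∧ σ j < x then (-1 : ℤ) else 1)]
  simp only [← key, Equiv.symm_apply_apply]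
  rw [← Finset.prod_subset (Finset.subset_univ (Finset.Iio j)) fun i _ hi => if_neg fun h =>
    hi (Finset.mem_Iio.2 h.1)]
  · refine Finset.prod_congr rfl fun i hi => ?_
    rw [Finset.mem_Iio] at hi
    by_cases h : σ i < σ j <;> simp [h, hi]

/-- The disjoint union of two sets of coordinates in `2^{p+q} = 2^p × 2^q`. -/
def joinFinset {p q : ℕ} (α : Finset (Fin p)) (β : Finset (Fin q)) : Finset (Fin (p + q)) :=
  α.map (Fin.castAddEmb q) ∪ β.map (Fin.natAddEmb p)

section Join

variable {p q : ℕ} (α : Finset (Fin p)) (β : Finset (Fin q))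

@[simp]
theorem castAdd_mem_joinFinset (i : Fin p) : Fin.castAdd q i ∈ joinFinset α β ↔ i ∈ α := by
  simp only [joinFinset, Finset.mem_union, Finset.mem_map, Fin.castAddEmb_apply,
    Fin.natAddEmb_apply]
  constructor
  · rintro (⟨a, ha, h⟩ | ⟨b, hb, h⟩)
    · rwa [← Fin.castAdd_injective _ _ h]
    · have := congrArg Fin.val h
      simp only [Fin.val_natAdd, Fin.val_castAdd] at this
      omega
  · exact fun h => Or.inl ⟨i, h, rfl⟩

@[simp]
theorem natAdd_mem_joinFinset (i : Fin q) : Fin.natAdd p i ∈ joinFinset α β ↔ i ∈ β := by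
  simp only [joinFinset, Finset.mem_union, Finset.mem_map, Fin.castAddEmb_apply,
    Fin.natAddEmb_apply]
  constructor
  · rintro (⟨a, ha, h⟩ | ⟨b, hb, h⟩)
    · have := congrArg Fin.val h
      simp only [Fin.val_natAdd, Fin.val_castAdd] at this
      omega
    · rwa [← Fin.natAdd_injective _ _ h]
  · exact fun h => Or.inr ⟨i, h, rfl⟩

theorem joinFinset_compl : (joinFinset α β)ᶜ = joinFinset αᶜ βᶜ := by
  ext x
  refine Fin.addCases (fun i => ?_) (fun i => ?_) x <;> simp

theorem card_joinFinset : (joinFinset α β).card = α.card + β.card := by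
  rw [joinFinset, Finset.card_union_of_disjoint, Finset.card_map, Finset.card_map]
  rw [Finset.disjoint_left]
  simp only [Finset.mem_map, Fin.castAddEmb_apply, Fin.natAddEmb_apply]
  rintro x ⟨a, _, rfl⟩ ⟨b, _, h⟩
  have := congrArg Fin.val h
  simp only [Fin.val_natAdd, Fin.val_castAdd] at this
  omega

theorem joinFinset_bijective : Function.Bijective
    fun x : Finset (Fin p) × Finset (Fin q) => joinFinset x.1 x.2 := by
  rw [Fintype.bijective_iff_injective_and_card]
  constructor
  · rintro ⟨α, β⟩ ⟨α', β'⟩ h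
    dsimp only at h
    refine Prod.ext (Finset.ext fun i => ?_) (Finset.ext fun i => ?_)
    · rw [← castAdd_mem_joinFinset α β, h, castAdd_mem_joinFinset]
    · rw [← natAdd_mem_joinFinset α β, h, natAdd_mem_joinFinset]
  · simp [pow_add]

/-- The sign relating the diagonal of a product of cubes to the product of their diagonals: the
pairs with one coordinate in each factor contribute the Koszul sign. -/
theorem shuffleSign_joinFinset : shuffleSign (joinFinset α β) =
    shuffleSign α * shuffleSign β * (-1) ^ (β.card * αᶜ.card) := by
  simp only [shuffleSign_eq_prod, Fin.prod_univ_add, castAdd_mem_joinFinset,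
    natAdd_mem_joinFinset]
  have h1 (y : Fin q) (x : Fin p) : ¬ Fin.natAdd p y < Fin.castAdd q x := by
    simp only [Fin.lt_def, Fin.val_natAdd, Fin.val_castAdd]
    omega
  have h2 (y : Fin p) (x : Fin q) : Fin.castAdd q y < Fin.natAdd p x := by
    simp only [Fin.lt_def, Fin.val_natAdd, Fin.val_castAdd]
    omega
  have h3 (y x : Fin p) : Fin.castAdd q y < Fin.castAdd q x ↔ y < x := Iff.rfl
  have h4 (y x : Fin q) : Fin.natAdd p y < Fin.natAdd p x ↔ y < x := by
    simp only [Fin.lt_def, Fin.val_natAdd]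
    omega
  simp only [h1, h2, h3, h4, and_false, if_false, Finset.prod_const_one, one_mul, and_true,
    Finset.prod_mul_distrib]
  have h5 : (∏ y : Fin p, ∏ x : Fin q, if x ∈ β ∧ y ∉ α then (-1 : ℤ) else 1) =
      (-1) ^ (β.card * αᶜ.card) := by
    have (y : Fin p) : (∏ x : Fin q, if x ∈ β ∧ y ∉ α then (-1 : ℤ) else 1) =
        if y ∈ αᶜ then (-1) ^ β.card else 1 := by
      by_cases hy : y ∈ α
      · simp [hy]
      · simp [hy, Finset.prod_ite_mem]
    simp only [this, Finset.prod_ite_mem, Finset.univ_inter, Finset.prod_const]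
    rw [← pow_mul]
  rw [h5]
  ring

end Join

theorem middleSwap_tmul {k : Type v} [CommRing k] {A : ℕ → Type w} [∀ n, AddCommGroup (A n)]
    [∀ n, Module k (A n)] {p q : ℕ} (a b' : ⨁ n, A n) (b : A q) (a' : A p) :
    middleSwap k A ((a ⊗ₜ[k] DirectSum.lof k ℕ A q b) ⊗ₜ[k] (DirectSum.lof k ℕ A p a' ⊗ₜ[k] b')) =
      ((-1 : ℤ) ^ (p * q)) • ((a ⊗ₜ[k] DirectSum.lof k ℕ A p a') ⊗ₜ[k]
        (DirectSum.lof k ℕ A q b ⊗ₜ[k] b')) := by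
  simp only [middleSwap, LinearMap.comp_apply, LinearEquiv.coe_coe, TensorProduct.assoc_tmul,
    LinearMap.lTensor_tmul, TensorProduct.assoc_symm_tmul, LinearMap.rTensor_tmul,
    TensorProduct.gradedComm_of_tmul_of]
  rw [Units.smul_def, ← Int.cast_smul_eq_zsmul k, ← Int.cast_smul_eq_zsmul k]
  simp only [TensorProduct.smul_tmul', TensorProduct.tmul_smul,
    TensorProduct.assoc_tmul, TensorProduct.assoc_symm_tmul]
  simp

/-! ### The chain bialgebra of a simplicial monoid -/

/-- The extension of a finite sequence by zeros. -/
def extendZero {n : ℕ} (t : Fin n → Fin 2) (i : ℕ) : Fin 2 := if h : i < n then t ⟨i, h⟩ else 0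

/-- The insertion of `ε` at position `j` into an infinite sequence. -/
def insertAt (ε : Fin 2) (j : ℕ) (t : ℕ → Fin 2) (i : ℕ) : Fin 2 :=
  if i < j then t i else if i = j then ε else t (i - 1)

theorem extendZero_mono {n : ℕ} {t t' : Fin n → Fin 2} (h : t ≤ t') (i : ℕ) :
    extendZero t i ≤ extendZero t' i := by
  unfold extendZero
  split_ifs
  · exact h _
  · exact le_rfl

theorem extendZero_val {n : ℕ} (t : Fin n → Fin 2) (i : Fin n) : extendZero t i = t i := by
  simp [extendZero]

theorem extendZero_cast {m n : ℕ} (h : m = n) (t : Fin m → Fin 2) (t' : Fin n → Fin 2)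
    (ht : ∀ i, t i = t' (Fin.cast h i)) : extendZero t = extendZero t' := by
  subst h
  rw [show t = t' from funext ht]

/-- The face map `2^{n-1} → 2^n` inserting `ε` at position `j`. For `n = 0` it is the identity,
which never occurs in a sum over `j < n`. This form of the face maps avoids successors in the
dimension, which are inconvenient when faces of a product are identified with products. -/
def boundaryHom {n : ℕ} (ε : Fin 2) (j : ℕ) : (Fin (n - 1) → Fin 2) →o (Fin n → Fin 2) :=
  ⟨fun t i => insertAt ε j (extendZero t) i, fun t t' h i => by
    dsimp only
    unfold insertAt
    split_ifs
    · exact extendZero_mono h _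
    · exact le_rfl
    · exact extendZero_mono h _⟩

theorem boundaryHom_apply {n : ℕ} (ε : Fin 2) (j : ℕ) (t : Fin (n - 1) → Fin 2) (i : Fin n) :
    boundaryHom ε j t i = insertAt ε j (extendZero t) i := rfl

namespace SingularCube

variable {X : SSet.{u}} {n : ℕ} (k : Type v) [CommRing k]

theorem faceHom_eq_boundaryHom (ε : Fin 2) (i : Fin (n + 1)) :
    faceHom ε i = boundaryHom (n := n + 1) ε i := by
  ext t : 2
  refine CubeMap.face_eq ε i t _ ?_ fun j => ?_
  · change insertAt ε i (extendZero t) i = ε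
    simp [insertAt]
  · rw [boundaryHom_apply, insertAt, CubeMap.val_succAbove]
    have e : ∀ a : ℕ, a = j → extendZero (n := n) t a = t j := by
      rintro _ rfl
      exact extendZero_val t j
    split_ifs <;> first | omega | exact e _ (by omega)

theorem totalD_totalChain (c : SingularCube X n) : SSet.totalD X k (c.totalChain k) =
    ∑ j ∈ Finset.range n, (-1 : ℤ) ^ (j + 1) •
      ((c.comp (boundaryHom 0 j)).totalChain k - (c.comp (boundaryHom 1 j)).totalChain k) := by
  cases n with
  | zero => exact totalDifferential_lof_zero _ _
  | succ n =>
    rw [totalChain, totalDifferential_lof_succ, chainD_chain, map_sum, Finset.sum_range]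
    refine Finset.sum_congr rfl fun i _ => ?_
    rw [map_zsmul, map_sub, faceHom_eq_boundaryHom, faceHom_eq_boundaryHom]
    rfl

theorem chainComul_totalChain (c : SingularCube X n) : SSet.chainComul X k (c.totalChain k) =
    ∑ α : Finset (Fin n), shuffleSign α • ((c.comp (inclHom α 0)).totalChain k ⊗ₜ[k]
      (c.comp (inclHom αᶜ 1)).totalChain k) := by
  rw [← sum_interval_tmul_interval, totalChain_eq_sum, map_sum]
  exact Finset.sum_congr rfl fun π _ => by rw [map_zsmul, SSet.chainComul_totalCell]

theorem chainCounit_totalChain (c : SingularCube X n) :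
    SSet.chainCounit X k (c.totalChain k) = if n = 0 then 1 else 0 := by
  rw [totalChain_eq_sum, map_sum]
  simp only [map_zsmul, SSet.chainCounit_totalCell]
  split_ifs with h
  · subst h
    simp
  · simp

end SingularCube

namespace SimplicialMonoid

open SingularCube

variable {X : SSet.{u}} (G : SimplicialMonoid X) (k : Type v) [CommRing k]

/-- The unit as a singular cube of dimension `0`. -/
def oneCube : SingularCube X 0 where
  toFun {_} _ := G.one _
  toFun_comp _ _ := (G.map_one _).symm

theorem totalChain_oneCube :
    G.oneCube.totalChain k = SSet.totalCell k (G.one (op (SimplexCategory.mk 0))) := by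
  rw [totalChain_eq_sum]
  simp [oneCube]

theorem totalChain_oneCube_cubeMul {p : ℕ} (c : SingularCube X p) :
    (G.cubeMul G.oneCube c).totalChain k = c.totalChain k := by
  refine totalChain_congr (Nat.zero_add p) _ _ fun m s s' hs => ?_
  refine (G.one_mul _).trans ?_
  congr 1
  ext v i : 3
  refine (hs v _).trans ?_
  ext
  simp

theorem totalChain_cubeMul_oneCube {p : ℕ} (c : SingularCube X p) :
    (G.cubeMul c G.oneCube).totalChain k = c.totalChain k := by
  refine totalChain_congr (Nat.add_zero p) _ _ fun m s s' hs => ?_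
  refine (G.mul_one _).trans ?_
  congr 1
  ext v i : 3
  exact hs v _

theorem totalChain_cubeMul_assoc {p q r : ℕ} (a : SingularCube X p) (b : SingularCube X q)
    (c : SingularCube X r) : (G.cubeMul (G.cubeMul a b) c).totalChain k =
      (G.cubeMul a (G.cubeMul b c)).totalChain k := by
  refine totalChain_congr (Nat.add_assoc p q r) _ _ fun m s s' hs => ?_
  refine (G.mul_assoc _ _ _).trans ?_
  change G.mul _ (G.mul _ _) = G.mul _ (G.mul _ _)
  congr 2
  · ext v i : 3
    exact hs v _
  · congr 1
    ext v i : 3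
    exact hs v _
  · congr 1
    ext v i : 3
    refine (hs v _).trans ?_
    exact congrArg (s v) (Fin.ext (Nat.add_assoc p q i))

/-- If `F` is the product of two maps `f` and `f'` of cubes, up to an equality of dimensions, then
composing a product of singular cubes with `F` amounts to composing the factors with `f` and `f'`.
-/
theorem totalChain_cubeMul_comp {p q p' q' m : ℕ} (c : SingularCube X p) (c' : SingularCube X q)
    (h : m = p' + q') (F : (Fin m → Fin 2) →o (Fin (p + q) → Fin 2))
    (f : (Fin p' → Fin 2) →o (Fin p → Fin 2)) (f' : (Fin q' → Fin 2) →o (Fin q → Fin 2))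
    (h1 : ∀ (t : Fin (p' + q') → Fin 2) (t' : Fin m → Fin 2), (∀ i, t' i = t (Fin.cast h i)) →
      ∀ i, F t' (Fin.castAdd q i) = f (CubeMap.fstHom p' q' t) i)
    (h2 : ∀ (t : Fin (p' + q') → Fin 2) (t' : Fin m → Fin 2), (∀ i, t' i = t (Fin.cast h i)) →
      ∀ i, F t' (Fin.natAdd p i) = f' (CubeMap.sndHom p' q' t) i) :
    ((G.cubeMul c c').comp F).totalChain k = (G.cubeMul (c.comp f) (c'.comp f')).totalChain k := by
  refine totalChain_congr h _ _ fun l s s' hs => ?_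
  change G.mul _ _ = G.mul _ _
  congr 2
  · ext v i : 3
    exact h1 _ _ (hs v) i
  · ext v i : 3
    exact h2 _ _ (hs v) i

theorem totalChain_cubeMul_boundary_left {p q : ℕ} (c : SingularCube X p) (c' : SingularCube X q)
    (ε : Fin 2) {j : ℕ} (hj : j < p) : ((G.cubeMul c c').comp (boundaryHom ε j)).totalChain k =
      (G.cubeMul (c.comp (boundaryHom ε j)) c').totalChain k := by
  refine totalChain_cubeMul_comp G k c c' (by omega : p + q - 1 = p - 1 + q) _
    (boundaryHom ε j) OrderHom.id (fun t t' ht i => ?_) (fun t t' ht i => ?_)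
  · rw [boundaryHom_apply, boundaryHom_apply, extendZero_cast _ t' t ht]
    have key : ∀ a, a < p - 1 →
        extendZero t a = extendZero (CubeMap.fstHom (p - 1) q t) a := by
      intro a ha
      rw [extendZero, extendZero, dif_pos ha, dif_pos (by omega)]
      rfl
    have := i.2
    simp only [insertAt, Fin.val_castAdd]
    split_ifs
    · exact key _ (by omega)
    · rfl
    · exact key _ (by omega)
  · rw [boundaryHom_apply, extendZero_cast _ t' t ht]
    have := i.2
    simp only [insertAt, Fin.val_natAdd]
    rw [if_neg (by omega), if_neg (by omega), extendZero, dif_pos (by omega)]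
    change t _ = t _
    congr 1
    ext
    simp only [Fin.val_natAdd]
    omega

theorem totalChain_cubeMul_boundary_right {p q : ℕ} (c : SingularCube X p) (c' : SingularCube X q)
    (ε : Fin 2) {j : ℕ} (hj : j < q) :
    ((G.cubeMul c c').comp (boundaryHom ε (p + j))).totalChain k =
      (G.cubeMul c (c'.comp (boundaryHom ε j))).totalChain k := by
  refine totalChain_cubeMul_comp G k c c' (by omega : p + q - 1 = p + (q - 1)) _
    OrderHom.id (boundaryHom ε j) (fun t t' ht i => ?_) (fun t t' ht i => ?_)
  · rw [boundaryHom_apply, extendZero_cast _ t' t ht]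
    have := i.2
    simp only [insertAt, Fin.val_castAdd]
    rw [if_pos (by omega), extendZero, dif_pos (by omega)]
    rfl
  · rw [boundaryHom_apply, boundaryHom_apply, extendZero_cast _ t' t ht]
    have key : ∀ a, a < q - 1 →
        extendZero t (p + a) = extendZero (CubeMap.sndHom p (q - 1) t) a := by
      intro a ha
      rw [extendZero, extendZero, dif_pos ha, dif_pos (by omega)]
      rfl
    have := i.2
    simp only [insertAt, Fin.val_natAdd, Nat.add_lt_add_iff_left, Nat.add_left_cancel_iff]
    split_ifs
    · exact key _ (by omega)
    · rfl
    · rw [← key _ (by omega)]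
      congr 1
      omega

end SimplicialMonoid

theorem joinFinset_orderEmb {p q : ℕ} (α : Finset (Fin p)) (β : Finset (Fin q))
    (j : Fin (joinFinset α β).card) : (joinFinset α β).orderEmbOfFin rfl j =
      Fin.append (fun i => Fin.castAdd q (α.orderEmbOfFin rfl i))
        (fun i => Fin.natAdd p (β.orderEmbOfFin rfl i)) (Fin.cast (card_joinFinset α β) j) := by
  refine (congrFun (Finset.orderEmbOfFin_unique rfl (f := fun j => Fin.append
    (fun i => Fin.castAdd q (α.orderEmbOfFin rfl i))
    (fun i => Fin.natAdd p (β.orderEmbOfFin rfl i)) (Fin.cast (card_joinFinset α β) j))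
    (fun j => ?_) fun a b h => ?_) j).symm
  · refine Fin.addCases (fun i => ?_) (fun i => ?_) (Fin.cast (card_joinFinset α β) j) <;> simp
  · have h' : Fin.cast (card_joinFinset α β) a < Fin.cast (card_joinFinset α β) b := h
    dsimp only
    generalize Fin.cast (card_joinFinset α β) a = a' at h' ⊢
    generalize Fin.cast (card_joinFinset α β) b = b' at h' ⊢
    revert h'
    refine Fin.addCases (fun i => ?_) (fun i => ?_) a' <;>
    refine Fin.addCases (fun j => ?_) (fun j => ?_) b' <;>
    intro h'
    · rw [Fin.append_left, Fin.append_left]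
      exact (α.orderEmbOfFin rfl).strictMono (show i < j from h')
    · rw [Fin.append_left, Fin.append_right, Fin.lt_def, Fin.val_castAdd, Fin.val_natAdd]
      omega
    · rw [Fin.lt_def, Fin.val_castAdd, Fin.val_natAdd] at h'
      omega
    · rw [Fin.append_right, Fin.append_right, Fin.lt_def, Fin.val_natAdd, Fin.val_natAdd]
      rw [Fin.lt_def, Fin.val_natAdd, Fin.val_natAdd] at h'
      exact Nat.add_lt_add_left ((β.orderEmbOfFin rfl).strictMono (Nat.lt_of_add_lt_add_left h')) p

theorem map_lift_middleSwap {k : Type v} [CommRing k] {A : ℕ → Type w} [∀ n, AddCommGroup (A n)]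
    [∀ n, Module k (A n)] (μ : (⨁ n, A n) →ₗ[k] (⨁ n, A n) →ₗ[k] ⨁ n, A n) (y z : ℤ) {p q : ℕ}
    (a b' : ⨁ n, A n) (b : A q) (a' : A p) :
    TensorProduct.map (TensorProduct.lift μ) (TensorProduct.lift μ) (middleSwap k A
      ((y • (a ⊗ₜ[k] DirectSum.lof k ℕ A q b)) ⊗ₜ[k] (z • (DirectSum.lof k ℕ A p a' ⊗ₜ[k] b')))) =
      (y * z * (-1) ^ (p * q)) • (μ a (DirectSum.lof k ℕ A p a') ⊗ₜ[k]
        μ (DirectSum.lof k ℕ A q b) b') := by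
  rw [← Int.cast_smul_eq_zsmul k, ← Int.cast_smul_eq_zsmul k, ← Int.cast_smul_eq_zsmul k,
    ← TensorProduct.smul_tmul', TensorProduct.tmul_smul, map_smul, map_smul, map_smul, map_smul,
    middleSwap_tmul, ← Int.cast_smul_eq_zsmul k, map_smul, smul_smul, smul_smul,
    TensorProduct.map_tmul, TensorProduct.lift.tmul, TensorProduct.lift.tmul]
  congr 1
  push_cast
  ring

/-- The product of the diagonals of two elements in the tensor square of a graded algebra, as a
bilinear map. -/
noncomputable def tensorMul {k : Type v} [CommRing k] {A : ℕ → Type w} [∀ n, AddCommGroup (A n)]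
    [∀ n, Module k (A n)] (μ : (⨁ n, A n) →ₗ[k] (⨁ n, A n) →ₗ[k] ⨁ n, A n)
    (δ : (⨁ n, A n) →ₗ[k] (⨁ n, A n) ⊗[k] ⨁ n, A n) :
    (⨁ n, A n) →ₗ[k] (⨁ n, A n) →ₗ[k] (⨁ n, A n) ⊗[k] ⨁ n, A n :=
  ((TensorProduct.mk k _ _).compl₁₂ δ δ).compr₂
    (TensorProduct.map (TensorProduct.lift μ) (TensorProduct.lift μ) ∘ₗ middleSwap k A)

theorem tensorMul_apply {k : Type v} [CommRing k] {A : ℕ → Type w} [∀ n, AddCommGroup (A n)]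
    [∀ n, Module k (A n)] (μ : (⨁ n, A n) →ₗ[k] (⨁ n, A n) →ₗ[k] ⨁ n, A n)
    (δ : (⨁ n, A n) →ₗ[k] (⨁ n, A n) ⊗[k] ⨁ n, A n) (a b : ⨁ n, A n) :
    tensorMul μ δ a b = TensorProduct.map (TensorProduct.lift μ) (TensorProduct.lift μ)
      (middleSwap k A (δ a ⊗ₜ[k] δ b)) := rfl

/-- The product of two diagonals that are given as sums of tensors of homogeneous elements. -/
theorem tensorMul_apply_of_eq_sum {k : Type v} [CommRing k] {A : ℕ → Type w}
    [∀ n, AddCommGroup (A n)] [∀ n, Module k (A n)]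
    (μ : (⨁ n, A n) →ₗ[k] (⨁ n, A n) →ₗ[k] ⨁ n, A n)
    (δ : (⨁ n, A n) →ₗ[k] (⨁ n, A n) ⊗[k] ⨁ n, A n) (a b : ⨁ n, A n)
    {ι κ : Type*} [Fintype ι] [Fintype κ] {r r' : ι → ℕ} {s s' : κ → ℕ} {y : ι → ℤ} {z : κ → ℤ}
    {f : ∀ i, A (r i)} {f' : ∀ i, A (r' i)} {g : ∀ j, A (s j)} {g' : ∀ j, A (s' j)}
    (ha : δ a = ∑ i, y i • (DirectSum.lof k ℕ A (r i) (f i) ⊗ₜ[k]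
      DirectSum.lof k ℕ A (r' i) (f' i)))
    (hb : δ b = ∑ j, z j • (DirectSum.lof k ℕ A (s j) (g j) ⊗ₜ[k]
      DirectSum.lof k ℕ A (s' j) (g' j))) :
    tensorMul μ δ a b = ∑ i, ∑ j, (y i * z j * (-1) ^ (s j * r' i)) •
      (μ (DirectSum.lof k ℕ A (r i) (f i)) (DirectSum.lof k ℕ A (s j) (g j)) ⊗ₜ[k]
        μ (DirectSum.lof k ℕ A (r' i) (f' i)) (DirectSum.lof k ℕ A (s' j) (g' j))) := by
  rw [tensorMul_apply, ha, hb]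
  simp only [TensorProduct.sum_tmul, TensorProduct.tmul_sum, map_sum]
  rw [Finset.sum_comm]
  exact Finset.sum_congr rfl fun i _ => Finset.sum_congr rfl fun j _ =>
    map_lift_middleSwap μ (y i) (z j) _ _ (f' i) (g j)

theorem SingularCube.totalChain_eq_lof {X : SSet.{u}} (k : Type v) [CommRing k] {n : ℕ}
    (c : SingularCube X n) :
    c.totalChain k = DirectSum.lof k ℕ (X.NChains k) n (c.chain k) := rfl

/-- Bilinear maps on normalized chains agree if they do so on the chains of singular cubes. -/
theorem SSet.cube_hom_ext₂ {X X' : SSet.{u}} {k : Type v} [CommRing k] {V : Type w} [AddCommGroup V]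
    [Module k V] {f g : (⨁ n, X.NChains k n) →ₗ[k] (⨁ n, X'.NChains k n) →ₗ[k] V}
    (h : ∀ (p q : ℕ) (c : SingularCube X p) (c' : SingularCube X' q),
      f (c.totalChain k) (c'.totalChain k) = g (c.totalChain k) (c'.totalChain k)) (a b) :
    f a b = g a b := by
  suffices f = g by rw [this]
  exact total_hom_ext_cube fun p c => total_hom_ext_cube fun q c' => h p q c c'

namespace SimplicialMonoid

open SingularCube

variable {X : SSet.{u}} (G : SimplicialMonoid X) (k : Type v) [CommRing k]

/-- A face of a product of singular cubes is the product of faces of the factors. -/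
theorem totalChain_cubeMul_inclHom {p q : ℕ} (c : SingularCube X p) (c' : SingularCube X q)
    (α : Finset (Fin p)) (β : Finset (Fin q)) (ε : Fin 2) {γ : Finset (Fin (p + q))}
    (hγ : γ = joinFinset α β) : ((G.cubeMul c c').comp (inclHom γ ε)).totalChain k =
      (G.cubeMul (c.comp (inclHom α ε)) (c'.comp (inclHom β ε))).totalChain k := by
  subst hγ
  refine totalChain_cubeMul_comp G k c c' (card_joinFinset α β) _ _ _
    (fun t t' ht i => ?_) (fun t t' ht i => ?_)
  · by_cases hi : i ∈ α
    · obtain ⟨j, rfl⟩ := exists_orderEmbOfFin rfl hi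
      have := joinFinset_orderEmb α β (Fin.cast (card_joinFinset α β).symm (Fin.castAdd _ j))
      simp only [Fin.cast_cast, Fin.cast_eq_self, Fin.append_left] at this
      rw [← this, inclHom_orderEmb, inclHom_orderEmb, ht]
      rfl
    · rw [inclHom_of_notMem α _ _ hi, inclHom_of_notMem]
      simpa using hi
  · by_cases hi : i ∈ β
    · obtain ⟨j, rfl⟩ := exists_orderEmbOfFin rfl hi
      have := joinFinset_orderEmb α β (Fin.cast (card_joinFinset α β).symm (Fin.natAdd _ j))
      simp only [Fin.cast_cast, Fin.cast_eq_self, Fin.append_right] at this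
      rw [← this, inclHom_orderEmb, inclHom_orderEmb, ht]
      rfl
    · rw [inclHom_of_notMem β _ _ hi, inclHom_of_notMem]
      simpa using hi

/-- The unit of the algebra of normalized chains. -/
noncomputable def chainOne : ⨁ n, X.NChains k n := G.oneCube.totalChain k

theorem chainMul_one (a : ⨁ n, X.NChains k n) : G.chainMul k a (G.chainOne k) = a := by
  suffices h : (G.chainMul k).flip (G.chainOne k) = LinearMap.id from LinearMap.congr_fun h a
  refine SSet.total_hom_ext_cube fun p c => ?_
  rw [LinearMap.flip_apply, chainOne, chainMul_totalChain, totalChain_cubeMul_oneCube]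
  rfl

theorem one_chainMul (a : ⨁ n, X.NChains k n) : G.chainMul k (G.chainOne k) a = a := by
  suffices h : G.chainMul k (G.chainOne k) = LinearMap.id from LinearMap.congr_fun h a
  refine SSet.total_hom_ext_cube fun p c => ?_
  rw [chainOne, chainMul_totalChain, totalChain_oneCube_cubeMul]
  rfl

theorem chainMul_assoc (a b c : ⨁ n, X.NChains k n) :
    G.chainMul k (G.chainMul k a b) c = G.chainMul k a (G.chainMul k b c) := by
  refine SSet.cube_hom_ext₂ (f := (G.chainMul k).compr₂ ((G.chainMul k).flip c))
    (g := (G.chainMul k).compl₂ ((G.chainMul k).flip c)) (fun p q a b => ?_) a b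
  simp only [LinearMap.compr₂_apply, LinearMap.compl₂_apply, LinearMap.flip_apply]
  suffices h : G.chainMul k (G.chainMul k (a.totalChain k) (b.totalChain k)) =
      G.chainMul k (a.totalChain k) ∘ₗ G.chainMul k (b.totalChain k) from LinearMap.congr_fun h c
  refine SSet.total_hom_ext_cube fun r c => ?_
  simp only [LinearMap.comp_apply, chainMul_totalChain, totalChain_cubeMul_assoc]

theorem chainCounit_chainMul (a b : ⨁ n, X.NChains k n) : SSet.chainCounit X k (G.chainMul k a b) =
    SSet.chainCounit X k a * SSet.chainCounit X k b := by
  refine SSet.cube_hom_ext₂ (f := (G.chainMul k).compr₂ (SSet.chainCounit X k))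
    (g := (LinearMap.mul k k).compl₁₂ (SSet.chainCounit X k) (SSet.chainCounit X k))
    (fun p q c c' => ?_) a b
  simp only [LinearMap.compr₂_apply, LinearMap.compl₁₂_apply, LinearMap.mul_apply',
    chainMul_totalChain, chainCounit_totalChain]
  rcases p with _ | p <;> rcases q with _ | q <;> simp

/-- The diagonal is multiplicative: on singular cubes both sides are sums over faces of the product,
that is, over pairs of faces of the factors. -/
theorem chainComul_chainMul (a b : ⨁ n, X.NChains k n) : SSet.chainComul X k (G.chainMul k a b) =
    tensorMul (G.chainMul k) (SSet.chainComul X k) a b := by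
  refine SSet.cube_hom_ext₂ (f := (G.chainMul k).compr₂ (SSet.chainComul X k))
    (g := tensorMul (G.chainMul k) (SSet.chainComul X k)) (fun p q c c' => ?_) a b
  rw [tensorMul_apply_of_eq_sum _ _ _ _ (chainComul_totalChain k c) (chainComul_totalChain k c'),
    LinearMap.compr₂_apply, chainMul_totalChain, chainComul_totalChain,
    ← joinFinset_bijective.sum_comp, Fintype.sum_prod_type]
  refine Finset.sum_congr rfl fun α _ => Finset.sum_congr rfl fun β _ => ?_
  rw [totalChain_cubeMul_inclHom G k c c' α β 0 rfl,
    totalChain_cubeMul_inclHom G k c c' αᶜ βᶜ 1 (joinFinset_compl α β), shuffleSign_joinFinset,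
    ← totalChain_eq_lof, ← totalChain_eq_lof, ← totalChain_eq_lof, ← totalChain_eq_lof,
    chainMul_totalChain, chainMul_totalChain]

/-- The Leibniz rule: the faces of a product of singular cubes belong to the first or to the second
factor. -/
theorem totalD_chainMul (a b : ⨁ n, X.NChains k n) : SSet.totalD X k (G.chainMul k a b) =
    G.chainMul k (SSet.totalD X k a) b +
      G.chainMul k (signInvolution k (X.NChains k) a) (SSet.totalD X k b) := by
  refine SSet.cube_hom_ext₂ (f := (G.chainMul k).compr₂ (SSet.totalD X k))
    (g := (G.chainMul k) ∘ₗ (SSet.totalD X k) +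
      (G.chainMul k).compl₁₂ (signInvolution k (X.NChains k)) (SSet.totalD X k))
    (fun p q c c' => ?_) a b
  have hs : signInvolution k (X.NChains k) (c.totalChain k) = (-1 : ℤ) ^ p • c.totalChain k :=
    signInvolution_lof _ _
  simp only [LinearMap.compr₂_apply, LinearMap.compl₁₂_apply, LinearMap.comp_apply,
    LinearMap.add_apply, chainMul_totalChain, totalD_totalChain, hs, map_sum, map_zsmul, map_sub,
    LinearMap.sum_apply]
  rw [Finset.sum_range_add]
  congr 1
  · refine Finset.sum_congr rfl fun j hj => ?_
    rw [totalChain_cubeMul_boundary_left G k c c' _ (Finset.mem_range.1 hj),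
      totalChain_cubeMul_boundary_left G k c c' _ (Finset.mem_range.1 hj)]
    rw [LinearMap.smul_apply, LinearMap.sub_apply, chainMul_totalChain, chainMul_totalChain]
  · refine Finset.sum_congr rfl fun j hj => ?_
    rw [totalChain_cubeMul_boundary_right G k c c' _ (Finset.mem_range.1 hj),
      totalChain_cubeMul_boundary_right G k c c' _ (Finset.mem_range.1 hj)]
    rw [LinearMap.smul_apply, LinearMap.smul_apply, chainMul_totalChain, chainMul_totalChain,
      ← smul_sub, smul_smul, ← pow_add]
    congr 2
    omega

theorem chainMul_degree (p q : ℕ) (a : X.NChains k p) (b : X.NChains k q) :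
    G.chainMul k (DirectSum.lof k ℕ (X.NChains k) p a) (DirectSum.lof k ℕ (X.NChains k) q b) ∈
      LinearMap.range (DirectSum.lof k ℕ (X.NChains k) (p + q)) := by
  refine SSet.mem_of_cell_mem (Submodule.comap ((G.chainMul k).flip (DirectSum.lof k ℕ _ q b) ∘ₗ
    DirectSum.lof k ℕ (X.NChains k) p) (LinearMap.range (DirectSum.lof k ℕ _ (p + q))))
    (fun x => ?_) a
  refine SSet.mem_of_cell_mem (Submodule.comap (G.chainMul k (SSet.totalCell k x) ∘ₗ
    DirectSum.lof k ℕ (X.NChains k) q) (LinearMap.range (DirectSum.lof k ℕ _ (p + q))))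
    (fun y => ?_) b
  change G.chainMul k (SSet.totalCell k x) (SSet.totalCell k y) ∈
    LinearMap.range (DirectSum.lof k ℕ (X.NChains k) (p + q))
  rw [chainMul_totalCell, shuffle]
  refine Submodule.sum_mem _ fun α _ => ?_
  rw [← Int.cast_smul_eq_zsmul k]
  exact Submodule.smul_mem _ _ ⟨_, rfl⟩

theorem _root_.SSet.chainComul_degree (n : ℕ) (a : X.NChains k n) :
    SSet.chainComul X k (DirectSum.lof k ℕ (X.NChains k) n a) ∈
      ⨆ p : {p : ℕ × ℕ // p.1 + p.2 = n}, LinearMap.range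
        (TensorProduct.map (DirectSum.lof k ℕ (X.NChains k) p.1.1)
          (DirectSum.lof k ℕ (X.NChains k) p.1.2)) := by
  set P := ⨆ p : {p : ℕ × ℕ // p.1 + p.2 = n}, LinearMap.range
    (TensorProduct.map (DirectSum.lof k ℕ (X.NChains k) p.1.1)
      (DirectSum.lof k ℕ (X.NChains k) p.1.2)) with hP
  refine SSet.mem_of_cell_mem (Submodule.comap (SSet.chainComul X k ∘ₗ
    DirectSum.lof k ℕ (X.NChains k) n) P) (fun x => ?_) a
  change SSet.chainComul X k (SSet.totalCell k x) ∈ P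
  rw [SSet.chainComul_totalCell, hP]
  refine Submodule.sum_mem _ fun i _ => ?_
  exact Submodule.mem_iSup_of_mem ⟨(i, n - i), by simp only; omega⟩ ⟨_ ⊗ₜ[k] _, rfl⟩

theorem _root_.SSet.chainCounit_degree (n : ℕ) (a : X.NChains k (n + 1)) :
    SSet.chainCounit X k (DirectSum.lof k ℕ (X.NChains k) (n + 1) a) = 0 := by
  suffices h : SSet.chainCounit X k ∘ₗ DirectSum.lof k ℕ (X.NChains k) (n + 1) = 0 from
    LinearMap.congr_fun h a
  refine SSet.chain_hom_ext fun x => ?_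
  exact (SSet.chainCounit_totalCell k x).trans (if_neg (Nat.succ_ne_zero n))

/-- The dg bialgebra of normalized chains of a simplicial monoid. -/
noncomputable def chainBialgebra : DGBialgebra k (X.NChains k) where
  d := X.chainD k
  mul := G.chainMul k
  one := G.chainOne k
  comul := SSet.chainComul X k
  counit := SSet.chainCounit X k
  d_comp_d := SSet.chainD_comp_chainD k
  mul_degree := G.chainMul_degree k
  one_degree := ⟨_, rfl⟩
  comul_degree := SSet.chainComul_degree k
  counit_degree := SSet.chainCounit_degree k
  mul_assoc := G.chainMul_assoc k
  one_mul := G.one_chainMul k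
  mul_one := G.chainMul_one k
  coassoc := SSet.chainComul_coassoc k
  counit_comul := SSet.chainCounit_rTensor_chainComul k
  comul_counit := SSet.chainCounit_lTensor_chainComul k
  comul_mul := G.chainComul_chainMul k
  comul_one := by
    rw [chainOne, totalChain_oneCube, SSet.chainComul_totalCell', Finset.sum_range_one,
      SSet.shift_zero, ← SSet.totalCell_eq_vertexCell]
  counit_mul := G.chainCounit_chainMul k
  counit_one := by rw [chainOne, chainCounit_totalChain, if_pos rfl]
  d_mul := G.totalD_chainMul k
  d_comul := SSet.chainComul_totalD k
  counit_d := SSet.chainCounit_totalD k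

theorem isChainBialgebra_chainBialgebra :
    G.IsChainBialgebra (k := k) (G.chainBialgebra k : DGBialgebra k (X.NormalizedChains k)) where
  d_apply _ x := SSet.chainD_cell k x
  mul_apply _ _ x y := G.chainMul_totalCell k x y
  one_eq := G.totalChain_oneCube k
  comul_apply _ x := SSet.chainComul_totalCell k x
  counit_apply x := SSet.chainCounit_totalCell k x

end SimplicialMonoid

/-! ### The triangulation of a cubical monoid -/

namespace CubicalSet

variable {Y : CubicalSet.{u}}

theorem pull_id {n : ℕ} (y : Y.cubes n) : Y.pull (𝟙 (⟨n⟩ : Cube)) y = y := by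
  simp [pull]

theorem simplex_push {n n' m : ℕ} (l : (⟨n⟩ : Cube) ⟶ ⟨n'⟩) (y : Y.cubes n')
    (s : CubeSimplex n m) : Y.simplex (Y.pull l y) s = Y.simplex y (CubeSimplex.push l s) :=
  Quot.sound (TriangRel.glue l y s)

theorem triang_mk_congr {m a b : ℕ} {y : Y.cubes a} {y' : Y.cubes b}
    (h : (⟨a, y⟩ : Σ n, Y.cubes n) = ⟨b, y'⟩) {s : CubeSimplex a m} {s' : CubeSimplex b m}
    (hs : ∀ (e : a = b) v i, s v i = s' v (Fin.cast e i)) :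
    Quot.mk (TriangRel Y m) ⟨a, y, s⟩ = Quot.mk (TriangRel Y m) ⟨b, y', s'⟩ := by
  cases h
  have : s = s' := by
    ext v i : 3
    exact hs rfl v i
  rw [this]

end CubicalSet

namespace CubeSimplex

theorem pair_castAdd {k l m : ℕ} (s : CubeSimplex k m) (t : CubeSimplex l m) (v : Fin (m + 1))
    (i : Fin k) : pair s t v (Fin.castAdd l i) = s v i := Fin.append_left _ _ _

theorem pair_natAdd {k l m : ℕ} (s : CubeSimplex k m) (t : CubeSimplex l m) (v : Fin (m + 1))
    (i : Fin l) : pair s t v (Fin.natAdd k i) = t v i := Fin.append_right _ _ _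

theorem push_id {n m : ℕ} (s : CubeSimplex n m) : push (𝟙 (⟨n⟩ : Cube)) s = s := rfl

theorem push_prod_pair {k l k' l' m : ℕ} (f : (⟨k⟩ : Cube) ⟶ ⟨k'⟩) (g : (⟨l⟩ : Cube) ⟶ ⟨l'⟩)
    (s : CubeSimplex k m) (t : CubeSimplex l m) :
    push (Cube.prod f g) (pair s t) = pair (push f s) (push g t) := by
  ext v i : 3
  change Fin.append (f.1 fun i => pair s t v (Fin.castAdd l i))
    (g.1 fun i => pair s t v (Fin.natAdd k i)) i = Fin.append (f.1 (s v)) (g.1 (t v)) i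
  simp only [pair_castAdd, pair_natAdd]

end CubeSimplex

namespace CubicalMonoid

variable {Y : CubicalSet.{u}} (M : CubicalMonoid Y)

/-- The product of simplices of the triangulation. -/
def triangMul (m : ℕ) : Quot (Y.TriangRel m) → Quot (Y.TriangRel m) → Quot (Y.TriangRel m) :=
  Quot.map₂ (fun a b => ⟨a.1 + b.1, M.mul a.2.1 b.2.1, CubeSimplex.pair a.2.2 b.2.2⟩) (by
    rintro ⟨a, x, s⟩ _ _ ⟨l, y, t⟩
    have h := CubicalSet.TriangRel.glue (Cube.prod (𝟙 _) l) (M.mul x y) (CubeSimplex.pair s t)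
    rwa [← M.mul_pull, CubicalSet.pull_id, CubeSimplex.push_prod_pair, CubeSimplex.push_id] at h)
  (by
    rintro _ _ ⟨b, x, s⟩ ⟨l, y, t⟩
    have h := CubicalSet.TriangRel.glue (Cube.prod l (𝟙 _)) (M.mul y x) (CubeSimplex.pair t s)
    rwa [← M.mul_pull, CubicalSet.pull_id, CubeSimplex.push_prod_pair, CubeSimplex.push_id] at h)

/-- The simplicial monoid structure on the triangulation of a cubical monoid. -/
def triangMonoid : SimplicialMonoid Y.triang where
  mul {n} := M.triangMul n.unop.len
  one n := Quot.mk _ ⟨0, M.one, OrderHom.const _ Fin.elim0⟩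
  mul_assoc x y z := by
    induction x using Quot.ind with | mk a
    induction y using Quot.ind with | mk b
    induction z using Quot.ind with | mk c
    refine CubicalSet.triang_mk_congr (M.mul_assoc _ _ _) fun e v i => ?_
    refine Fin.addCases (fun i => ?_) (fun i => ?_) i
    · refine Fin.addCases (fun i => ?_) (fun i => ?_) i
      · rw [CubeSimplex.pair_castAdd, CubeSimplex.pair_castAdd]
        exact (CubeSimplex.pair_castAdd _ _ _ _).symm
      · rw [CubeSimplex.pair_castAdd, CubeSimplex.pair_natAdd]
        refine ((CubeSimplex.pair_natAdd _ _ _ _).trans (CubeSimplex.pair_castAdd _ _ _ _)).symm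
    · rw [CubeSimplex.pair_natAdd]
      refine (((CubeSimplex.pair_natAdd a.2.2 (CubeSimplex.pair b.2.2 c.2.2) v _).trans
        (CubeSimplex.pair_natAdd _ _ _ i)).symm.trans ?_)
      exact congrArg _ (Fin.ext (Nat.add_assoc _ _ _).symm)
  one_mul x := by
    induction x using Quot.ind
    refine CubicalSet.triang_mk_congr (M.one_mul _) fun e v i => ?_
    refine Fin.addCases (fun i => i.elim0) (fun i => ?_) i
    exact (CubeSimplex.pair_natAdd _ _ _ _).trans (congrArg _ (Fin.ext (Nat.zero_add _).symm))
  mul_one x := by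
    induction x using Quot.ind
    refine CubicalSet.triang_mk_congr (M.mul_one _) fun e v i => ?_
    refine Fin.addCases (fun i => ?_) (fun i => i.elim0) i
    exact CubeSimplex.pair_castAdd _ _ _ _
  map_mul θ x y := by
    induction x using Quot.ind
    induction y using Quot.ind
    rfl
  map_one θ := rfl

theorem triangMonoid_mul_simplex {p q m : ℕ} (y : Y.cubes p) (z : Y.cubes q) (s : CubeSimplex p m)
    (t : CubeSimplex q m) : M.triangMonoid.mul (Y.simplex y s) (Y.simplex z t) =
      Y.simplex (M.mul y z) (CubeSimplex.pair s t) := rfl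

theorem simplex_toZero {n m : ℕ} (s : CubeSimplex n m) :
    Y.simplex (Y.pull (Cube.toZero n) M.one) s =
      M.triangMonoid.one (op (SimplexCategory.mk m)) := by
  rw [CubicalSet.simplex_push]
  refine CubicalSet.triang_mk_congr rfl fun _ _ i => i.elim0

theorem triangMonoid_isGroup (h : M.IsGroup) : M.triangMonoid.IsGroup := by
  intro n x
  induction x using Quot.ind with | mk a
  obtain ⟨p, y, s⟩ := a
  obtain ⟨q, z, h1, h2⟩ := h p y
  refine ⟨Y.simplex z (OrderHom.const _ 0), ?_, ?_⟩
  · refine (M.triangMonoid_mul_simplex y z s _).trans ?_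
    rw [h1]
    exact M.simplex_toZero _
  · refine (M.triangMonoid_mul_simplex z y _ s).trans ?_
    rw [h2]
    exact M.simplex_toZero _

end CubicalMonoid

/-! ### The map from cubical to simplicial chains -/

namespace CubicalSet

variable {Y : CubicalSet.{u}}

/-- The singular cube of the triangulation given by a cube. -/
def singular {n : ℕ} (y : Y.cubes n) : SingularCube Y.triang n where
  toFun s := Y.simplex y s
  toFun_comp _ _ := rfl

theorem singular_pull {m n : ℕ} (l : (⟨m⟩ : Cube) ⟶ ⟨n⟩) (y : Y.cubes n) :
    singular (Y.pull l y) = (singular y).comp (Cube.toOrderHom l) := by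
  unfold singular SingularCube.comp
  congr 1
  funext m s
  exact simplex_push l y s

theorem cubeMul_singular (M : CubicalMonoid Y) {p q : ℕ} (y : Y.cubes p) (z : Y.cubes q) :
    M.triangMonoid.cubeMul (singular y) (singular z) = singular (M.mul y z) := by
  unfold singular SimplicialMonoid.cubeMul
  congr 1
  funext m s
  refine (M.triangMonoid_mul_simplex y z _ _).trans ?_
  congr 1
  ext v i : 3
  refine Fin.addCases (fun i => ?_) (fun i => ?_) i
  · exact CubeSimplex.pair_castAdd _ _ _ _
  · exact CubeSimplex.pair_natAdd _ _ _ _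

end CubicalSet

namespace SingularCube

variable {X : SSet.{u}} {n : ℕ} (k : Type v) [CommRing k]

/-- In every maximal simplex of the cube, the step changing the coordinate `i` is made degenerate by
deleting that coordinate. -/
theorem chain_comp_degen (c : SingularCube X n) (i : Fin (n + 1)) :
    (c.comp (Cube.toOrderHom (Cube.degen i))).chain k = 0 := by
  refine Finset.sum_eq_zero fun π _ => ?_
  rw [SSet.cell_eq_zero, smul_zero]
  refine c.toFun_mem_degenerate _ fun h => ?_
  have : (π.symm i).castSucc = (π.symm i).succ := h <| by
    funext j
    change CubeSimplex.ofPerm π _ (i.succAbove j) = CubeSimplex.ofPerm π _ (i.succAbove j)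
    have : π.symm (i.succAbove j) ≠ π.symm i := fun e => i.succAbove_ne j (π.symm.injective e)
    have : (π.symm (i.succAbove j) : ℕ) ≠ π.symm i := fun e => this (Fin.ext e)
    rw [ofPerm_apply, ofPerm_apply, Fin.val_castSucc, Fin.val_succ]
    split_ifs <;> first | rfl | omega
  simp [Fin.ext_iff] at this

theorem conn_comp_swap (i : Fin (n + 1)) (t : Fin (n + 2) → Fin 2) :
    CubeMap.conn i (fun j => t (Equiv.swap i.castSucc i.succ j)) = CubeMap.conn i t := by
  funext j
  rcases eq_or_ne j i with rfl | hj
  · have h1 : j.castSucc.succAbove j = j.succ := Fin.succAbove_of_le_castSucc _ _ le_rfl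
    have h2 : j.succ.succAbove j = j.castSucc :=
      Fin.succAbove_of_castSucc_lt _ _ j.castSucc_lt_succ
    simp only [CubeMap.conn, h1, h2, Equiv.swap_apply_left, Equiv.swap_apply_right]
    exact min_comm _ _
  · have hj' : (j : ℕ) ≠ i := fun e => hj (Fin.ext e)
    have h : ∀ a : Fin (n + 2), (a : ℕ) ≠ i → (a : ℕ) ≠ i + 1 →
        Equiv.swap i.castSucc i.succ a = a := fun a h1 h2 =>
      Equiv.swap_apply_of_ne_of_ne (fun e => h1 (congrArg Fin.val e))
        (fun e => h2 (congrArg Fin.val e))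
    have h1 := h (i.castSucc.succAbove j)
    have h2 := h (i.succ.succAbove j)
    simp only [CubeMap.val_succAbove, Fin.val_castSucc, Fin.val_succ] at h1 h2
    simp only [CubeMap.conn]
    rw [h1, h2] <;> split_ifs <;> omega

/-- The maximal simplices of the cube cancel in pairs, since exchanging two coordinates does not
change their minimum. -/
theorem chain_comp_conn (c : SingularCube X (n + 1)) (i : Fin (n + 1)) :
    (c.comp (Cube.toOrderHom (Cube.conn i))).chain k = 0 := by
  have hne : i.castSucc ≠ i.succ := i.castSucc_lt_succ.ne
  refine Finset.sum_involution (fun π _ => Equiv.swap i.castSucc i.succ * π) ?_ ?_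
    (fun _ _ => Finset.mem_univ _) ?_
  · intro π _
    have h : (c.comp (Cube.toOrderHom (Cube.conn i))).toFun
        (CubeSimplex.ofPerm (Equiv.swap i.castSucc i.succ * π)) =
        (c.comp (Cube.toOrderHom (Cube.conn i))).toFun (CubeSimplex.ofPerm π) := by
      refine congrArg c.toFun ?_
      ext v : 2
      refine Eq.trans ?_ (conn_comp_swap i (CubeSimplex.ofPerm π v))
      change CubeMap.conn i (CubeSimplex.ofPerm _ v) = _
      congr 1
    rw [h, Equiv.Perm.sign_mul, Equiv.Perm.sign_swap hne, ← add_smul]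
    simp
  · intro π _ _ h
    have h' : Equiv.swap i.castSucc i.succ = 1 := mul_eq_right.1 h
    exact hne (Equiv.swap_eq_one_iff.1 h')
  · intro π _
    simp [← mul_assoc]

end SingularCube

namespace CubicalSet

variable (Y : CubicalSet.{u}) (k : Type v) [CommRing k]

/-- The map `y ↦ ∑_π sgn(π) [y, u_π]` on normalized chains. -/
noncomputable def triangChain (n : ℕ) : Y.NChains k n →ₗ[k] Y.triang.NChains k n :=
  chainLift (fun y => (singular y).chain k) (by
    rintro _ (⟨i, y⟩ | ⟨i, y⟩)
    · rw [singular_pull, SingularCube.chain_comp_degen]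
    · rw [singular_pull, SingularCube.chain_comp_conn])

theorem triangChain_cell {n : ℕ} (y : Y.cubes n) :
    Y.triangChain k n (cell k y) = (singular y).chain k := chainLift_cell _ _ _

theorem lmap_triangChain_totalCell {n : ℕ} (y : Y.cubes n) :
    DirectSum.lmap (Y.triangChain k) (totalCell k y) = (singular y).totalChain k := by
  rw [totalCell, DirectSum.lmap_lof, triangChain_cell]
  rfl

end CubicalSet

/-! ### Faces of the cube and sums over the faces along a path -/

/-- The cell of the interval given by an endpoint. The cells are the endpoint `0`, the interior
(written `1`) and the endpoint `1` (written `2`), so that connections act by minima of cells. -/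
def endpoint (ε : Fin 2) : Fin 3 := if ε = 0 then 0 else 2

/-- The point of a closed cell of the interval with parameter `t`. -/
def cellEval (x : Fin 3) (t : Fin 2) : Fin 2 := if x = 0 then 0 else if x = 2 then 1 else t

/-- The dimension of the face of the cube given by a word in the cells of the interval. -/
def faceDim : ∀ {n : ℕ}, (Fin n → Fin 3) → ℕ
  | 0, _ => 0
  | _ + 1, w => faceDim (Fin.tail w) + if w 0 = 1 then 1 else 0

/-- The parametrization of a face of the cube. An infinite sequence of parameters is allowed,
of which only the first ones are used, as many as the dimension of the face says. -/
def faceMap : ∀ {n : ℕ}, (Fin n → Fin 3) → (ℕ → Fin 2) → Fin n → Fin 2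
  | 0, _, _ => Fin.elim0
  | _ + 1, w, T => Fin.cons (cellEval (w 0) (T 0))
      (faceMap (Fin.tail w) (if w 0 = 1 then fun i => T (i + 1) else T))

/-- The sum of `ψ` over those faces of the cube which occur in the Alexander-Whitney map of a
path `p`. The coordinates are read one after the other, the state `c` being the number of steps of
the path already used. A coordinate contributes either its current value, or, if it changes in the
current step, the interior of the interval, and then this step is used up. Only the faces for which
the final state is `m` are counted. -/
def pathSum {V : Type*} [AddCommGroup V] (m : ℕ) : ∀ {n : ℕ}, (ℕ → Fin n → Fin 2) → ℕ →
    ((Fin n → Fin 3) → V) → V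
  | 0, _, c, ψ => if c = m then ψ Fin.elim0 else 0
  | _ + 1, p, c, ψ =>
    pathSum m (fun v => Fin.tail (p v)) c (fun w => ψ (Fin.cons (endpoint (p c 0)) w)) +
      if p c 0 = p (c + 1) 0 then 0 else
        pathSum m (fun v => Fin.tail (p v)) (c + 1) (fun w => ψ (Fin.cons 1 w))

section PathSum

variable {V : Type*} [AddCommGroup V] {m : ℕ}

theorem pathSum_zero (p : ℕ → Fin 0 → Fin 2) (c : ℕ) (ψ : (Fin 0 → Fin 3) → V) :
    pathSum m p c ψ = if c = m then ψ Fin.elim0 else 0 := rfl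

theorem pathSum_succ {n : ℕ} (p : ℕ → Fin (n + 1) → Fin 2) (c : ℕ)
    (ψ : (Fin (n + 1) → Fin 3) → V) : pathSum m p c ψ =
    pathSum m (fun v => Fin.tail (p v)) c (fun w => ψ (Fin.cons (endpoint (p c 0)) w)) +
      if p c 0 = p (c + 1) 0 then 0 else
        pathSum m (fun v => Fin.tail (p v)) (c + 1) (fun w => ψ (Fin.cons 1 w)) := rfl

theorem faceDim_cons {n : ℕ} (x : Fin 3) (w : Fin n → Fin 3) :
    faceDim (Fin.cons x w : Fin (n + 1) → Fin 3) = faceDim w + if x = 1 then 1 else 0 := by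
  simp [faceDim]

theorem faceMap_cons {n : ℕ} (x : Fin 3) (w : Fin n → Fin 3) (T : ℕ → Fin 2) :
    faceMap (Fin.cons x w : Fin (n + 1) → Fin 3) T = Fin.cons (cellEval x (T 0))
      (faceMap w (if x = 1 then fun i => T (i + 1) else T)) := by
  simp [faceMap]

theorem endpoint_ne_one (ε : Fin 2) : endpoint ε ≠ 1 := by
  fin_cases ε <;> decide

theorem cellEval_endpoint (ε t : Fin 2) : cellEval (endpoint ε) t = ε := by
  fin_cases ε <;> rfl

/-- Only faces of the right dimension occur. Moreover, as the path is monotone, a coordinate which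
has the value `1` in the initial state keeps this value in all faces. -/
theorem pathSum_congr {n : ℕ} {p : ℕ → Fin n → Fin 2} (hp : Monotone p) (c : ℕ)
    {ψ ψ' : (Fin n → Fin 3) → V}
    (h : ∀ w, c + faceDim w = m → (∀ i, p c i = 1 → w i = 2) → ψ w = ψ' w) :
    pathSum m p c ψ = pathSum m p c ψ' := by
  induction n generalizing c with
  | zero =>
    rw [pathSum_zero, pathSum_zero]
    split_ifs with hc
    · exact h _ hc fun i => i.elim0
    · rfl
  | succ n ih =>
    have hp' : Monotone fun v => Fin.tail (p v) := fun a b hab i => hp hab _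
    rw [pathSum_succ, pathSum_succ]
    congr 1
    · refine ih hp' c fun w hw hw' => h _ ?_ fun i => ?_
      · rw [faceDim_cons, if_neg (endpoint_ne_one _), ← hw]
        rfl
      · refine Fin.cases (fun hi => ?_) (fun i hi => ?_) i
        · rw [Fin.cons_zero, hi]
          rfl
        · exact hw' i hi
    · split_ifs with hc
      · rfl
      · refine ih hp' _ fun w hw hw' => h _ ?_ fun i => ?_
        · rw [faceDim_cons, if_pos rfl, ← hw]
          omega
        · refine Fin.cases (fun hi => ?_) (fun i hi => ?_) i
          · have := hp (Nat.le_succ c) 0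
            rw [hi] at this hc
            exact absurd (le_antisymm this (Fin.le_last _)) hc
          · refine hw' i ?_
            have := hp (Nat.le_succ c) i.succ
            rw [hi] at this
            exact (le_antisymm this (Fin.le_last _)).symm

theorem map_pathSum {W : Type*} [AddCommGroup W] (f : V →+ W) {n : ℕ} (p : ℕ → Fin n → Fin 2)
    (c : ℕ) (ψ : (Fin n → Fin 3) → V) :
    f (pathSum m p c ψ) = pathSum m p c (fun w => f (ψ w)) := by
  induction n generalizing c with
  | zero => rw [pathSum_zero, pathSum_zero, apply_ite f, map_zero]
  | succ n ih => rw [pathSum_succ, pathSum_succ, map_add, apply_ite f, map_zero, ih, ih]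

theorem pathSum_add {n : ℕ} (p : ℕ → Fin n → Fin 2) (c : ℕ) (ψ ψ' : (Fin n → Fin 3) → V) :
    pathSum m p c (fun w => ψ w + ψ' w) = pathSum m p c ψ + pathSum m p c ψ' := by
  induction n generalizing c with
  | zero =>
    simp only [pathSum_zero]
    split_ifs <;> simp
  | succ n ih =>
    simp only [pathSum_succ, ih]
    split_ifs
    · abel
    · abel

theorem pathSum_neg {n : ℕ} (p : ℕ → Fin n → Fin 2) (c : ℕ) (ψ : (Fin n → Fin 3) → V) :
    pathSum m p c (fun w => -ψ w) = -pathSum m p c ψ :=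
  (map_pathSum (-AddMonoidHom.id V) p c ψ).symm

theorem pathSum_const_zero {n : ℕ} (p : ℕ → Fin n → Fin 2) (c : ℕ) :
    pathSum m p c (fun _ => (0 : V)) = 0 :=
  (map_pathSum (0 : V →+ V) p c fun _ => 0).symm

theorem pathSum_eq_zero_of_lt {n : ℕ} (p : ℕ → Fin n → Fin 2) {c : ℕ} (h : m < c)
    (ψ : (Fin n → Fin 3) → V) : pathSum m p c ψ = 0 := by
  induction n generalizing c with
  | zero => exact if_neg h.ne'
  | succ n ih => rw [pathSum_succ, ih _ h, ih _ (by omega), ite_self, add_zero]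

theorem pathSum_path_congr {n : ℕ} {p p' : ℕ → Fin n → Fin 2} (h : ∀ v ≤ m, p v = p' v) (c : ℕ)
    (ψ : (Fin n → Fin 3) → V) : pathSum m p c ψ = pathSum m p' c ψ := by
  induction n generalizing c with
  | zero => rfl
  | succ n ih =>
    rcases lt_or_ge m c with hc | hc
    · rw [pathSum_eq_zero_of_lt _ hc, pathSum_eq_zero_of_lt _ hc]
    · have h' : ∀ v ≤ m, Fin.tail (p v) = Fin.tail (p' v) := fun v hv => by rw [h v hv]
      rw [pathSum_succ, pathSum_succ, ih h', h c hc]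
      rcases hc.lt_or_eq with hc | rfl
      · rw [ih h', h (c + 1) hc]
      · rw [pathSum_eq_zero_of_lt _ (Nat.lt_succ_self c), pathSum_eq_zero_of_lt _
          (Nat.lt_succ_self c), ite_self, ite_self]

/-- A step in which the path does not move can never be used up. -/
theorem pathSum_eq_zero_of_step {n : ℕ} {p : ℕ → Fin n → Fin 2} {v : ℕ} (hv : v < m)
    (h : p v = p (v + 1)) {c : ℕ} (hc : c ≤ v) (ψ : (Fin n → Fin 3) → V) :
    pathSum m p c ψ = 0 := by
  induction n generalizing c with
  | zero => exact if_neg (by omega)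
  | succ n ih =>
    rw [pathSum_succ, ih (congrArg Fin.tail h) hc, zero_add]
    rcases hc.lt_or_eq with hc | rfl
    · rw [ih (congrArg Fin.tail h) hc, ite_self]
    · rw [if_pos (congrFun h 0)]

theorem pathSum_eq_zero_of_add_lt {n : ℕ} (p : ℕ → Fin n → Fin 2) {c : ℕ} (h : c + n < m)
    (ψ : (Fin n → Fin 3) → V) : pathSum m p c ψ = 0 := by
  induction n generalizing c with
  | zero => exact if_neg (by omega)
  | succ n ih => rw [pathSum_succ, ih _ (by omega), ih _ (by omega), ite_self, add_zero]

/-- If every coordinate has to use up a step, only the face of full dimension can occur. -/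
theorem pathSum_of_add_eq {n : ℕ} (p : ℕ → Fin n → Fin 2) {c : ℕ} (h : c + n = m)
    (ψ : (Fin n → Fin 3) → V) : pathSum m p c ψ =
      if ∀ i : Fin n, p (c + i) i ≠ p (c + i + 1) i then ψ fun _ => 1 else 0 := by
  induction n generalizing c with
  | zero =>
    rw [pathSum_zero, if_pos (by omega), if_pos fun i => i.elim0]
    congr 1
    exact Subsingleton.elim _ _
  | succ n ih =>
    rw [pathSum_succ, pathSum_eq_zero_of_add_lt _ (by omega), zero_add, ih _ (by omega)]
    have h1 : (Fin.cons 1 fun _ => 1 : Fin (n + 1) → Fin 3) = fun _ => 1 := by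
      funext i
      refine Fin.cases rfl (fun _ => rfl) i
    rw [h1]
    simp only [Fin.forall_fin_succ, Fin.val_zero, add_zero, Fin.val_succ, Fin.tail]
    have h2 (i : ℕ) : c + 1 + i = c + (i + 1) := by omega
    simp only [h2, ite_and, ne_eq, ite_not]

/-! ### Naturality of the sums over faces -/

theorem insertNth_succ_eq_cons {n : ℕ} {α : Type*} (i : Fin (n + 1)) (x : α)
    (t : Fin (n + 1) → α) : (i.succ.insertNth x t : Fin (n + 2) → α) =
      Fin.cons (t 0) (i.insertNth x (Fin.tail t) : Fin (n + 1) → α) := by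
  refine Fin.insertNth_eq_iff.2 ⟨by simp, funext fun j => ?_⟩
  refine Fin.cases ?_ (fun j => ?_) j
  · simp [Fin.removeNth]
  · simp [Fin.removeNth, Fin.tail]

/-- The faces occurring for a path in a face of the cube lie in that face. -/
theorem pathSum_face {n : ℕ} (ε : Fin 2) (i : Fin (n + 1)) (p : ℕ → Fin n → Fin 2) (c : ℕ)
    (ψ : (Fin (n + 1) → Fin 3) → V) : pathSum m (fun v => CubeMap.face ε i (p v)) c ψ =
      pathSum m p c (fun w => ψ (i.insertNth (endpoint ε) w)) := by
  induction n generalizing c with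
  | zero =>
    obtain rfl : i = 0 := Fin.eq_zero i
    rw [pathSum_succ]
    simp [CubeMap.face]
  | succ n ih =>
    refine Fin.cases ?_ (fun i => ?_) i
    · rw [pathSum_succ]
      simp [CubeMap.face]
    · rw [pathSum_succ, pathSum_succ p]
      simp only [CubeMap.face, insertNth_succ_eq_cons, Fin.tail_cons, Fin.cons_zero]
      have := fun c ψ => ih i (fun v => Fin.tail (p v)) c ψ
      simp only [CubeMap.face] at this
      rw [this, this]

/-- The faces occurring for a path with a deleted coordinate come from those faces of the original
path in which this coordinate is not an interior one. -/
theorem pathSum_degen {n : ℕ} (i : Fin (n + 1)) (p : ℕ → Fin (n + 1) → Fin 2) (c : ℕ)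
    (ψ : (Fin n → Fin 3) → V) : pathSum m (fun v => CubeMap.degen i (p v)) c ψ =
      pathSum m p c (fun w => if w i = 1 then 0 else ψ fun j => w (i.succAbove j)) := by
  have h0 : ∀ {n : ℕ} (p : ℕ → Fin (n + 1) → Fin 2) (c : ℕ) (ψ : (Fin n → Fin 3) → V),
      pathSum m (fun v => CubeMap.degen 0 (p v)) c ψ =
      pathSum m p c (fun w => if w 0 = 1 then 0 else ψ fun j => w (Fin.succAbove 0 j)) := by
    intro n p c ψ
    rw [pathSum_succ]
    simp only [Fin.cons_zero, endpoint_ne_one, if_false, if_true, pathSum_const_zero, ite_self,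
      add_zero, Fin.zero_succAbove, Fin.cons_succ]
    rfl
  induction n generalizing c with
  | zero =>
    obtain rfl : i = 0 := Fin.eq_zero i
    exact h0 p c ψ
  | succ n ih =>
    refine Fin.cases (h0 p c ψ) (fun i => ?_) i
    have h1 (x : Fin 3) (w : Fin (n + 1) → Fin 3) :
        (fun j => (Fin.cons x w : Fin (n + 2) → Fin 3) (i.succ.succAbove j)) =
          Fin.cons x fun j => w (i.succAbove j) := by
      funext j
      refine Fin.cases ?_ (fun j => ?_) j <;> simp
    have h2 (v : ℕ) : Fin.tail (CubeMap.degen i.succ (p v)) =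
        CubeMap.degen i (Fin.tail (p v)) := by
      funext j
      simp [CubeMap.degen, Fin.tail]
    have h3 (v : ℕ) : CubeMap.degen i.succ (p v) 0 = p v 0 := by
      simp [CubeMap.degen]
    rw [pathSum_succ, pathSum_succ p]
    simp only [h1, h2, h3, ih, Fin.cons_succ]

theorem min_succAbove_zero {α : Type*} [LinearOrder α] {n : ℕ} (x y : α) (w : Fin n → α) :
    (fun j => min ((Fin.cons x (Fin.cons y w : Fin (n + 1) → α) : Fin (n + 2) → α)
      (Fin.succAbove (Fin.castSucc 0) j)) ((Fin.cons x (Fin.cons y w : Fin (n + 1) → α) :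
      Fin (n + 2) → α) (Fin.succAbove (Fin.succ 0) j))) = Fin.cons (min x y) w := by
  funext j
  refine Fin.cases ?_ (fun j => ?_) j
  · simp [min_comm]
  · simp

theorem min_succAbove_succ {α : Type*} [LinearOrder α] {n : ℕ} (i : Fin (n + 1)) (x : α)
    (w : Fin (n + 2) → α) :
    (fun j => min ((Fin.cons x w : Fin (n + 3) → α) (i.succ.castSucc.succAbove j))
      ((Fin.cons x w : Fin (n + 3) → α) (i.succ.succ.succAbove j))) =
      Fin.cons x fun j => min (w (i.castSucc.succAbove j)) (w (i.succ.succAbove j)) := by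
  funext j
  refine Fin.cases ?_ (fun j => ?_) j
  · simp
  · simp

/-- The faces on which the connection `γ_i` drops the dimension; here `x` and `y` are the cells at
the positions `i` and `i + 1`. -/
def ConnKills (x y : Fin 3) : Prop := (x = 1 ∧ y ≠ 2) ∨ (y = 1 ∧ x ≠ 2)

instance (x y : Fin 3) : Decidable (ConnKills x y) := inferInstanceAs (Decidable (_ ∨ _))

/-- The faces occurring after a connection are the images of the original ones whose dimension is
not dropped. -/
theorem pathSum_conn {n : ℕ} (i : Fin (n + 1)) {p : ℕ → Fin (n + 2) → Fin 2} (hp : Monotone p)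
    (c : ℕ) (ψ : (Fin (n + 1) → Fin 3) → V) : pathSum m (fun v => CubeMap.conn i (p v)) c ψ =
      pathSum m p c (fun w => if ConnKills (w i.castSucc) (w i.succ) then 0 else
        ψ fun j => min (w (i.castSucc.succAbove j)) (w (i.succ.succAbove j))) := by
  have h0 : ∀ {n : ℕ} {p : ℕ → Fin (n + 2) → Fin 2} (hp : Monotone p) (c : ℕ)
      (ψ : (Fin (n + 1) → Fin 3) → V), pathSum m (fun v => CubeMap.conn 0 (p v)) c ψ =
      pathSum m p c (fun w => if ConnKills (w (Fin.castSucc 0)) (w (Fin.succ 0)) then 0 else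
        ψ fun j => min (w (Fin.succAbove (Fin.castSucc 0) j))
          (w (Fin.succAbove (Fin.succ 0) j))) := by
    intro n p hp c ψ
    have h2 (v : ℕ) : Fin.tail (CubeMap.conn 0 (p v)) = Fin.tail (Fin.tail (p v)) := by
      funext j
      simp [CubeMap.conn, Fin.tail]
    have h3 (v : ℕ) : CubeMap.conn 0 (p v) 0 = min (p v 0) (p v 1) := by
      simp [CubeMap.conn, min_comm]
    have h4 : p c 0 ≤ p (c + 1) 0 := hp (Nat.le_succ c) 0
    have h5 : p c 1 ≤ p (c + 1) 1 := hp (Nat.le_succ c) 1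
    rw [pathSum_succ, pathSum_succ p, pathSum_succ (fun v => Fin.tail (p v)),
      pathSum_succ (fun v => Fin.tail (p v))]
    simp only [min_succAbove_zero]
    simp only [h2, h3, Fin.cons_zero, Fin.castSucc_zero, Fin.tail,
      Fin.succ_zero_eq_one]
    -- What remains is a case distinction by the values of both coordinates before and after the
    -- step, decreasing values being excluded by monotonicity.
    generalize p c 0 = a at *
    generalize p (c + 1) 0 = a' at *
    generalize p c 1 = b at *
    generalize p (c + 1) 1 = b' at *
    generalize p (c + 1 + 1) 1 = b'' at *
    have key : ∀ x : Fin 2, x = 0 ∨ x = 1 := by decide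
    rcases key a with rfl | rfl <;> rcases key a' with rfl | rfl <;> rcases key b with rfl | rfl <;>
      rcases key b' with rfl | rfl <;> first
      | (clear h5; exfalso; revert h4; decide)
      | (clear h4; exfalso; revert h5; decide)
      | simp [endpoint, ConnKills, pathSum_const_zero]
  induction n generalizing c with
  | zero =>
    obtain rfl : i = 0 := Fin.eq_zero i
    exact h0 hp c ψ
  | succ n ih =>
    refine Fin.cases (h0 hp c ψ) (fun i => ?_) i
    have h2 (v : ℕ) : Fin.tail (CubeMap.conn i.succ (p v)) =
        CubeMap.conn i (Fin.tail (p v)) := by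
      funext j
      simp [CubeMap.conn, Fin.tail]
    have h3 (v : ℕ) : CubeMap.conn i.succ (p v) 0 = p v 0 := by
      simp [CubeMap.conn]
    have hp' : Monotone fun v => Fin.tail (p v) := fun a b hab i => hp hab _
    rw [pathSum_succ, pathSum_succ p]
    simp only [min_succAbove_succ]
    simp only [h2, h3, ih i hp', Fin.cons_succ, ← Fin.succ_castSucc]

end PathSum

/-! ### The boundary of the sums over faces -/

/-- The sum of `ψ` over the boundary of a face, with signs. -/
def faceBoundary {V : Type*} [AddCommGroup V] : ∀ {n : ℕ}, (Fin n → Fin 3) →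
    ((Fin n → Fin 3) → V) → V
  | 0, _, _ => 0
  | _ + 1, w, ψ =>
    (if w 0 = 1 then ψ (Fin.cons 2 (Fin.tail w)) - ψ (Fin.cons 0 (Fin.tail w)) else 0) +
      (if w 0 = 1 then -1 else 1 : ℤ) • faceBoundary (Fin.tail w) fun w' => ψ (Fin.cons (w 0) w')

section FaceBoundary

variable {V : Type*} [AddCommGroup V] {m : ℕ}

theorem faceBoundary_cons_of_ne {n : ℕ} {x : Fin 3} (hx : x ≠ 1) (w : Fin n → Fin 3)
    (ψ : (Fin (n + 1) → Fin 3) → V) : faceBoundary (Fin.cons x w : Fin (n + 1) → Fin 3) ψ =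
      faceBoundary w fun w' => ψ (Fin.cons x w') := by
  simp [faceBoundary, hx]

theorem faceBoundary_cons_one {n : ℕ} (w : Fin n → Fin 3)
    (ψ : (Fin (n + 1) → Fin 3) → V) : faceBoundary (Fin.cons 1 w : Fin (n + 1) → Fin 3) ψ =
      ψ (Fin.cons 2 w) + (-ψ (Fin.cons 0 w) + -faceBoundary w fun w' => ψ (Fin.cons 1 w')) := by
  simp [faceBoundary, sub_eq_add_neg, add_assoc]

/-- Omitting an earlier vertex only renumbers the steps. -/
theorem pathSum_shift {n : ℕ} {p p' : ℕ → Fin n → Fin 2} {c : ℕ} (h : ∀ v, c ≤ v → p' v = p (v + 1))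
    (ψ : (Fin n → Fin 3) → V) : pathSum m p' c ψ = pathSum (m + 1) p (c + 1) ψ := by
  induction n generalizing c with
  | zero => simp [pathSum_zero]
  | succ n ih =>
    rw [pathSum_succ, pathSum_succ, h c le_rfl, h (c + 1) (by omega),
      ih (p := fun v => Fin.tail (p v)) (c := c) fun v hv => congrArg Fin.tail (h v hv),
      ih (p := fun v => Fin.tail (p v)) (c := c + 1) fun v hv => congrArg Fin.tail (h v (by omega))]

/-- The Alexander-Whitney map is compatible with boundaries. The sum on the right runs over the
faces of the path omitting a vertex from the current state on; the earlier vertices do not matter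
any more. -/
theorem pathSum_faceBoundary {n : ℕ} {p : ℕ → Fin n → Fin 2} (hp : Monotone p) {c N : ℕ}
    (h : c + N = m + 2) (ψ : (Fin n → Fin 3) → V) :
    pathSum (m + 1) p c (fun w => faceBoundary w ψ) = ∑ k ∈ Finset.range N,
      (-1 : ℤ) ^ k • pathSum m (fun v => p (SSet.skip (c + k) v)) c ψ := by
  induction n generalizing c N with
  | zero =>
    simp only [pathSum_zero, faceBoundary, ite_self]
    split_ifs with hc
    · obtain rfl : N = 2 := by omega
      simp [Finset.sum_range_succ]
    · simp
  | succ n ih =>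
    have hp' : Monotone fun v => Fin.tail (p v) := fun a b hab i => hp hab _
    rcases N with _ | N
    · rw [Finset.sum_range_zero, pathSum_eq_zero_of_lt _ (by omega)]
    rw [pathSum_succ]
    simp only [faceBoundary_cons_of_ne (endpoint_ne_one _), faceBoundary_cons_one, pathSum_add,
      pathSum_neg, ih hp' h, ih hp' (c := c + 1) (N := N) (by omega)]
    have hskip (k v : ℕ) : SSet.skip (c + k) v = if v < c + k then v else v + 1 := rfl
    have hB (ψ : (Fin n → Fin 3) → V) :
        pathSum m (fun v => Fin.tail (p (SSet.skip (c + 0) v))) c ψ =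
          pathSum (m + 1) (fun v => Fin.tail (p v)) (c + 1) ψ :=
      pathSum_shift (fun v hv => by rw [hskip, if_neg (by omega)]) ψ
    have hC0 (ψ : (Fin n → Fin 3) → V) :
        pathSum m (fun v => Fin.tail (p (SSet.skip (c + 0) v))) (c + 1) ψ =
          pathSum (m + 1) (fun v => Fin.tail (p v)) (c + 2) ψ :=
      pathSum_shift (fun v hv => by rw [hskip, if_neg (by omega)]) ψ
    have hC1 (ψ : (Fin n → Fin 3) → V) :
        pathSum m (fun v => Fin.tail (p (SSet.skip (c + 1 + 0) v))) (c + 1) ψ =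
          pathSum (m + 1) (fun v => Fin.tail (p v)) (c + 2) ψ :=
      pathSum_shift (fun v hv => by rw [SSet.skip_apply, if_neg (by omega)]) ψ
    rw [Finset.sum_range_succ', Finset.sum_range_succ']
    simp only [pathSum_succ (fun v => p (SSet.skip _ v)), hB, hC0, pow_zero, one_smul]
    have e0 : SSet.skip (c + 0) c = c + 1 := by rw [hskip, if_neg (by omega)]
    have e0' : SSet.skip (c + 0) (c + 1) = c + 2 := by rw [hskip, if_neg (by omega)]
    have e1 (k : ℕ) : SSet.skip (c + (k + 1)) c = c := by rw [hskip, if_pos (by omega)]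
    have e2 (k : ℕ) : c + 1 + k = c + (k + 1) := by omega
    simp only [e0, e0', e1]
    have h1 : p c 0 ≤ p (c + 1) 0 := hp (Nat.le_succ _) 0
    have h2 : p (c + 1) 0 ≤ p (c + 2) 0 := hp (Nat.le_succ _) 0
    rcases N with _ | N
    · simp [pathSum_eq_zero_of_lt _ (show m + 1 < c + 1 by omega),
        pathSum_eq_zero_of_lt _ (show m + 1 < c + 2 by omega)]
    · rw [Finset.sum_range_succ' _ N, Finset.sum_range_succ' _ N, Finset.sum_range_succ' _ N, hC1]
      have e3 : SSet.skip (c + (0 + 1)) (c + 1) = c + 2 := by rw [hskip, if_neg (by omega)]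
      have e4 (k : ℕ) : SSet.skip (c + (k + 1 + 1)) (c + 1) = c + 1 := by
        rw [hskip, if_pos (by omega)]
      have e5 (k : ℕ) : c + 1 + (k + 1) = c + (k + 1 + 1) := by omega
      simp only [e3, e4, e5]
      -- Omitting the vertex `v` with `v ≥ c + 2` is covered by induction. The terms for `v = c` and
      -- `v = c + 1` are compared with the endpoints of the interval in the first coordinate, which
      -- depends on its three values at `c`, `c + 1` and `c + 2` only.
      generalize p c 0 = x at *
      generalize p (c + 1) 0 = y at *
      generalize p (c + 2) 0 = z at *
      have key : ∀ x : Fin 2, x = 0 ∨ x = 1 := by decide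
      rcases key x with rfl | rfl <;> rcases key y with rfl | rfl <;>
        rcases key z with rfl | rfl <;> first
        | (clear h2; exfalso; revert h1; decide)
        | (clear h1; exfalso; revert h2; decide)
        | (simp [Finset.sum_add_distrib, pow_succ, endpoint]; done)
        | (simp [Finset.sum_add_distrib, pow_succ, endpoint]; abel)

/-- The boundary of a face in terms of its parametrization. -/
theorem sum_insertAt_faceMap {n : ℕ} (w : Fin n → Fin 3)
    (φ : ((ℕ → Fin 2) → Fin n → Fin 2) → V) :
    ∑ j ∈ Finset.range (faceDim w), (-1 : ℤ) ^ (j + 1) •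
      (φ (fun T => faceMap w (insertAt 0 j T)) - φ (fun T => faceMap w (insertAt 1 j T))) =
      faceBoundary w fun w' => φ (faceMap w') := by
  induction n with
  | zero => rfl
  | succ n ih =>
    refine Fin.consCases (fun x w => ?_) w
    by_cases hx : x = 1
    · subst hx
      have h0 (ε : Fin 2) (x : Fin 3) (hx : x = endpoint ε) :
          (fun T => faceMap (Fin.cons 1 w : Fin (n + 1) → Fin 3) (insertAt ε 0 T)) =
          faceMap (Fin.cons x w : Fin (n + 1) → Fin 3) := by
        funext T
        subst hx
        rw [faceMap_cons, faceMap_cons, cellEval_endpoint, if_pos rfl, if_neg (endpoint_ne_one ε)]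
        rfl
      have h1 (ε : Fin 2) (j : ℕ) :
          (fun T => faceMap (Fin.cons 1 w : Fin (n + 1) → Fin 3) (insertAt ε (j + 1) T)) =
          fun T => Fin.cons (T 0) (faceMap w (insertAt ε j fun i => T (i + 1))) := by
        funext T
        rw [faceMap_cons, if_pos rfl]
        congr 2
        funext i
        simp only [insertAt, Nat.add_lt_add_iff_right, Nat.add_right_cancel_iff]
        split_ifs with h h'
        · rfl
        · rfl
        · congr 1
          omega
      have h2 (w' : Fin n → Fin 3) : faceMap (Fin.cons 1 w' : Fin (n + 1) → Fin 3) =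
          fun T => Fin.cons (T 0) (faceMap w' fun i => T (i + 1)) := by
        funext T
        rw [faceMap_cons, if_pos rfl]
        rfl
      have := ih w fun g => φ fun T => Fin.cons (T 0) (g fun i => T (i + 1))
      simp only [← h2] at this
      rw [faceBoundary_cons_one, ← this, faceDim_cons, if_pos rfl, Finset.sum_range_succ']
      simp only [h1, h0 0 0 rfl, h0 1 2 rfl]
      rw [← Finset.sum_neg_distrib, add_comm, ← add_assoc]
      congr 1
      · rw [zero_add, pow_one, neg_smul, one_smul]
        abel
      · refine Finset.sum_congr rfl fun j _ => ?_
        rw [pow_succ _ (j + 1), mul_neg_one, neg_smul]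
    · have h1 (w' : Fin n → Fin 3) : faceMap (Fin.cons x w' : Fin (n + 1) → Fin 3) =
          fun T => Fin.cons (cellEval x 0) (faceMap w' T) := by
        funext T
        rw [faceMap_cons, if_neg hx]
        congr 1
        unfold cellEval
        have : ∀ x : Fin 3, x ≠ 1 → x = 0 ∨ x = 2 := by decide
        rcases this x hx with rfl | rfl <;> rfl
      rw [faceBoundary_cons_of_ne hx, faceDim_cons, if_neg hx]
      simp only [h1]
      exact ih w fun g => φ fun T => Fin.cons (cellEval x 0) (g T)

end FaceBoundary

/-! ### Faces and morphisms of the cube category -/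

theorem faceDim_insertNth {n : ℕ} (ε : Fin 2) (i : Fin (n + 1)) (w : Fin n → Fin 3) :
    faceDim (i.insertNth (endpoint ε) w : Fin (n + 1) → Fin 3) = faceDim w := by
  induction n with
  | zero =>
    obtain rfl : i = 0 := Fin.eq_zero i
    rw [Fin.insertNth_zero', faceDim_cons, if_neg (endpoint_ne_one ε), add_zero]
  | succ n ih =>
    refine Fin.cases ?_ (fun i => ?_) i
    · rw [Fin.insertNth_zero', faceDim_cons, if_neg (endpoint_ne_one ε), add_zero]
    · rw [insertNth_succ_eq_cons, faceDim_cons, ih]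
      rfl

theorem faceMap_insertNth {n : ℕ} (ε : Fin 2) (i : Fin (n + 1)) (w : Fin n → Fin 3)
    (T : ℕ → Fin 2) : faceMap (i.insertNth (endpoint ε) w : Fin (n + 1) → Fin 3) T =
      CubeMap.face ε i (faceMap w T) := by
  have h0 : ∀ {n : ℕ} (w : Fin n → Fin 3) (T : ℕ → Fin 2),
      faceMap (Fin.insertNth 0 (endpoint ε) w : Fin (n + 1) → Fin 3) T =
      CubeMap.face ε 0 (faceMap w T) := by
    intro n w T
    rw [Fin.insertNth_zero', faceMap_cons, cellEval_endpoint, if_neg (endpoint_ne_one ε),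
      CubeMap.face, Fin.insertNth_zero']
  induction n generalizing T with
  | zero =>
    obtain rfl : i = 0 := Fin.eq_zero i
    exact h0 w T
  | succ n ih =>
    refine Fin.cases (h0 w T) (fun i => ?_) i
    rw [insertNth_succ_eq_cons, faceMap_cons, ih, CubeMap.face, CubeMap.face,
      insertNth_succ_eq_cons]
    rfl

theorem faceDim_const_one (n : ℕ) : faceDim (fun _ : Fin n => 1) = n := by
  induction n with
  | zero => rfl
  | succ n ih =>
    rw [faceDim, if_pos rfl]
    exact congrArg (· + 1) ih

theorem faceMap_const_one {n : ℕ} (T : ℕ → Fin 2) (i : Fin n) :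
    faceMap (fun _ => 1) T i = T i := by
  induction n generalizing T with
  | zero => exact i.elim0
  | succ n ih =>
    refine Fin.cases ?_ (fun i => ?_) i
    · rfl
    · exact ih _ i

theorem exists_endpoint_eq {x : Fin 3} (hx : x ≠ 1) : ∃ ε, x = endpoint ε := by
  revert x
  decide

/-- A map from a cube factors through a degeneracy or a connection, that is, it does not depend on
some coordinate, or it depends on two adjacent coordinates via their minimum only. -/
def IsNegligibleMap {m : ℕ} {β : Type*} (g : (Fin m → Fin 2) → β) : Prop :=
  (∃ s : Fin m, ∀ t t', (∀ j, j ≠ s → t j = t' j) → g t = g t') ∨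
  ∃ s s' : Fin m, (s' : ℕ) = s + 1 ∧ ∀ t t', (∀ j, j ≠ s → j ≠ s' → t j = t' j) →
    min (t s) (t s') = min (t' s) (t' s') → g t = g t'

theorem IsNegligibleMap.comp {m : ℕ} {β γ : Type*} {g : (Fin m → Fin 2) → β}
    (hg : IsNegligibleMap g) (f : β → γ) : IsNegligibleMap (f ∘ g) := by
  rcases hg with ⟨s, hs⟩ | ⟨s, s', h, hs⟩
  · exact Or.inl ⟨s, fun t t' ht => congrArg f (hs t t' ht)⟩
  · exact Or.inr ⟨s, s', h, fun t t' ht ht' => congrArg f (hs t t' ht ht')⟩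

/-- The parametrization of a face by a cube of dimension `m`, which should be that of the face. -/
def faceParam (m : ℕ) {n : ℕ} (w : Fin n → Fin 3) (t : Fin m → Fin 2) : Fin n → Fin 2 :=
  faceMap w (extendZero t)

/-- The coordinate of the parametrizing cube which corresponds to an interior coordinate of
a face. -/
def faceCoord : ∀ {n : ℕ}, (Fin n → Fin 3) → Fin n → ℕ
  | 0, _, _ => 0
  | _ + 1, w, i => Fin.cases 0 (fun i => faceCoord (Fin.tail w) i + if w 0 = 1 then 1 else 0) i

theorem faceCoord_zero {n : ℕ} (w : Fin (n + 1) → Fin 3) : faceCoord w 0 = 0 := rfl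

theorem faceCoord_succ {n : ℕ} (w : Fin (n + 1) → Fin 3) (i : Fin n) : faceCoord w i.succ =
    faceCoord (Fin.tail w) i + if w 0 = 1 then 1 else 0 := rfl

theorem faceMap_apply {n : ℕ} (w : Fin n → Fin 3) (T : ℕ → Fin 2) (i : Fin n) :
    faceMap w T i = cellEval (w i) (T (faceCoord w i)) := by
  induction n generalizing T with
  | zero => exact i.elim0
  | succ n ih =>
    refine Fin.cases ?_ (fun i => ?_) i
    · rfl
    · rw [faceMap, Fin.cons_succ, ih, faceCoord_succ]
      split_ifs <;> rfl

theorem faceCoord_lt {n : ℕ} {w : Fin n → Fin 3} {i : Fin n} (h : w i = 1) :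
    faceCoord w i < faceDim w := by
  induction n with
  | zero => exact i.elim0
  | succ n ih =>
    revert h
    refine Fin.cases (fun h => ?_) (fun i h => ?_) i
    · rw [faceDim, if_pos h, faceCoord_zero]
      omega
    · rw [faceDim, faceCoord_succ]
      have := ih (w := Fin.tail w) h
      omega

theorem faceCoord_lt_faceCoord {n : ℕ} {w : Fin n → Fin 3} {i j : Fin n} (h : w i = 1)
    (hij : i < j) : faceCoord w i < faceCoord w j := by
  induction n with
  | zero => exact i.elim0
  | succ n ih =>
    revert h hij
    refine Fin.cases ?_ (fun i => ?_) i <;> refine Fin.cases ?_ (fun j => ?_) j <;> intro h hij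
    · exact absurd hij (lt_irrefl _)
    · rw [faceCoord_zero, faceCoord_succ, if_pos h]
      omega
    · exact absurd hij (Fin.not_lt_zero _)
    · rw [faceCoord_succ, faceCoord_succ]
      have := ih (w := Fin.tail w) h (Fin.succ_lt_succ_iff.1 hij)
      omega

theorem faceCoord_ne {n : ℕ} {w : Fin n → Fin 3} {i j : Fin n} (hi : w i = 1) (hj : w j = 1)
    (hij : i ≠ j) : faceCoord w i ≠ faceCoord w j := by
  rcases lt_or_gt_of_ne hij with h | h
  · exact (faceCoord_lt_faceCoord hi h).ne
  · exact (faceCoord_lt_faceCoord hj h).ne'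

theorem faceCoord_succ_eq {n : ℕ} (w : Fin (n + 1) → Fin 3) (i : Fin n) :
    faceCoord w i.succ = faceCoord w i.castSucc + if w i.castSucc = 1 then 1 else 0 := by
  induction n with
  | zero => exact i.elim0
  | succ n ih =>
    refine Fin.cases ?_ (fun i => ?_) i
    · rw [faceCoord_succ]
      rfl
    · rw [faceCoord_succ, ih, ← Fin.succ_castSucc, faceCoord_succ]
      exact Nat.add_right_comm _ _ _

theorem cellEval_congr {x : Fin 3} {t t' : Fin 2} (h : x = 1 → t = t') :
    cellEval x t = cellEval x t' := by
  revert x t t'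
  decide

theorem faceParam_congr {n m : ℕ} {w : Fin n → Fin 3} (hw : faceDim w = m) {t t' : Fin m → Fin 2}
    (j : Fin n) (h : w j = 1 → ∀ s : Fin m, (s : ℕ) = faceCoord w j → t s = t' s) :
    faceParam m w t j = faceParam m w t' j := by
  rw [faceParam, faceParam, faceMap_apply, faceMap_apply]
  refine cellEval_congr fun hj => ?_
  have hlt : faceCoord w j < m := hw ▸ faceCoord_lt hj
  rw [extendZero, extendZero, dif_pos hlt, dif_pos hlt]
  exact h hj _ rfl

theorem faceParam_of_eq_one {n m : ℕ} {w : Fin n → Fin 3} {t : Fin m → Fin 2} {j : Fin n}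
    (hj : w j = 1) (s : Fin m) (hs : (s : ℕ) = faceCoord w j) : faceParam m w t j = t s := by
  rw [faceParam, faceMap_apply, hj, ← hs, extendZero_val]
  rfl

theorem isNegligibleMap_degen_faceParam {n m : ℕ} {w : Fin (n + 1) → Fin 3} (hw : faceDim w = m)
    {i : Fin (n + 1)} (hi : w i = 1) : IsNegligibleMap (CubeMap.degen i ∘ faceParam m w) := by
  refine Or.inl ⟨⟨faceCoord w i, hw ▸ faceCoord_lt hi⟩, fun t t' h => ?_⟩
  funext j
  refine faceParam_congr hw _ fun hj s hs => h s ?_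
  rintro rfl
  exact faceCoord_ne hj hi (i.succAbove_ne j) hs.symm

theorem conn_apply_self {n : ℕ} (i : Fin (n + 1)) (t : Fin (n + 2) → Fin 2) :
    CubeMap.conn i t i = min (t i.castSucc) (t i.succ) := by
  have h1 : i.castSucc.succAbove i = i.succ := Fin.succAbove_of_le_castSucc _ _ le_rfl
  have h2 : i.succ.succAbove i = i.castSucc :=
    Fin.succAbove_of_castSucc_lt _ _ i.castSucc_lt_succ
  rw [CubeMap.conn, h1, h2, min_comm]

theorem conn_apply_of_ne {n : ℕ} {i j : Fin (n + 1)} (h : j ≠ i) : ∃ j', j' ≠ i.castSucc ∧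
    j' ≠ i.succ ∧ ∀ t : Fin (n + 2) → Fin 2, CubeMap.conn i t j = t j' := by
  have h' : (j : ℕ) ≠ i := fun e => h (Fin.ext e)
  have h1 : i.succ.succAbove j = i.castSucc.succAbove j := by
    ext
    simp only [CubeMap.val_succAbove, Fin.val_castSucc, Fin.val_succ]
    split_ifs <;> omega
  refine ⟨i.castSucc.succAbove j, Fin.succAbove_ne _ _, ?_, fun t => ?_⟩
  · rw [← h1]
    exact Fin.succAbove_ne _ _
  · rw [CubeMap.conn, h1, min_self]

/-- A face on which a connection drops the dimension becomes negligible: if one of the two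
coordinates is `0` and the other one interior, then the latter is forgotten, and if both are
interior, they remain adjacent in the parametrization. -/
theorem isNegligibleMap_conn_faceParam {n m : ℕ} {w : Fin (n + 2) → Fin 3} (hw : faceDim w = m)
    {i : Fin (n + 1)} (hi : ConnKills (w i.castSucc) (w i.succ)) :
    IsNegligibleMap (CubeMap.conn i ∘ faceParam m w) := by
  have hne : i.castSucc ≠ i.succ := i.castSucc_lt_succ.ne
  -- If one of the two coordinates is `0`, the other one is irrelevant.
  have key (a b : Fin (n + 2)) (hab : a = i.castSucc ∧ b = i.succ ∨ a = i.succ ∧ b = i.castSucc)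
      (ha : w a = 1) (hb : w b = 0) : IsNegligibleMap (CubeMap.conn i ∘ faceParam m w) := by
    refine Or.inl ⟨⟨faceCoord w a, hw ▸ faceCoord_lt ha⟩, fun t t' h => ?_⟩
    funext j
    simp only [Function.comp_apply]
    by_cases hj : j = i
    · subst hj
      have h0 (t : Fin m → Fin 2) : faceParam m w t b = 0 := by
        rw [faceParam, faceMap_apply, hb]
        rfl
      rw [conn_apply_self, conn_apply_self]
      rcases hab with ⟨rfl, rfl⟩ | ⟨rfl, rfl⟩ <;> simp [h0]
    · obtain ⟨j', h1, h2, h3⟩ := conn_apply_of_ne hj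
      rw [h3, h3]
      refine faceParam_congr hw _ fun hj' s hs => h s ?_
      rintro rfl
      refine faceCoord_ne hj' ha ?_ hs.symm
      rcases hab with ⟨rfl, rfl⟩ | ⟨rfl, rfl⟩ <;> assumption
  have key' (ha : w i.castSucc = 1) (hb : w i.succ = 1) :
      IsNegligibleMap (CubeMap.conn i ∘ faceParam m w) := by
    refine Or.inr ⟨⟨faceCoord w i.castSucc, hw ▸ faceCoord_lt ha⟩,
      ⟨faceCoord w i.succ, hw ▸ faceCoord_lt hb⟩, ?_, fun t t' h h' => ?_⟩
    · exact (faceCoord_succ_eq w i).trans (by rw [if_pos ha])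
    · funext j
      simp only [Function.comp_apply]
      by_cases hj : j = i
      · subst hj
        rw [conn_apply_self, conn_apply_self]
        rw [faceParam_of_eq_one ha ⟨faceCoord w j.castSucc, hw ▸ faceCoord_lt ha⟩ rfl,
          faceParam_of_eq_one hb ⟨faceCoord w j.succ, hw ▸ faceCoord_lt hb⟩ rfl, h',
          faceParam_of_eq_one ha ⟨faceCoord w j.castSucc, hw ▸ faceCoord_lt ha⟩ rfl,
          faceParam_of_eq_one hb ⟨faceCoord w j.succ, hw ▸ faceCoord_lt hb⟩ rfl]
      · obtain ⟨j', h1, h2, h3⟩ := conn_apply_of_ne hj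
        rw [h3, h3]
        refine faceParam_congr hw _ fun hj' s hs => h s ?_ ?_
        · rintro rfl
          exact faceCoord_ne hj' ha h1 hs.symm
        · rintro rfl
          exact faceCoord_ne hj' hb h2 hs.symm
  have h3 : ∀ x : Fin 3, x ≠ 2 → x = 0 ∨ x = 1 := by decide
  rcases hi with ⟨ha, hb⟩ | ⟨hb, ha⟩
  · rcases h3 _ hb with hb | hb
    · exact key _ _ (Or.inl ⟨rfl, rfl⟩) ha hb
    · exact key' ha hb
  · rcases h3 _ ha with ha | ha
    · exact key _ _ (Or.inr ⟨rfl, rfl⟩) hb ha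
    · exact key' ha hb

/-- A connection maps a face on which it does not drop the dimension onto the face given by the
minimum of cells, and this is compatible with the parametrizations. -/
theorem conn_faceMap {n : ℕ} {w : Fin (n + 2) → Fin 3} {i : Fin (n + 1)}
    (hi : ¬ ConnKills (w i.castSucc) (w i.succ)) (T : ℕ → Fin 2) :
    CubeMap.conn i (faceMap w T) =
      faceMap (fun j => min (w (i.castSucc.succAbove j)) (w (i.succ.succAbove j))) T := by
  have h0 : ∀ {n : ℕ} {w : Fin (n + 2) → Fin 3} (T : ℕ → Fin 2),
      ¬ ConnKills (w (Fin.castSucc 0)) (w (Fin.succ 0)) → CubeMap.conn 0 (faceMap w T) =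
      faceMap (fun j => min (w (Fin.succAbove (Fin.castSucc 0) j))
        (w (Fin.succAbove (Fin.succ 0) j))) T := by
    intro n w T
    refine Fin.consCases (fun x w => ?_) w
    refine Fin.consCases (fun y w => ?_) w
    intro hi
    rw [min_succAbove_zero, faceMap_cons, faceMap_cons, faceMap_cons]
    refine (min_succAbove_zero _ _ _).trans ?_
    have hi' : ¬ ConnKills x y := hi
    clear hi
    have h3 : ∀ x : Fin 3, x = 0 ∨ x = 1 ∨ x = 2 := by decide
    rcases h3 x with rfl | rfl | rfl <;> rcases h3 y with rfl | rfl | rfl <;> first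
      | (exfalso; revert hi'; decide)
      | simp [cellEval, show T 0 ≤ 1 from Fin.le_last _]
  induction n generalizing T with
  | zero =>
    obtain rfl : i = 0 := Fin.eq_zero i
    exact h0 T hi
  | succ n ih =>
    revert hi
    refine Fin.cases (fun hi => h0 T hi) (fun i => ?_) i
    refine Fin.consCases (fun x w => ?_) w
    intro hi
    rw [min_succAbove_succ, faceMap_cons, faceMap_cons]
    refine (min_succAbove_succ i _ _).trans ?_
    congr 1
    exact ih hi _

theorem isCubeMap_faceParam {n m : ℕ} (w : Fin n → Fin 3) (hw : faceDim w = m) :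
    IsCubeMap (faceParam m w) := by
  induction n with
  | zero =>
    subst hw
    convert! IsCubeMap.id 0 using 1
  | succ n ih =>
    by_cases h : ∃ i, w i ≠ 1
    · obtain ⟨i, hi⟩ := h
      obtain ⟨ε, hε⟩ := exists_endpoint_eq hi
      obtain ⟨w', rfl⟩ : ∃ w', w = i.insertNth (endpoint ε) w' :=
        ⟨i.removeNth w, by rw [← hε, Fin.insertNth_self_removeNth]⟩
      rw [faceDim_insertNth] at hw
      have : faceParam m (i.insertNth (endpoint ε) w' : Fin (n + 1) → Fin 3) =
          CubeMap.face ε i ∘ faceParam m w' := funext fun t => faceMap_insertNth ε i w' _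
      rw [this]
      exact (IsCubeMap.face ε i).comp (ih w' hw)
    · push Not at h
      obtain rfl : w = fun _ => 1 := funext h
      rw [faceDim_const_one] at hw
      subst hw
      convert! IsCubeMap.id (n + 1) using 1
      funext t i
      exact (faceMap_const_one _ i).trans (extendZero_val t i)

/-- The Alexander-Whitney map is natural with respect to the morphisms of the cube category, up to
faces which factor through degeneracies or connections. -/
theorem pathSum_push {V : Type*} [AddCommGroup V] {m n n' : ℕ}
    {l : (Fin n → Fin 2) → (Fin n' → Fin 2)} (hl : IsCubeMap l) {p : ℕ → Fin n → Fin 2}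
    (hp : Monotone p) (Ψ : ((Fin m → Fin 2) → Fin n' → Fin 2) → V)
    (hΨ : ∀ g, IsNegligibleMap g → Ψ g = 0) :
    pathSum m (fun v => l (p v)) 0 (fun w => Ψ (faceParam m w)) =
      pathSum m p 0 (fun w => Ψ (l ∘ faceParam m w)) := by
  induction hl with
  | id n => rfl
  | @comp _ _ _ g f hg hf ihg ihf =>
    have h1 : Monotone fun v => f (p v) := fun a b h => hf.monotone (hp h)
    exact (ihg h1 Ψ hΨ).trans (ihf hp (fun h => Ψ (g ∘ h)) fun h hh => hΨ _ (hh.comp g))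
  | face ε i =>
    rw [pathSum_face]
    congr 1
    funext w
    congr 1
    exact funext fun t => faceMap_insertNth ε i w _
  | degen i =>
    rw [pathSum_degen]
    refine pathSum_congr hp 0 fun w hw _ => ?_
    rw [zero_add] at hw
    split_ifs with hi
    · exact (hΨ _ (isNegligibleMap_degen_faceParam hw hi)).symm
    · obtain ⟨ε, hε⟩ := exists_endpoint_eq hi
      obtain ⟨w', rfl⟩ : ∃ w', w = i.insertNth (endpoint ε) w' :=
        ⟨i.removeNth w, by rw [← hε, Fin.insertNth_self_removeNth]⟩
      congr 1
      funext t
      simp only [Fin.insertNth_apply_succAbove, Function.comp_apply, faceParam, faceMap_insertNth]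
      funext j
      simp [CubeMap.degen, CubeMap.face]
  | conn i =>
    rw [pathSum_conn i hp]
    refine pathSum_congr hp 0 fun w hw _ => ?_
    rw [zero_add] at hw
    split_ifs with hi
    · exact (hΨ _ (isNegligibleMap_conn_faceParam hw hi)).symm
    · congr 1
      exact funext fun t => (conn_faceMap hi _).symm

/-! ### Transfer of dg bialgebras to retracts -/

section Retract

variable {k : Type v} [CommRing k] {A B : ℕ → Type w} [∀ n, AddCommGroup (A n)]
  [∀ n, Module k (A n)] [∀ n, AddCommGroup (B n)] [∀ n, Module k (B n)]

theorem lmap_signInvolution (f : ∀ n, A n →ₗ[k] B n) (a : ⨁ n, A n) :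
    DirectSum.lmap f (signInvolution k A a) = signInvolution k B (DirectSum.lmap f a) := by
  suffices h : DirectSum.lmap f ∘ₗ signInvolution k A = signInvolution k B ∘ₗ DirectSum.lmap f from
    LinearMap.congr_fun h a
  refine DirectSum.linearMap_ext k fun n => LinearMap.ext fun x => ?_
  simp only [LinearMap.comp_apply, signInvolution_lof, DirectSum.lmap_lof, map_zsmul]

theorem lmap_totalDifferential {d : ∀ n, A (n + 1) →ₗ[k] A n} {d' : ∀ n, B (n + 1) →ₗ[k] B n}
    {f : ∀ n, A n →ₗ[k] B n} (hf : ∀ n a, f n (d n a) = d' n (f (n + 1) a)) (a : ⨁ n, A n) :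
    DirectSum.lmap f (totalDifferential k d a) =
      totalDifferential k d' (DirectSum.lmap f a) := by
  suffices h : DirectSum.lmap f ∘ₗ totalDifferential k d =
      totalDifferential k d' ∘ₗ DirectSum.lmap f from LinearMap.congr_fun h a
  refine DirectSum.linearMap_ext k fun n => LinearMap.ext fun x => ?_
  simp only [LinearMap.comp_apply, DirectSum.lmap_lof]
  cases n with
  | zero => rw [totalDifferential_lof_zero, totalDifferential_lof_zero, map_zero]
  | succ n => rw [totalDifferential_lof_succ, totalDifferential_lof_succ, DirectSum.lmap_lof, hf]

theorem middleSwap_map_lmap (f : ∀ n, A n →ₗ[k] B n) (x y : (⨁ n, A n) ⊗[k] ⨁ n, A n) :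
    middleSwap k B (TensorProduct.map (DirectSum.lmap f) (DirectSum.lmap f) x ⊗ₜ[k]
      TensorProduct.map (DirectSum.lmap f) (DirectSum.lmap f) y) =
    TensorProduct.map (TensorProduct.map (DirectSum.lmap f) (DirectSum.lmap f))
      (TensorProduct.map (DirectSum.lmap f) (DirectSum.lmap f)) (middleSwap k A (x ⊗ₜ[k] y)) := by
  suffices h : middleSwap k B ∘ₗ
      TensorProduct.map (TensorProduct.map (DirectSum.lmap f) (DirectSum.lmap f))
        (TensorProduct.map (DirectSum.lmap f) (DirectSum.lmap f)) =
      TensorProduct.map (TensorProduct.map (DirectSum.lmap f) (DirectSum.lmap f))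
        (TensorProduct.map (DirectSum.lmap f) (DirectSum.lmap f)) ∘ₗ middleSwap k A from
    LinearMap.congr_fun h (x ⊗ₜ y)
  refine TensorProduct.ext (TensorProduct.ext ?_)
  refine LinearMap.ext fun a => DirectSum.linearMap_ext k fun q => LinearMap.ext fun b => ?_
  refine TensorProduct.ext (DirectSum.linearMap_ext k fun p => LinearMap.ext fun a' =>
    LinearMap.ext fun b' => ?_)
  simp only [LinearMap.comp_apply, LinearMap.compr₂ₛₗ_apply, TensorProduct.mk_apply,
    TensorProduct.map_tmul, DirectSum.lmap_lof, middleSwap_tmul]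
  rw [← Int.cast_smul_eq_zsmul k, ← Int.cast_smul_eq_zsmul k, map_smul]
  simp only [TensorProduct.map_tmul, DirectSum.lmap_lof]

namespace DGBialgebra

/-- A graded module which is a retract of a dg bialgebra. The retraction is not assumed to
be compatible with any structure, but the retract is closed under all structure maps. -/
structure RetractData (T : DGBialgebra k B) (A : ℕ → Type w) [∀ n, AddCommGroup (A n)]
    [∀ n, Module k (A n)] where
  /-- The inclusion. -/
  f : ∀ n, A n →ₗ[k] B n
  /-- The retraction. -/
  g : ∀ n, B n →ₗ[k] A n
  g_f : ∀ n a, g n (f n a) = a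
  d_mem : ∀ n a, ∃ b, f n b = T.d n (f (n + 1) a)
  mul_mem : ∀ a b, ∃ c, DirectSum.lmap f c = T.mul (DirectSum.lmap f a) (DirectSum.lmap f b)
  one_mem : ∃ c, DirectSum.lmap f c = T.one
  comul_mem : ∀ a, ∃ c, TensorProduct.map (DirectSum.lmap f) (DirectSum.lmap f) c =
    T.comul (DirectSum.lmap f a)

namespace RetractData

variable {T : DGBialgebra k B} (R : T.RetractData A)

/-- The inclusion of total modules. -/
noncomputable abbrev F : (⨁ n, A n) →ₗ[k] ⨁ n, B n := DirectSum.lmap R.f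

/-- The retraction of total modules. -/
noncomputable abbrev G : (⨁ n, B n) →ₗ[k] ⨁ n, A n := DirectSum.lmap R.g

theorem G_comp_F : R.G ∘ₗ R.F = LinearMap.id :=
  DirectSum.linearMap_ext k fun n => LinearMap.ext fun a => by
    simp only [LinearMap.comp_apply, DirectSum.lmap_lof, R.g_f, LinearMap.id_apply]

theorem G_F (a : ⨁ n, A n) : R.G (R.F a) = a := LinearMap.congr_fun R.G_comp_F a

theorem F_injective : Function.Injective R.F := Function.LeftInverse.injective R.G_F

theorem G_tensor_F (x : (⨁ n, A n) ⊗[k] ⨁ n, A n) :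
    TensorProduct.map R.G R.G (TensorProduct.map R.F R.F x) = x := by
  rw [← LinearMap.comp_apply, ← TensorProduct.map_comp, G_comp_F, TensorProduct.map_id,
    LinearMap.id_apply]

/-- The differential of the retract. -/
noncomputable def d (n : ℕ) : A (n + 1) →ₗ[k] A n := R.g n ∘ₗ T.d n ∘ₗ R.f (n + 1)

/-- The product of the retract. -/
noncomputable def mul : (⨁ n, A n) →ₗ[k] (⨁ n, A n) →ₗ[k] ⨁ n, A n :=
  (T.mul.compl₁₂ R.F R.F).compr₂ R.G

/-- The diagonal of the retract. -/
noncomputable def comul : (⨁ n, A n) →ₗ[k] (⨁ n, A n) ⊗[k] ⨁ n, A n :=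
  TensorProduct.map R.G R.G ∘ₗ T.comul ∘ₗ R.F

theorem f_d (n : ℕ) (a : A (n + 1)) : R.f n (R.d n a) = T.d n (R.f (n + 1) a) := by
  obtain ⟨b, hb⟩ := R.d_mem n a
  rw [d, LinearMap.comp_apply, LinearMap.comp_apply, ← hb, R.g_f]

theorem F_d (a : ⨁ n, A n) :
    R.F (totalDifferential k R.d a) = totalDifferential k T.d (R.F a) :=
  lmap_totalDifferential R.f_d a

theorem F_mul (a b : ⨁ n, A n) : R.F (R.mul a b) = T.mul (R.F a) (R.F b) := by
  obtain ⟨c, hc⟩ := R.mul_mem a b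
  rw [mul, LinearMap.compr₂_apply, LinearMap.compl₁₂_apply, ← hc, R.G_F]

theorem F_one : R.F (R.G T.one) = T.one := by
  obtain ⟨c, hc⟩ := R.one_mem
  rw [← hc, R.G_F]

theorem F_comul (a : ⨁ n, A n) :
    TensorProduct.map R.F R.F (R.comul a) = T.comul (R.F a) := by
  obtain ⟨c, hc⟩ := R.comul_mem a
  rw [comul, LinearMap.comp_apply, LinearMap.comp_apply, ← hc, R.G_tensor_F]

theorem eq_of_F_tensor {x y : (⨁ n, A n) ⊗[k] ⨁ n, A n}
    (h : TensorProduct.map R.F R.F x = TensorProduct.map R.F R.F y) : x = y := by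
  rw [← R.G_tensor_F x, h, R.G_tensor_F]

theorem coassoc (a : ⨁ n, A n) :
    TensorProduct.assoc k _ _ _ (R.comul.rTensor (⨁ n, A n) (R.comul a)) =
      R.comul.lTensor (⨁ n, A n) (R.comul a) := by
  have h1 (x : (⨁ n, A n) ⊗[k] ⨁ n, A n) :
      TensorProduct.map R.F (TensorProduct.map R.F R.F)
        (TensorProduct.assoc k _ _ _ (R.comul.rTensor (⨁ n, A n) x)) =
      TensorProduct.assoc k _ _ _ (T.comul.rTensor _ (TensorProduct.map R.F R.F x)) := by
    induction x with
    | zero => simp only [map_zero]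
    | add x y hx hy => simp only [map_add, hx, hy]
    | tmul x y =>
      rw [TensorProduct.map_tmul, LinearMap.rTensor_tmul, LinearMap.rTensor_tmul, ← R.F_comul]
      generalize R.comul x = z
      induction z with
      | zero => simp only [map_zero, TensorProduct.zero_tmul]
      | add x y hx hy => simp only [map_add, TensorProduct.add_tmul, hx, hy]
      | tmul x y => simp only [TensorProduct.map_tmul, TensorProduct.assoc_tmul]
  have h2 (x : (⨁ n, A n) ⊗[k] ⨁ n, A n) :
      TensorProduct.map R.F (TensorProduct.map R.F R.F) (R.comul.lTensor (⨁ n, A n) x) =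
      T.comul.lTensor _ (TensorProduct.map R.F R.F x) := by
    induction x with
    | zero => simp only [map_zero]
    | add x y hx hy => simp only [map_add, hx, hy]
    | tmul x y =>
      rw [TensorProduct.map_tmul, LinearMap.lTensor_tmul, LinearMap.lTensor_tmul, ← R.F_comul,
        TensorProduct.map_tmul]
  have h3 (x : (⨁ n, A n) ⊗[k] ((⨁ n, A n) ⊗[k] ⨁ n, A n)) :
      TensorProduct.map R.G (TensorProduct.map R.G R.G)
        (TensorProduct.map R.F (TensorProduct.map R.F R.F) x) = x := by
    rw [← LinearMap.comp_apply, ← TensorProduct.map_comp, ← TensorProduct.map_comp, G_comp_F,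
      TensorProduct.map_id, TensorProduct.map_id, LinearMap.id_apply]
  rw [← h3 (TensorProduct.assoc k _ _ _ _), h1, ← h3 (R.comul.lTensor _ _), h2, R.F_comul,
    T.coassoc]

/-- The dg bialgebra structure on a retract. -/
noncomputable def bialgebra : DGBialgebra k A where
  d := R.d
  mul := R.mul
  one := R.G T.one
  comul := R.comul
  counit := T.counit ∘ₗ R.F
  d_comp_d n := LinearMap.ext fun a => by
    have h := LinearMap.congr_fun (T.d_comp_d n) (R.f (n + 2) a)
    rw [LinearMap.comp_apply, ← R.f_d, ← R.f_d] at h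
    have := congrArg (R.g n) h
    rwa [R.g_f, LinearMap.zero_apply, map_zero] at this
  mul_degree p q a b := by
    obtain ⟨c, hc⟩ := T.mul_degree p q (R.f p a) (R.f q b)
    refine ⟨R.g _ c, ?_⟩
    rw [mul, LinearMap.compr₂_apply, LinearMap.compl₁₂_apply, DirectSum.lmap_lof,
      DirectSum.lmap_lof, ← hc, DirectSum.lmap_lof]
  one_degree := by
    obtain ⟨c, hc⟩ := T.one_degree
    exact ⟨R.g _ c, by rw [← hc, DirectSum.lmap_lof]⟩
  comul_degree n a := by
    have h := T.comul_degree n (R.f n a)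
    rw [comul, LinearMap.comp_apply, LinearMap.comp_apply, DirectSum.lmap_lof]
    revert h
    generalize T.comul (DirectSum.lof k ℕ B n (R.f n a)) = z
    intro h
    refine (iSup_le (fun p => ?_) : (⨆ p : {p : ℕ × ℕ // p.1 + p.2 = n}, LinearMap.range
      (TensorProduct.map (DirectSum.lof k ℕ B p.1.1) (DirectSum.lof k ℕ B p.1.2))) ≤
      Submodule.comap (TensorProduct.map R.G R.G) (⨆ p : {p : ℕ × ℕ // p.1 + p.2 = n},
        LinearMap.range (TensorProduct.map (DirectSum.lof k ℕ A p.1.1)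
          (DirectSum.lof k ℕ A p.1.2)))) h
    rintro _ ⟨z, rfl⟩
    refine Submodule.mem_iSup_of_mem p ⟨TensorProduct.map (R.g _) (R.g _) z, ?_⟩
    rw [← LinearMap.comp_apply, ← LinearMap.comp_apply, ← TensorProduct.map_comp,
      ← TensorProduct.map_comp]
    congr 2 <;> exact LinearMap.ext fun x => (DirectSum.lmap_lof _ _ _).symm
  counit_degree n a := by
    rw [LinearMap.comp_apply, DirectSum.lmap_lof, T.counit_degree]
  mul_assoc a b c := R.F_injective (by simp only [F_mul, T.mul_assoc])
  one_mul a := R.F_injective (by simp only [F_mul, F_one, T.one_mul])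
  mul_one a := R.F_injective (by simp only [F_mul, F_one, T.mul_one])
  coassoc := R.coassoc
  counit_comul a := by
    have h (x : (⨁ n, A n) ⊗[k] ⨁ n, A n) : (T.counit ∘ₗ R.F).rTensor (⨁ n, A n) x =
        R.G.lTensor k (T.counit.rTensor _ (TensorProduct.map R.F R.F x)) := by
      induction x with
      | zero => simp only [map_zero]
      | add x y hx hy => simp only [map_add, hx, hy]
      | tmul x y => simp only [TensorProduct.map_tmul, LinearMap.rTensor_tmul,
          LinearMap.lTensor_tmul, LinearMap.comp_apply, R.G_F]
    rw [h, R.F_comul, T.counit_comul, LinearMap.lTensor_tmul, R.G_F]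
  comul_counit a := by
    have h (x : (⨁ n, A n) ⊗[k] ⨁ n, A n) : (T.counit ∘ₗ R.F).lTensor (⨁ n, A n) x =
        R.G.rTensor k (T.counit.lTensor _ (TensorProduct.map R.F R.F x)) := by
      induction x with
      | zero => simp only [map_zero]
      | add x y hx hy => simp only [map_add, hx, hy]
      | tmul x y => simp only [TensorProduct.map_tmul, LinearMap.rTensor_tmul,
          LinearMap.lTensor_tmul, LinearMap.comp_apply, R.G_F]
    rw [h, R.F_comul, T.comul_counit, LinearMap.rTensor_tmul, R.G_F]
  comul_mul a b := by
    apply R.eq_of_F_tensor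
    have h : R.F ∘ₗ TensorProduct.lift R.mul =
        TensorProduct.lift T.mul ∘ₗ TensorProduct.map R.F R.F :=
      TensorProduct.ext' fun x y => by
        simp only [LinearMap.comp_apply, TensorProduct.lift.tmul, TensorProduct.map_tmul, F_mul]
    rw [R.F_comul, R.F_mul, T.comul_mul, ← R.F_comul, ← R.F_comul, middleSwap_map_lmap,
      ← LinearMap.comp_apply, ← TensorProduct.map_comp, ← h, TensorProduct.map_comp,
      LinearMap.comp_apply]
  comul_one := by
    apply R.eq_of_F_tensor
    rw [R.F_comul, R.F_one, T.comul_one, TensorProduct.map_tmul, R.F_one]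
  counit_mul a b := by
    rw [LinearMap.comp_apply, R.F_mul, T.counit_mul]
    rfl
  counit_one := by rw [LinearMap.comp_apply, R.F_one, T.counit_one]
  d_mul a b := by
    apply R.F_injective
    rw [R.F_d, R.F_mul, T.d_mul, map_add, R.F_mul, R.F_mul, R.F_d, R.F_d, lmap_signInvolution]
  d_comul a := by
    apply R.eq_of_F_tensor
    have h1 (x : (⨁ n, A n) ⊗[k] ⨁ n, A n) :
        TensorProduct.map R.F R.F ((totalDifferential k R.d).rTensor _ x) =
          (totalDifferential k T.d).rTensor _ (TensorProduct.map R.F R.F x) := by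
      induction x with
      | zero => simp only [map_zero]
      | add x y hx hy => simp only [map_add, hx, hy]
      | tmul x y => simp only [TensorProduct.map_tmul, LinearMap.rTensor_tmul, F_d]
    have h2 (x : (⨁ n, A n) ⊗[k] ⨁ n, A n) : TensorProduct.map R.F R.F
        (TensorProduct.map (signInvolution k A) (totalDifferential k R.d) x) =
          TensorProduct.map (signInvolution k B) (totalDifferential k T.d)
            (TensorProduct.map R.F R.F x) := by
      induction x with
      | zero => simp only [map_zero]
      | add x y hx hy => simp only [map_add, hx, hy]
      | tmul x y => simp only [TensorProduct.map_tmul, lmap_signInvolution, F_d]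
    rw [R.F_comul, R.F_d, T.d_comul, map_add, h1, h2, R.F_comul]
  counit_d a := by rw [LinearMap.comp_apply, R.F_d, T.counit_d]

/-- The inclusion of a retract as a morphism of dg bialgebras. -/
noncomputable def hom : Hom R.bialgebra T where
  f := R.f
  comm_d n := LinearMap.ext fun a => R.f_d n a
  map_mul := R.F_mul
  map_one := R.F_one
  map_comul a := (R.F_comul a).symm
  map_counit _ := rfl

end RetractData

end DGBialgebra

end Retract

/-! ### The retraction of simplicial onto cubical chains -/

/-- A negligible map factors through a degeneracy or a connection, the other factor being its
restriction to a face. -/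
theorem IsNegligibleMap.induction {β : Type*} {P : ∀ m : ℕ, ((Fin m → Fin 2) → β) → Prop}
    (hd : ∀ (m : ℕ) (g : (Fin (m + 1) → Fin 2) → β) (i : Fin (m + 1)),
      g = (g ∘ CubeMap.face 0 i) ∘ CubeMap.degen i → P (m + 1) g)
    (hc : ∀ (m : ℕ) (g : (Fin (m + 2) → Fin 2) → β) (i : Fin (m + 1)),
      g = (g ∘ CubeMap.face 1 i.castSucc) ∘ CubeMap.conn i → P (m + 2) g)
    {m : ℕ} {g : (Fin m → Fin 2) → β} (hg : IsNegligibleMap g) : P m g := by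
  rcases hg with ⟨s, hs⟩ | ⟨s, s', hss, hs⟩
  · obtain _ | m := m
    · exact s.elim0
    refine hd m g s (funext fun t => hs _ _ fun j hj => ?_)
    obtain ⟨j, rfl⟩ := Fin.exists_succAbove_eq hj
    simp [CubeMap.face, CubeMap.degen]
  · obtain _ | _ | m := m
    · exact s.elim0
    · omega
    obtain ⟨i, rfl⟩ : ∃ i : Fin (m + 1), s = i.castSucc := ⟨⟨s, by omega⟩, rfl⟩
    obtain rfl : s' = i.succ := Fin.ext hss
    have h1 : i.castSucc.succAbove i = i.succ := Fin.succAbove_of_le_castSucc _ _ le_rfl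
    have h2 (t : Fin (m + 1) → Fin 2) : CubeMap.face 1 i.castSucc t i.succ = t i :=
      (congrArg _ h1.symm).trans (Fin.insertNth_apply_succAbove _ _ _ _)
    refine hc m g i (funext fun t => hs _ _ (fun j hj hj' => ?_) ?_)
    · obtain ⟨j, rfl⟩ := Fin.exists_succAbove_eq hj
      have h3 : j ≠ i := by
        rintro rfl
        exact hj' h1
      have h3' : (j : ℕ) ≠ i := fun e => h3 (Fin.ext e)
      have h4 : i.succ.succAbove j = i.castSucc.succAbove j := by
        ext
        simp only [CubeMap.val_succAbove, Fin.val_castSucc, Fin.val_succ]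
        split_ifs <;> omega
      simp [CubeMap.face, CubeMap.conn, h4]
    · rw [h2, conn_apply_self]
      have : (CubeMap.face 1 i.castSucc (CubeMap.conn i t) i.castSucc : Fin 2) = Fin.last 1 := by
        simp [CubeMap.face]
      rw [this, min_eq_right (Fin.le_last _)]

namespace CubeSimplex

variable {n m : ℕ} {V : Type*} [AddCommGroup V]

/-- The sequence of vertices of a simplex of the cube, continued by its last vertex. -/
def path (s : CubeSimplex n m) (v : ℕ) : Fin n → Fin 2 := s ⟨min v m, by omega⟩

theorem path_monotone (s : CubeSimplex n m) : Monotone s.path := fun a b h => s.monotone <| by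
  refine Fin.le_def.2 ?_
  simp only
  omega

theorem path_val (s : CubeSimplex n m) (v : Fin (m + 1)) : s.path v = s v :=
  congrArg s (Fin.ext (min_eq_left (by omega)))

/-- The sum of the values of `Ψ` on the parametrized `m`-dimensional faces of the cube which
occur in the Alexander-Whitney map of an `m`-simplex. -/
def faceSum (s : CubeSimplex n m) (Ψ : ((Fin m → Fin 2) → Fin n → Fin 2) → V) : V :=
  pathSum m s.path 0 fun w => Ψ (faceParam m w)

theorem faceSum_push {n' : ℕ} (l : (⟨n⟩ : Cube) ⟶ ⟨n'⟩) (s : CubeSimplex n m)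
    (Ψ : ((Fin m → Fin 2) → Fin n' → Fin 2) → V) (hΨ : ∀ g, IsNegligibleMap g → Ψ g = 0) :
    faceSum (push l s) Ψ = faceSum s fun g => Ψ (l.1 ∘ g) :=
  pathSum_push l.2 s.path_monotone Ψ hΨ

theorem faceSum_eq_zero {s : CubeSimplex n m} {i : Fin m} (h : s i.castSucc = s i.succ)
    (Ψ : ((Fin m → Fin 2) → Fin n → Fin 2) → V) : faceSum s Ψ = 0 := by
  refine pathSum_eq_zero_of_step i.2 ?_ (Nat.zero_le _) _
  exact (s.path_val i.castSucc).trans (h.trans (s.path_val i.succ).symm)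

/-- Only faces above the first vertex occur in the Alexander-Whitney map of a simplex. -/
theorem faceSum_congr {s : CubeSimplex n m} {Ψ Ψ' : ((Fin m → Fin 2) → Fin n → Fin 2) → V}
    (h : ∀ g, IsCubeMap g → (∀ t, s 0 ≤ g t) → Ψ g = Ψ' g) : faceSum s Ψ = faceSum s Ψ' := by
  refine pathSum_congr s.path_monotone 0 fun w hw hw' => h _ ?_ fun t i => ?_
  · exact isCubeMap_faceParam w (by omega)
  · by_cases hi : s 0 i = 1
    · rw [faceParam, faceMap_apply, hw' i ((congrFun (s.path_val 0) i).trans hi), hi]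
      exact le_rfl
    · have : ∀ x : Fin 2, x ≠ 1 → x = 0 := by decide
      rw [this _ hi]
      exact Fin.zero_le _

theorem map_faceSum {W : Type*} [AddCommGroup W] (f : V →+ W) (s : CubeSimplex n m)
    (Ψ : ((Fin m → Fin 2) → Fin n → Fin 2) → V) :
    f (faceSum s Ψ) = faceSum s fun g => f (Ψ g) := map_pathSum f _ _ _

/-- The Alexander-Whitney map is zero on a maximal simplex of the cube unless the coordinates change
in their order, in which case it gives the whole cube. -/
theorem faceSum_ofPerm (π : Equiv.Perm (Fin n)) (Ψ : ((Fin n → Fin 2) → Fin n → Fin 2) → V) :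
    faceSum (ofPerm π) Ψ = if π = 1 then Ψ id else 0 := by
  have h1 : faceParam n (fun _ : Fin n => 1) = id :=
    funext fun t => funext fun i => (faceMap_const_one _ i).trans (extendZero_val t i)
  rw [faceSum, pathSum_of_add_eq _ (Nat.zero_add n), h1]
  refine if_congr ⟨fun h => ?_, ?_⟩ rfl rfl
  · have h2 : ∀ i, π.symm i = i := fun i => by
      have := h i
      rw [Nat.zero_add] at this
      change ofPerm π _ i ≠ ofPerm π _ i at this
      have h3 := i.2
      rw [SingularCube.ofPerm_apply, SingularCube.ofPerm_apply] at this
      simp only [show min (i : ℕ) n = i by omega, show min ((i : ℕ) + 1) n = i + 1 by omega] at this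
      refine Fin.ext ?_
      by_contra hne
      refine this ?_
      split_ifs <;> first | rfl | omega
    refine Equiv.ext fun i => ?_
    exact ((Equiv.symm_apply_eq π).1 (h2 i)).symm
  · rintro rfl i
    have h3 := i.2
    change ofPerm 1 _ i ≠ ofPerm 1 _ i
    rw [SingularCube.ofPerm_apply, SingularCube.ofPerm_apply]
    simp [show (Equiv.symm (1 : Equiv.Perm (Fin n))) i = i from rfl]

end CubeSimplex

namespace CubicalSet

variable {Y : CubicalSet.{u}} (k : Type v) [CommRing k]

theorem pull_comp {a b c : ℕ} (f : (⟨a⟩ : Cube) ⟶ ⟨b⟩) (g : (⟨b⟩ : Cube) ⟶ ⟨c⟩) (y : Y.cubes c) :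
    Y.pull (f ≫ g) y = Y.pull f (Y.pull g y) := by
  rw [pull, op_comp, Y.map_comp]
  rfl

open Classical in
/-- The class of the cube `y ∘ g`, the value being `0` if `g` is not in the cube category. -/
noncomputable def faceCell {n m : ℕ} (y : Y.cubes n) (g : (Fin m → Fin 2) → Fin n → Fin 2) :
    Y.NChains k m :=
  if h : IsCubeMap g then cell k (Y.pull ⟨g, h⟩ y) else 0

theorem faceCell_of {n m : ℕ} (y : Y.cubes n) {g : (Fin m → Fin 2) → Fin n → Fin 2}
    (h : IsCubeMap g) : faceCell k y g = cell k (Y.pull ⟨g, h⟩ y) := dif_pos h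

theorem faceCell_eq_zero {n m : ℕ} (y : Y.cubes n) {g : (Fin m → Fin 2) → Fin n → Fin 2}
    (hg : IsNegligibleMap g) : faceCell k y g = 0 := by
  by_cases h : IsCubeMap g
  · rw [faceCell_of k y h]
    refine cell_eq_zero ?_
    revert h
    refine IsNegligibleMap.induction (P := fun m g => ∀ h : IsCubeMap g,
      Y.IsNegligible m (Y.pull ⟨g, h⟩ y)) ?_ ?_ hg
    · intro m g i hg h
      have : (⟨g, h⟩ : (⟨m + 1⟩ : Cube) ⟶ ⟨n⟩) =
          Cube.degen i ≫ (⟨g ∘ CubeMap.face 0 i, h.comp (.face 0 i)⟩ : (⟨m⟩ : Cube) ⟶ ⟨n⟩) :=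
        Subtype.ext hg
      rw [this, pull_comp]
      exact .degenerate i _
    · intro m g i hg h
      have : (⟨g, h⟩ : (⟨m + 2⟩ : Cube) ⟶ ⟨n⟩) = Cube.conn i ≫
          (⟨g ∘ CubeMap.face 1 i.castSucc, h.comp (.face 1 _)⟩ : (⟨m + 1⟩ : Cube) ⟶ ⟨n⟩) :=
        Subtype.ext hg
      rw [this, pull_comp]
      exact .folded i _
  · exact dif_neg h

theorem faceCell_pull {n n' m : ℕ} (l : (⟨n⟩ : Cube) ⟶ ⟨n'⟩) (y : Y.cubes n')
    {g : (Fin m → Fin 2) → Fin n → Fin 2} (hg : IsCubeMap g) :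
    faceCell k (Y.pull l y) g = faceCell k y (l.1 ∘ g) := by
  rw [faceCell_of k _ hg, faceCell_of k _ (l.2.comp hg), ← pull_comp]
  rfl

/-- A degenerate simplex of the triangulation has a representative with a repeated vertex. -/
theorem exists_simplex_of_mem_degenerate {m : ℕ}
    {x : Y.triang.obj (op (SimplexCategory.mk (m + 1)))} (hx : x ∈ Y.triang.degenerate (m + 1)) :
    ∃ (n : ℕ) (y : Y.cubes n) (s : CubeSimplex n (m + 1)) (i : Fin (m + 1)),
      s i.castSucc = s i.succ ∧ x = Y.simplex y s := by
  obtain ⟨i, z, rfl⟩ := SSet.exists_restrict_of_mem_degenerate hx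
  induction z using Quot.ind with | mk a
  refine ⟨a.1, a.2.1, a.2.2.comp i.predAboveOrderHom, i, ?_, rfl⟩
  simp

variable (Y)

/-- The map sending the simplex `[y, s]` to the sum of the cubes `y ∘ g` over those faces `g`
which occur in the Alexander-Whitney map of `s`. -/
noncomputable def cubicalChain (m : ℕ) : Y.triang.NChains k m →ₗ[k] Y.NChains k m :=
  SSet.chainLift (Quot.lift (fun a => CubeSimplex.faceSum a.2.2 (faceCell k a.2.1)) (by
    rintro _ _ ⟨l, y, s⟩
    rw [CubeSimplex.faceSum_push _ _ _ fun g => faceCell_eq_zero k y]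
    exact CubeSimplex.faceSum_congr fun g hg _ => faceCell_pull k l y hg)) (by
    intro x hx
    obtain _ | m := m
    · exact absurd hx SSet.not_mem_degenerate_zero
    · obtain ⟨n, y, s, i, hi, rfl⟩ := exists_simplex_of_mem_degenerate hx
      exact CubeSimplex.faceSum_eq_zero hi _)

theorem cubicalChain_cell {n m : ℕ} (y : Y.cubes n) (s : CubeSimplex n m) :
    Y.cubicalChain k m (SSet.cell k (Y.simplex y s)) = CubeSimplex.faceSum s (faceCell k y) :=
  SSet.chainLift_cell _ _ _

/-- The retraction is a left inverse of the map from cubical to simplicial chains. -/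
theorem cubicalChain_triangChain (n : ℕ) (a : Y.NChains k n) :
    Y.cubicalChain k n (Y.triangChain k n a) = a := by
  suffices h : Y.cubicalChain k n ∘ₗ Y.triangChain k n = LinearMap.id from
    LinearMap.congr_fun h a
  refine chain_hom_ext fun y => ?_
  rw [LinearMap.comp_apply, triangChain_cell, SingularCube.chain, map_sum]
  have (π : Equiv.Perm (Fin n)) : Y.cubicalChain k n ((Equiv.Perm.sign π : ℤ) •
      SSet.cell k ((singular y).toFun (CubeSimplex.ofPerm π))) =
      if π = 1 then cell k y else 0 := by
    rw [map_zsmul]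
    refine (congrArg _ (cubicalChain_cell Y k y _)).trans ?_
    rw [CubeSimplex.faceSum_ofPerm]
    split_ifs with h
    · subst h
      rw [Equiv.Perm.sign_one, Units.val_one, one_zsmul, faceCell_of k y (.id n)]
      exact congrArg _ (pull_id y)
    · exact smul_zero _
  rw [Finset.sum_congr rfl fun π _ => this π, Finset.sum_ite_eq' , if_pos (Finset.mem_univ _)]
  rfl

end CubicalSet

/-! ### The dg bialgebra of a cubical monoid -/

theorem CubicalSet.mem_of_totalCell_mem {k : Type v} [CommRing k] {Y : CubicalSet.{u}}
    (p : Submodule k (⨁ n, Y.NChains k n)) (h : ∀ n (y : Y.cubes n), totalCell k y ∈ p)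
    (a : ⨁ n, Y.NChains k n) : a ∈ p := by
  have : p.mkQ = 0 := total_hom_ext fun n y => by
    rw [LinearMap.zero_apply, Submodule.mkQ_apply, Submodule.Quotient.mk_eq_zero]
    exact h n y
  rw [← Submodule.Quotient.mk_eq_zero, ← Submodule.mkQ_apply, this, LinearMap.zero_apply]

/-- A bilinear map takes values in a submodule if it does so on pairs of cubes. -/
theorem CubicalSet.mem_of_totalCell_mem₂ {k : Type v} [CommRing k] {Y : CubicalSet.{u}}
    {V : Type w} [AddCommGroup V] [Module k V]
    (f : (⨁ n, Y.NChains k n) →ₗ[k] (⨁ n, Y.NChains k n) →ₗ[k] V) (p : Submodule k V)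
    (h : ∀ m n (y : Y.cubes m) (z : Y.cubes n), f (totalCell k y) (totalCell k z) ∈ p)
    (a b : ⨁ n, Y.NChains k n) : f a b ∈ p :=
  mem_of_totalCell_mem (p.comap (f.flip b)) (fun m y =>
    mem_of_totalCell_mem (p.comap (f (totalCell k y))) (fun n z => h m n y z) b) a

namespace CubicalMonoid

variable {Y : CubicalSet.{u}} (M : CubicalMonoid Y) (k : Type v) [CommRing k]

theorem chainD_triangChain_cell {n : ℕ} (y : Y.cubes (n + 1)) :
    Y.triang.chainD k n (Y.triangChain k (n + 1) (CubicalSet.cell k y)) =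
      Y.triangChain k n (∑ i : Fin (n + 1), (-1 : ℤ) ^ ((i : ℕ) + 1) •
        (CubicalSet.cell k (Y.pull (Cube.face 0 i) y) -
          CubicalSet.cell k (Y.pull (Cube.face 1 i) y))) := by
  rw [CubicalSet.triangChain_cell, SingularCube.chainD_chain, map_sum]
  refine Finset.sum_congr rfl fun i _ => ?_
  rw [map_zsmul, map_sub, CubicalSet.triangChain_cell, CubicalSet.triangChain_cell,
    CubicalSet.singular_pull, CubicalSet.singular_pull]
  rfl

theorem chainMul_triangChain_totalCell {p q : ℕ} (y : Y.cubes p) (z : Y.cubes q) :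
    M.triangMonoid.chainMul k (DirectSum.lmap (Y.triangChain k) (CubicalSet.totalCell k y))
      (DirectSum.lmap (Y.triangChain k) (CubicalSet.totalCell k z)) =
    DirectSum.lmap (Y.triangChain k) (CubicalSet.totalCell k (M.mul y z)) := by
  simp only [CubicalSet.lmap_triangChain_totalCell]
  rw [SimplicialMonoid.chainMul_totalChain, CubicalSet.cubeMul_singular]

theorem lmap_triangChain_one :
    DirectSum.lmap (Y.triangChain k) (CubicalSet.totalCell k M.one) =
      M.triangMonoid.chainOne k := by
  rw [CubicalSet.lmap_triangChain_totalCell, SimplicialMonoid.chainOne]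
  refine SingularCube.totalChain_congr rfl _ _ fun m s s' _ => ?_
  refine CubicalSet.triang_mk_congr rfl fun _ _ i => i.elim0

theorem chainComul_triangChain_totalCell {n : ℕ} (y : Y.cubes n) :
    SSet.chainComul Y.triang k
      (DirectSum.lmap (Y.triangChain k) (CubicalSet.totalCell k y)) =
    TensorProduct.map (DirectSum.lmap (Y.triangChain k)) (DirectSum.lmap (Y.triangChain k))
      (∑ α : Finset (Fin n), shuffleSign α •
        (CubicalSet.totalCell k (Y.pull (Cube.incl α 0) y) ⊗ₜ[k]
          CubicalSet.totalCell k (Y.pull (Cube.incl αᶜ 1) y))) := by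
  rw [CubicalSet.lmap_triangChain_totalCell, SingularCube.chainComul_totalChain, map_sum]
  refine Finset.sum_congr rfl fun α _ => ?_
  rw [map_zsmul, TensorProduct.map_tmul, CubicalSet.lmap_triangChain_totalCell,
    CubicalSet.lmap_triangChain_totalCell, CubicalSet.singular_pull, CubicalSet.singular_pull]
  rfl

/-- The normalized chains on a cubical monoid as a retract of those on its triangulation. -/
noncomputable def retractData :
    (M.triangMonoid.chainBialgebra k).RetractData (Y.NChains k) where
  f := Y.triangChain k
  g := Y.cubicalChain k
  g_f := Y.cubicalChain_triangChain k
  d_mem n a := by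
    suffices h : ∀ a, Y.triang.chainD k n (Y.triangChain k (n + 1) a) ∈
        LinearMap.range (Y.triangChain k n) from h a
    intro a
    refine FreeQuotient.mem_of_gen_mem ((LinearMap.range (Y.triangChain k n)).comap
      (Y.triang.chainD k n ∘ₗ Y.triangChain k (n + 1))) (fun y => ?_) a
    exact ⟨_, (chainD_triangChain_cell k y).symm⟩
  mul_mem a b := CubicalSet.mem_of_totalCell_mem₂
    ((M.triangMonoid.chainMul k).compl₁₂ (DirectSum.lmap (Y.triangChain k))
      (DirectSum.lmap (Y.triangChain k))) (LinearMap.range (DirectSum.lmap (Y.triangChain k)))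
    (fun _ _ y z => ⟨_, (M.chainMul_triangChain_totalCell k y z).symm⟩) a b
  one_mem := ⟨_, M.lmap_triangChain_one k⟩
  comul_mem a := CubicalSet.mem_of_totalCell_mem
    ((LinearMap.range (TensorProduct.map (DirectSum.lmap (Y.triangChain k))
      (DirectSum.lmap (Y.triangChain k)))).comap
      (SSet.chainComul Y.triang k ∘ₗ DirectSum.lmap (Y.triangChain k)))
    (fun _ y => ⟨_, (chainComul_triangChain_totalCell k y).symm⟩) a

/-- The dg bialgebra of normalized chains of a cubical monoid. -/
noncomputable def chainBialgebra : DGBialgebra k (Y.NChains k) := (M.retractData k).bialgebra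

/-- The map of dg bialgebras from the chains of a cubical monoid to those of its triangulation. -/
noncomputable def triangHom :
    DGBialgebra.Hom (M.chainBialgebra k) (M.triangMonoid.chainBialgebra k) :=
  (M.retractData k).hom

theorem chainBialgebra_d {n : ℕ} (y : Y.cubes (n + 1)) :
    (M.chainBialgebra k).d n (CubicalSet.cell k y) = ∑ i : Fin (n + 1), (-1 : ℤ) ^ ((i : ℕ) + 1) •
      (CubicalSet.cell k (Y.pull (Cube.face 0 i) y) -
        CubicalSet.cell k (Y.pull (Cube.face 1 i) y)) := by
  refine Function.LeftInverse.injective (Y.cubicalChain_triangChain k n) ?_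
  exact ((M.retractData k).f_d n _).trans (chainD_triangChain_cell k y)

theorem chainBialgebra_mul {p q : ℕ} (y : Y.cubes p) (z : Y.cubes q) :
    (M.chainBialgebra k).mul (CubicalSet.totalCell k y) (CubicalSet.totalCell k z) =
      CubicalSet.totalCell k (M.mul y z) :=
  (M.retractData k).F_injective <|
    ((M.retractData k).F_mul _ _).trans (M.chainMul_triangChain_totalCell k y z)

theorem chainBialgebra_one : (M.chainBialgebra k).one = CubicalSet.totalCell k M.one :=
  (M.retractData k).F_injective <| (M.retractData k).F_one.trans (M.lmap_triangChain_one k).symm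

theorem chainBialgebra_comul {n : ℕ} (y : Y.cubes n) :
    (M.chainBialgebra k).comul (CubicalSet.totalCell k y) =
      ∑ α : Finset (Fin n), shuffleSign α •
        (CubicalSet.totalCell k (Y.pull (Cube.incl α 0) y) ⊗ₜ[k]
          CubicalSet.totalCell k (Y.pull (Cube.incl αᶜ 1) y)) :=
  (M.retractData k).eq_of_F_tensor <|
    ((M.retractData k).F_comul _).trans (chainComul_triangChain_totalCell k y)

theorem chainBialgebra_counit (y : Y.cubes 0) :
    (M.chainBialgebra k).counit (CubicalSet.totalCell k y) = 1 := by
  have h : (M.chainBialgebra k).counit (CubicalSet.totalCell k y) = SSet.chainCounit Y.triang k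
      (DirectSum.lmap (Y.triangChain k) (CubicalSet.totalCell k y)) := rfl
  rw [h, CubicalSet.lmap_triangChain_totalCell, SingularCube.chainCounit_totalChain, if_pos rfl]

theorem isChainBialgebra_chainBialgebra : M.IsChainBialgebra (k := k)
    (M.chainBialgebra k : DGBialgebra k (Y.Chains k)) where
  d_apply _ y := M.chainBialgebra_d k y
  mul_apply _ _ y z := M.chainBialgebra_mul k y z
  one_eq := M.chainBialgebra_one k
  comul_apply _ y := M.chainBialgebra_comul k y
  counit_apply y := M.chainBialgebra_counit k y

end CubicalMonoid

/-! ### The Alexander-Whitney map on simplicial cubes -/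

theorem extendZero_face {m : ℕ} (ε : Fin 2) (i : Fin (m + 1)) (t : Fin m → Fin 2) :
    extendZero (CubeMap.face ε i t) = insertAt ε i (extendZero t) := by
  funext a
  by_cases ha : a < m + 1
  · obtain ⟨a, rfl⟩ : ∃ b : Fin (m + 1), (b : ℕ) = a := ⟨⟨a, ha⟩, rfl⟩
    rw [extendZero_val]
    rcases eq_or_ne a i with rfl | hne
    · simp [CubeMap.face, insertAt]
    · obtain ⟨j, rfl⟩ := Fin.exists_succAbove_eq hne
      have h1 : CubeMap.face ε i t (i.succAbove j) = t j := Fin.insertNth_apply_succAbove _ _ _ _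
      rw [h1, insertAt, CubeMap.val_succAbove]
      split_ifs <;> first | omega | exact (extendZero_val t j).symm
  · have hi := i.2
    rw [insertAt, extendZero, dif_neg ha, if_neg (by omega), if_neg (by omega), extendZero,
      dif_neg (by omega)]

namespace CubeSimplex

theorem path_comp_succAbove {n m : ℕ} (s : CubeSimplex n (m + 1)) (j : Fin (m + 2)) {v : ℕ}
    (hv : v ≤ m) : path (s.comp j.succAboveOrderEmb.toOrderHom) v = s.path (SSet.skip j v) := by
  refine congrArg s (Fin.ext ?_)
  refine (CubeMap.val_succAbove j _).trans ?_
  simp only [SSet.skip_apply]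
  split_ifs <;> omega

/-- The Alexander-Whitney map turns the boundary of cubes into the boundary of simplices. -/
theorem faceSum_boundary {n m : ℕ} {V : Type*} [AddCommGroup V] (s : CubeSimplex n (m + 1))
    (Ψ : ((Fin m → Fin 2) → Fin n → Fin 2) → V) :
    (faceSum s fun g => ∑ i : Fin (m + 1), (-1 : ℤ) ^ ((i : ℕ) + 1) •
      (Ψ (g ∘ CubeMap.face 0 i) - Ψ (g ∘ CubeMap.face 1 i))) =
    ∑ j : Fin (m + 2), (-1 : ℤ) ^ (j : ℕ) •
      faceSum (s.comp j.succAboveOrderEmb.toOrderHom) Ψ := by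
  have h1 := pathSum_faceBoundary (m := m) s.path_monotone (c := 0) (N := m + 2) (by omega)
    fun w => Ψ (faceParam m w)
  rw [Finset.sum_range] at h1
  refine Eq.trans ?_ (h1.trans (Finset.sum_congr rfl fun j _ => ?_))
  · refine pathSum_congr s.path_monotone 0 fun w hw _ => ?_
    have h2 := sum_insertAt_faceMap w fun G => Ψ fun t : Fin m → Fin 2 => G (extendZero t)
    rw [show faceDim w = m + 1 by omega, Finset.sum_range] at h2
    refine Eq.trans (Finset.sum_congr rfl fun i _ => ?_) h2
    have h3 (ε : Fin 2) : faceParam (m + 1) w ∘ CubeMap.face ε i =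
        fun t => faceMap w (insertAt ε i (extendZero t)) :=
      funext fun t => congrArg (faceMap w) (extendZero_face ε i t)
    rw [h3, h3]
  · rw [Nat.zero_add]
    exact congrArg _ (pathSum_path_congr (fun v hv => (path_comp_succAbove s j hv).symm) 0
      fun w => Ψ (faceParam m w))

/-- The Alexander-Whitney map of a vertex is that vertex. -/
theorem faceSum_vertex {n : ℕ} {V : Type*} [AddCommGroup V] (s : CubeSimplex n 0)
    (Ψ : ((Fin 0 → Fin 2) → Fin n → Fin 2) → V) : faceSum s Ψ = Ψ fun _ => s 0 := by
  have h : ∀ {n : ℕ} (p : ℕ → Fin n → Fin 2) (ψ : (Fin n → Fin 3) → V),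
      pathSum 0 p 0 ψ = ψ fun i => endpoint (p 0 i) := by
    intro n
    induction n with
    | zero =>
      intro p ψ
      rw [pathSum_zero, if_pos rfl]
      exact congrArg ψ (Subsingleton.elim _ _)
    | succ n ih =>
      intro p ψ
      rw [pathSum_succ, pathSum_eq_zero_of_lt (c := 0 + 1) _ (by omega), ite_self, add_zero, ih]
      congr 1
      funext i
      refine Fin.cases rfl (fun i => rfl) i
  rw [faceSum, h]
  congr 1
  funext t i
  rw [faceParam, faceMap_apply, cellEval_endpoint]
  exact congrFun (s.path_val 0) i

end CubeSimplex

namespace SingularCube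

variable {X : SSet.{u}} {n m : ℕ} (k : Type v) [CommRing k]

open Classical in
/-- The chain carried by the composition of a singular cube with a map of cubes, the value being `0`
if that map is not monotone. -/
noncomputable def faceChain (c : SingularCube X n) (g : (Fin m → Fin 2) → Fin n → Fin 2) :
    X.NChains k m :=
  if h : Monotone g then (c.comp ⟨g, h⟩).chain k else 0

theorem faceChain_of (c : SingularCube X n) {g : (Fin m → Fin 2) → Fin n → Fin 2}
    (h : Monotone g) : c.faceChain k g = (c.comp ⟨g, h⟩).chain k := dif_pos h

theorem faceChain_eq_zero (c : SingularCube X n) {g : (Fin m → Fin 2) → Fin n → Fin 2}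
    (hg : IsNegligibleMap g) : c.faceChain k g = 0 := by
  by_cases h : Monotone g
  · rw [faceChain_of k c h]
    revert h
    refine IsNegligibleMap.induction (P := fun m g => ∀ h : Monotone g,
      (c.comp ⟨g, h⟩).chain k = 0) ?_ ?_ hg
    · intro m g i hg h
      have : (⟨g, h⟩ : (Fin (m + 1) → Fin 2) →o (Fin n → Fin 2)) =
          (OrderHom.comp ⟨g, h⟩ (faceHom 0 i)).comp (Cube.toOrderHom (Cube.degen i)) :=
        OrderHom.ext _ _ hg
      rw [this, ← comp_comp, chain_comp_degen]
    · intro m g i hg h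
      have : (⟨g, h⟩ : (Fin (m + 2) → Fin 2) →o (Fin n → Fin 2)) =
          (OrderHom.comp ⟨g, h⟩ (faceHom 1 i.castSucc)).comp (Cube.toOrderHom (Cube.conn i)) :=
        OrderHom.ext _ _ hg
      rw [this, ← comp_comp, chain_comp_conn]
  · exact dif_neg h

theorem chainD_faceChain (c : SingularCube X n) {g : (Fin (m + 1) → Fin 2) → Fin n → Fin 2}
    (hg : Monotone g) : X.chainD k m (c.faceChain k g) =
      ∑ i : Fin (m + 1), (-1 : ℤ) ^ ((i : ℕ) + 1) •
        (c.faceChain k (g ∘ CubeMap.face 0 i) - c.faceChain k (g ∘ CubeMap.face 1 i)) := by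
  rw [faceChain_of k c hg, chainD_chain]
  refine Finset.sum_congr rfl fun i _ => ?_
  have h (ε : Fin 2) : Monotone (g ∘ CubeMap.face ε i) := hg.comp (faceHom ε i).monotone
  rw [faceChain_of k c (h 0), faceChain_of k c (h 1)]
  rfl

end SingularCube

/-- The simplicial cube `𝕀^n`. -/
def cubeSSet (n : ℕ) : SSet.{0} where
  obj m := CubeSimplex n m.unop.len
  map θ := ↾fun s => s.comp θ.unop.toOrderHom
  map_id _ := rfl
  map_comp _ _ := rfl

namespace cubeSSet

variable {n : ℕ}

theorem exists_eq_of_mem_degenerate {m : ℕ} {s : CubeSimplex n m}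
    (hs : s ∈ (cubeSSet n).degenerate m) : ∃ i : Fin m, s i.castSucc = s i.succ := by
  obtain _ | m := m
  · exact absurd hs SSet.not_mem_degenerate_zero
  · obtain ⟨i, y, rfl⟩ := SSet.exists_restrict_of_mem_degenerate hs
    have h : i.predAboveOrderHom i.castSucc = i.predAboveOrderHom i.succ := by simp
    exact ⟨i, congrArg (DFunLike.coe (F := CubeSimplex n m) y) h⟩

variable (n) in
/-- The tautological singular cube. -/
def tautological : SingularCube (cubeSSet n) n where
  toFun s := s
  toFun_comp _ _ := rfl

/-- The class of a simplex of a cube in the normalized chains. -/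
noncomputable abbrev cell (k : Type v) [CommRing k] {m : ℕ} (s : CubeSimplex n m) :
    (cubeSSet n).NChains k m := SSet.cell (X := cubeSSet n) k s

end cubeSSet

namespace SingularCube

variable {X : SSet.{u}} {n m : ℕ} (k : Type v) [CommRing k]

/-- The map of normalized chains induced by a singular cube. -/
noncomputable def pushChain (c : SingularCube X n) (m : ℕ) :
    (cubeSSet n).NChains k m →ₗ[k] X.NChains k m :=
  SSet.chainLift (fun s : CubeSimplex n m => SSet.cell k (c.toFun s)) fun s hs => by
    obtain ⟨i, hi⟩ := cubeSSet.exists_eq_of_mem_degenerate hs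
    exact SSet.cell_eq_zero (c.toFun_mem_degenerate s fun h =>
      i.castSucc_lt_succ.ne (h hi))

theorem pushChain_cell (c : SingularCube X n) (s : CubeSimplex n m) :
    c.pushChain k m (cubeSSet.cell k s) = SSet.cell k (c.toFun s) := SSet.chainLift_cell _ _ _

theorem pushChain_chain (c : SingularCube X n) (f : (Fin m → Fin 2) →o (Fin n → Fin 2)) :
    c.pushChain k m (((cubeSSet.tautological n).comp f).chain k) = (c.comp f).chain k := by
  rw [chain, map_sum]
  refine Finset.sum_congr rfl fun π _ => ?_
  rw [map_zsmul]
  exact congrArg _ (c.pushChain_cell k _)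

theorem pushChain_faceChain (c : SingularCube X n) {l : ℕ} (f : (Fin l → Fin 2) →o (Fin n → Fin 2))
    {g : (Fin m → Fin 2) → Fin l → Fin 2} (hg : Monotone g) :
    (c.comp f).pushChain k m ((cubeSSet.tautological l).faceChain k g) =
      c.faceChain k (f ∘ g) := by
  rw [faceChain_of k _ hg, pushChain_chain, faceChain_of k c (f.monotone.comp hg)]
  rfl

theorem chainD_pushChain (c : SingularCube X n) (a : (cubeSSet n).NChains k (m + 1)) :
    X.chainD k m (c.pushChain k (m + 1) a) = c.pushChain k m ((cubeSSet n).chainD k m a) := by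
  suffices h : X.chainD k m ∘ₗ c.pushChain k (m + 1) =
      c.pushChain k m ∘ₗ (cubeSSet n).chainD k m from LinearMap.congr_fun h a
  refine SSet.chain_hom_ext fun s => ?_
  rw [LinearMap.comp_apply, LinearMap.comp_apply, SSet.chainD_cell, map_sum]
  refine (congrArg _ (c.pushChain_cell k s)).trans ((SSet.chainD_cell k _).trans ?_)
  refine Finset.sum_congr rfl fun i _ => ?_
  rw [map_zsmul]
  refine congrArg _ (Eq.trans ?_ (c.pushChain_cell k _).symm)
  exact congrArg _ (c.toFun_comp s _).symm

theorem pushChain_comp (c : SingularCube X n) {l : ℕ} (f : (Fin l → Fin 2) →o (Fin n → Fin 2))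
    (a : (cubeSSet l).NChains k m) : (c.comp f).pushChain k m a =
      c.pushChain k m (((cubeSSet.tautological n).comp f).pushChain k m a) := by
  suffices h : (c.comp f).pushChain k m =
      c.pushChain k m ∘ₗ ((cubeSSet.tautological n).comp f).pushChain k m from
    LinearMap.congr_fun h a
  refine SSet.chain_hom_ext fun s => ?_
  refine ((c.comp f).pushChain_cell k s).trans ?_
  rw [LinearMap.comp_apply]
  refine Eq.trans ?_ (congrArg _ (pushChain_cell k _ s).symm)
  exact (c.pushChain_cell k _).symm

end SingularCube

/-! ### The contracting homotopy of the simplicial cubes -/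

namespace cubeSSet

variable {n m : ℕ} (k : Type v) [CommRing k]

theorem chainD_cell (s : CubeSimplex n (m + 1)) : (cubeSSet n).chainD k m (cell k s) =
    ∑ j : Fin (m + 2), (-1 : ℤ) ^ (j : ℕ) •
      cell k (OrderHom.comp s j.succAboveOrderEmb.toOrderHom : CubeSimplex n m) :=
  SSet.chainD_cell k _

variable (n m) in
/-- The endomorphism of the chains of a simplicial cube which is the Alexander-Whitney map, followed
by the triangulation of cubes. -/
noncomputable def awChain : (cubeSSet n).NChains k m →ₗ[k] (cubeSSet n).NChains k m :=
  SSet.chainLift (fun s : CubeSimplex n m => s.faceSum ((tautological n).faceChain k))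
    fun s hs => by
      obtain ⟨i, hi⟩ := exists_eq_of_mem_degenerate hs
      exact CubeSimplex.faceSum_eq_zero hi _

theorem awChain_cell (s : CubeSimplex n m) :
    awChain n m k (cell k s) = s.faceSum ((tautological n).faceChain k) :=
  SSet.chainLift_cell _ _ _

theorem chainD_awChain (a : (cubeSSet n).NChains k (m + 1)) :
    (cubeSSet n).chainD k m (awChain n (m + 1) k a) =
      awChain n m k ((cubeSSet n).chainD k m a) := by
  suffices h : (cubeSSet n).chainD k m ∘ₗ awChain n (m + 1) k =
      awChain n m k ∘ₗ (cubeSSet n).chainD k m from LinearMap.congr_fun h a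
  refine SSet.chain_hom_ext fun (s : CubeSimplex n (m + 1)) => ?_
  change (cubeSSet n).chainD k m (awChain n (m + 1) k (cell k s)) =
    awChain n m k ((cubeSSet n).chainD k m (cell k s))
  rw [awChain_cell, chainD_cell, map_sum]
  refine (CubeSimplex.map_faceSum ((cubeSSet n).chainD k m).toAddMonoidHom s _).trans ?_
  refine (CubeSimplex.faceSum_congr fun g hg _ =>
    (tautological n).chainD_faceChain k hg.monotone).trans ?_
  rw [CubeSimplex.faceSum_boundary]
  refine Finset.sum_congr rfl fun j _ => ?_
  rw [map_zsmul, awChain_cell]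

theorem awChain_zero (a : (cubeSSet n).NChains k 0) : awChain n 0 k a = a := by
  suffices h : awChain n 0 k = LinearMap.id from LinearMap.congr_fun h a
  refine SSet.chain_hom_ext fun (s : CubeSimplex n 0) => ?_
  refine (awChain_cell k s).trans ?_
  rw [CubeSimplex.faceSum_vertex, SingularCube.faceChain_of k _ monotone_const,
    SingularCube.chain, Fintype.sum_unique]
  have h1 : Equiv.Perm.sign (default : Equiv.Perm (Fin 0)) = 1 := Equiv.Perm.sign_one
  rw [h1, Units.val_one, one_zsmul]
  refine congrArg (cell k) (OrderHom.ext _ _ (funext fun v => ?_))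
  exact congrArg s (Subsingleton.elim (α := Fin 1) 0 v)

/-- The map of chains induced by a monotone map of cubes. -/
noncomputable abbrev pushChain {n' : ℕ} (f : (Fin n → Fin 2) →o (Fin n' → Fin 2)) (m : ℕ) :
    (cubeSSet n).NChains k m →ₗ[k] (cubeSSet n').NChains k m :=
  ((tautological n').comp f).pushChain k m

theorem pushChain_cell {n' : ℕ} (f : (Fin n → Fin 2) →o (Fin n' → Fin 2)) (s : CubeSimplex n m) :
    pushChain k f m (cell k s) = cell k (f.comp s : CubeSimplex n' m) :=
  SingularCube.pushChain_cell k _ s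

theorem awChain_pushChain {n' : ℕ} (l : (⟨n⟩ : Cube) ⟶ ⟨n'⟩)
    (a : (cubeSSet n).NChains k m) :
    awChain n' m k (pushChain k (Cube.toOrderHom l) m a) =
      pushChain k (Cube.toOrderHom l) m (awChain n m k a) := by
  suffices h : awChain n' m k ∘ₗ pushChain k (Cube.toOrderHom l) m =
      pushChain k (Cube.toOrderHom l) m ∘ₗ awChain n m k from LinearMap.congr_fun h a
  refine SSet.chain_hom_ext fun (s : CubeSimplex n m) => ?_
  change awChain n' m k (pushChain k (Cube.toOrderHom l) m (cell k s)) =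
      pushChain k (Cube.toOrderHom l) m (awChain n m k (cell k s))
  rw [pushChain_cell, awChain_cell, awChain_cell]
  refine (CubeSimplex.faceSum_push l s _ fun g hg =>
    (tautological n').faceChain_eq_zero k hg).trans ?_
  refine Eq.trans ?_ (CubeSimplex.map_faceSum
    (pushChain k (Cube.toOrderHom l) m).toAddMonoidHom s _).symm
  refine CubeSimplex.faceSum_congr fun g hg _ => ?_
  exact ((tautological n').pushChain_faceChain k (Cube.toOrderHom l) hg.monotone).symm

/-- The monotone map `x ↦ a ∨ x`. -/
def supHom (a : Fin n → Fin 2) : (Fin n → Fin 2) →o (Fin n → Fin 2) :=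
  ⟨fun x => a ⊔ x, fun _ _ h => sup_le_sup_left h a⟩

theorem pushChain_supHom_awChain (s : CubeSimplex n m) :
    pushChain k (supHom (s 0)) m (awChain n m k (cell k s)) =
      awChain n m k (cell k s) := by
  rw [awChain_cell]
  refine (CubeSimplex.map_faceSum (pushChain k (supHom (s 0)) m).toAddMonoidHom s _).trans ?_
  refine CubeSimplex.faceSum_congr fun g hg hs => ?_
  refine ((tautological n).pushChain_faceChain k _ hg.monotone).trans ?_
  congr 1
  exact funext fun t => sup_of_le_right (hs t)

/-- The cone over a simplex of the cube with apex `a`, the simplex being moved above `a` first. -/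
def coneSimplex (a : Fin n → Fin 2) (s : CubeSimplex n m) : CubeSimplex n (m + 1) where
  toFun := Fin.cons a fun v => a ⊔ s v
  monotone' := by
    refine Fin.monotone_iff_le_succ.2 fun i => ?_
    refine Fin.cases ?_ (fun i => ?_) i
    · exact le_sup_left
    · exact sup_le_sup_left (s.monotone i.castSucc_lt_succ.le) a

theorem coneSimplex_succ (a : Fin n → Fin 2) (s : CubeSimplex n m) (v : Fin (m + 1)) :
    coneSimplex a s v.succ = a ⊔ s v := rfl

/-- The cone of chains with apex `a`. -/
noncomputable def coneChain (a : Fin n → Fin 2) (m : ℕ) :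
    (cubeSSet n).NChains k m →ₗ[k] (cubeSSet n).NChains k (m + 1) :=
  SSet.chainLift (fun s : CubeSimplex n m => cell k (coneSimplex a s)) fun s hs => by
    obtain ⟨i, hi⟩ := exists_eq_of_mem_degenerate hs
    refine SSet.cell_eq_zero ((tautological n).toFun_mem_degenerate (coneSimplex a s) fun h => ?_)
    have : i.castSucc.succ = i.succ.succ := h (congrArg (a ⊔ ·) hi)
    exact i.castSucc_lt_succ.ne (Fin.succ_injective _ this)

theorem coneChain_cell (a : Fin n → Fin 2) (s : CubeSimplex n m) :
    coneChain k a m (cell k s) = cell k (coneSimplex a s) := SSet.chainLift_cell _ _ _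

/-- The cone is a homotopy between the retraction onto the part of the cube above the apex and the
projection to the apex, which vanishes in positive degrees. -/
theorem chainD_coneChain (a : Fin n → Fin 2) (z : (cubeSSet n).NChains k (m + 1)) :
    (cubeSSet n).chainD k (m + 1) (coneChain k a (m + 1) z) =
      pushChain k (supHom a) (m + 1) z - coneChain k a m ((cubeSSet n).chainD k m z) := by
  suffices h : (cubeSSet n).chainD k (m + 1) ∘ₗ coneChain k a (m + 1) =
      pushChain k (supHom a) (m + 1) - coneChain k a m ∘ₗ (cubeSSet n).chainD k m from
    LinearMap.congr_fun h z
  refine SSet.chain_hom_ext fun (s : CubeSimplex n (m + 1)) => ?_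
  change (cubeSSet n).chainD k (m + 1) (coneChain k a (m + 1) (cell k s)) =
      pushChain k (supHom a) (m + 1) (cell k s) -
        coneChain k a m ((cubeSSet n).chainD k m (cell k s))
  rw [coneChain_cell, chainD_cell, chainD_cell, pushChain_cell, map_sum, Fin.sum_univ_succ,
    sub_eq_add_neg, ← Finset.sum_neg_distrib]
  congr 1
  · rw [Fin.val_zero, pow_zero, one_zsmul]
    refine congrArg (cell k) (OrderHom.ext _ _ (funext fun v => ?_))
    change coneSimplex a s (Fin.succAbove 0 v) = a ⊔ s v
    rw [Fin.succAbove_zero, coneSimplex_succ]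
  · refine Finset.sum_congr rfl fun j _ => ?_
    rw [map_zsmul, coneChain_cell, ← neg_smul, Fin.val_succ, pow_succ, mul_neg_one]
    congr 2
    refine OrderHom.ext _ _ (funext fun v => ?_)
    change coneSimplex a s (j.succ.succAbove v) = coneSimplex a _ v
    refine Fin.cases ?_ (fun v => ?_) v
    · rw [Fin.succ_succAbove_zero]
      rfl
    · rw [Fin.succ_succAbove_succ]
      rfl

/-- A cone with apex `b` lies above every vertex `a ≤ b`. A chain lying above `a` is encoded as
being fixed by `pushChain k (supHom a)`. -/
theorem pushChain_supHom_coneChain {a b : Fin n → Fin 2} (h : a ≤ b)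
    (z : (cubeSSet n).NChains k m) :
    pushChain k (supHom a) (m + 1) (coneChain k b m z) = coneChain k b m z := by
  suffices h : pushChain k (supHom a) (m + 1) ∘ₗ coneChain k b m = coneChain k b m from
    LinearMap.congr_fun h z
  refine SSet.chain_hom_ext fun (s : CubeSimplex n m) => ?_
  change pushChain k (supHom a) (m + 1) (coneChain k b m (cell k s)) = coneChain k b m (cell k s)
  rw [coneChain_cell, pushChain_cell]
  refine congrArg (cell k) (OrderHom.ext _ _ (funext fun v => ?_))
  change a ⊔ coneSimplex b s v = coneSimplex b s v
  refine Fin.cases ?_ (fun v => ?_) v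
  · exact sup_of_le_right h
  · exact sup_of_le_right (h.trans le_sup_left)

/-- Cones are natural for arbitrary monotone maps of cubes, which need not preserve suprema, if the
chain lies above the apex. -/
theorem pushChain_coneChain {n' : ℕ} (f : (Fin n → Fin 2) →o (Fin n' → Fin 2)) (a : Fin n → Fin 2)
    {z : (cubeSSet n).NChains k m} (hz : pushChain k (supHom a) m z = z) :
    pushChain k f (m + 1) (coneChain k a m z) = coneChain k (f a) m (pushChain k f m z) := by
  suffices h : pushChain k f (m + 1) ∘ₗ coneChain k a m =
      coneChain k (f a) m ∘ₗ pushChain k f m ∘ₗ pushChain k (supHom a) m by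
    have := LinearMap.congr_fun h z
    rwa [LinearMap.comp_apply, LinearMap.comp_apply, LinearMap.comp_apply, hz] at this
  refine SSet.chain_hom_ext fun (s : CubeSimplex n m) => ?_
  change pushChain k f (m + 1) (coneChain k a m (cell k s)) =
    coneChain k (f a) m (pushChain k f m (pushChain k (supHom a) m (cell k s)))
  rw [coneChain_cell, pushChain_cell, pushChain_cell, pushChain_cell, coneChain_cell]
  refine congrArg (cell k) (OrderHom.ext _ _ (funext fun v => ?_))
  change f (coneSimplex a s v) = coneSimplex (f a) _ v
  refine Fin.cases rfl (fun v => ?_) v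
  exact (sup_of_le_right (f.monotone le_sup_left)).symm

variable (n) in
/-- A homotopy from the identity to `awChain`. On a simplex it is the cone, with apex the first
vertex, over the difference which has to be a boundary. -/
noncomputable def homotopy :
    ∀ m, (cubeSSet n).NChains k m →ₗ[k] (cubeSSet n).NChains k (m + 1)
  | 0 => 0
  | m + 1 => SSet.chainLift (fun s : CubeSimplex n (m + 1) => coneChain k (s 0) (m + 1)
      (cell k s - awChain n (m + 1) k (cell k s) -
        homotopy m ((cubeSSet n).chainD k m (cell k s)))) fun s hs => by
      have : cell k (show CubeSimplex n (m + 1) from s) = 0 := SSet.cell_eq_zero hs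
      simp only [this, map_zero, sub_zero]

theorem homotopy_cell (s : CubeSimplex n (m + 1)) : homotopy n k (m + 1) (cell k s) =
    coneChain k (s 0) (m + 1) (cell k s - awChain n (m + 1) k (cell k s) -
      homotopy n k m ((cubeSSet n).chainD k m (cell k s))) := SSet.chainLift_cell _ _ _

theorem pushChain_supHom_homotopy (s : CubeSimplex n m) {a : Fin n → Fin 2} (h : a ≤ s 0) :
    pushChain k (supHom a) (m + 1) (homotopy n k m (cell k s)) = homotopy n k m (cell k s) := by
  cases m with
  | zero => exact map_zero _
  | succ m => rw [homotopy_cell, pushChain_supHom_coneChain k h]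

/-- The chain whose cone defines the homotopy on a simplex lies above the first vertex. -/
theorem pushChain_supHom_homotopy_base (s : CubeSimplex n (m + 1)) :
    pushChain k (supHom (s 0)) (m + 1) (cell k s - awChain n (m + 1) k (cell k s) -
      homotopy n k m ((cubeSSet n).chainD k m (cell k s))) =
    cell k s - awChain n (m + 1) k (cell k s) -
      homotopy n k m ((cubeSSet n).chainD k m (cell k s)) := by
  have h1 : pushChain k (supHom (s 0)) (m + 1) (cell k s) = cell k s := by
    rw [pushChain_cell]
    refine congrArg (cell k) (OrderHom.ext _ _ (funext fun v => ?_))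
    exact sup_of_le_right (s.monotone (Fin.zero_le v))
  have h2 : pushChain k (supHom (s 0)) (m + 1)
      (homotopy n k m ((cubeSSet n).chainD k m (cell k s))) =
      homotopy n k m ((cubeSSet n).chainD k m (cell k s)) := by
    rw [chainD_cell, map_sum, map_sum]
    refine Finset.sum_congr rfl fun j _ => ?_
    rw [map_zsmul, map_zsmul, pushChain_supHom_homotopy]
    exact s.monotone (Fin.zero_le _)
  rw [map_sub, map_sub, pushChain_supHom_awChain, h1, h2]

theorem chainD_homotopy (m : ℕ) (a : (cubeSSet n).NChains k (m + 1)) :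
    (cubeSSet n).chainD k (m + 1) (homotopy n k (m + 1) a) +
      homotopy n k m ((cubeSSet n).chainD k m a) = a - awChain n (m + 1) k a := by
  induction m with
  | zero =>
    suffices h : (cubeSSet n).chainD k 1 ∘ₗ homotopy n k 1 +
        homotopy n k 0 ∘ₗ (cubeSSet n).chainD k 0 = LinearMap.id - awChain n 1 k from
      LinearMap.congr_fun h a
    refine SSet.chain_hom_ext fun (s : CubeSimplex n 1) => ?_
    change (cubeSSet n).chainD k 1 (homotopy n k 1 (cell k s)) +
        homotopy n k 0 ((cubeSSet n).chainD k 0 (cell k s)) =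
      cell k s - awChain n 1 k (cell k s)
    have h0 (b : (cubeSSet n).NChains k 0) : homotopy n k 0 b = 0 := rfl
    have hD : (cubeSSet n).chainD k 0 (cell k s - awChain n 1 k (cell k s)) = 0 := by
      rw [map_sub, chainD_awChain, awChain_zero, sub_self]
    rw [homotopy_cell, chainD_coneChain, pushChain_supHom_homotopy_base, h0, sub_zero, hD,
      map_zero, sub_zero, add_zero]
  | succ m ih =>
    suffices h : (cubeSSet n).chainD k (m + 2) ∘ₗ homotopy n k (m + 2) +
        homotopy n k (m + 1) ∘ₗ (cubeSSet n).chainD k (m + 1) =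
        LinearMap.id - awChain n (m + 2) k from LinearMap.congr_fun h a
    refine SSet.chain_hom_ext fun (s : CubeSimplex n (m + 2)) => ?_
    change (cubeSSet n).chainD k (m + 2) (homotopy n k (m + 2) (cell k s)) +
        homotopy n k (m + 1) ((cubeSSet n).chainD k (m + 1) (cell k s)) =
      cell k s - awChain n (m + 2) k (cell k s)
    have h1 := ih ((cubeSSet n).chainD k (m + 1) (cell k s))
    have h2 : (cubeSSet n).chainD k m ((cubeSSet n).chainD k (m + 1) (cell k s)) = 0 :=
      LinearMap.congr_fun (SSet.chainD_comp_chainD k m) _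
    rw [h2, map_zero, add_zero] at h1
    -- The chain to be coned off is a cycle.
    have hD : (cubeSSet n).chainD k (m + 1) (cell k s - awChain n (m + 2) k (cell k s) -
        homotopy n k (m + 1) ((cubeSSet n).chainD k (m + 1) (cell k s))) = 0 := by
      rw [map_sub, map_sub, chainD_awChain, h1, sub_self]
    rw [homotopy_cell, chainD_coneChain, pushChain_supHom_homotopy_base, hD, map_zero, sub_zero,
      sub_add_cancel]

/-- The homotopy is natural for the morphisms of the cube category. -/
theorem homotopy_pushChain {n' : ℕ} (l : (⟨n⟩ : Cube) ⟶ ⟨n'⟩) (m : ℕ)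
    (a : (cubeSSet n).NChains k m) :
    homotopy n' k m (pushChain k (Cube.toOrderHom l) m a) =
      pushChain k (Cube.toOrderHom l) (m + 1) (homotopy n k m a) := by
  induction m with
  | zero => exact (map_zero _).symm
  | succ m ih =>
    suffices h : homotopy n' k (m + 1) ∘ₗ pushChain k (Cube.toOrderHom l) (m + 1) =
        pushChain k (Cube.toOrderHom l) (m + 2) ∘ₗ homotopy n k (m + 1) from
      LinearMap.congr_fun h a
    refine SSet.chain_hom_ext fun (s : CubeSimplex n (m + 1)) => ?_
    change homotopy n' k (m + 1) (pushChain k (Cube.toOrderHom l) (m + 1) (cell k s)) =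
      pushChain k (Cube.toOrderHom l) (m + 2) (homotopy n k (m + 1) (cell k s))
    have h : pushChain k (Cube.toOrderHom l) (m + 1) (cell k s -
        awChain n (m + 1) k (cell k s) -
        homotopy n k m ((cubeSSet n).chainD k m (cell k s))) =
        pushChain k (Cube.toOrderHom l) (m + 1) (cell k s) -
          awChain n' (m + 1) k (pushChain k (Cube.toOrderHom l) (m + 1) (cell k s)) -
          homotopy n' k m ((cubeSSet n').chainD k m
            (pushChain k (Cube.toOrderHom l) (m + 1) (cell k s))) := by
      rw [map_sub, map_sub, awChain_pushChain, SingularCube.chainD_pushChain, ih]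
    rw [homotopy_cell, pushChain_coneChain k _ _ (pushChain_supHom_homotopy_base k s), h,
      pushChain_cell, homotopy_cell]
    rfl

end cubeSSet

/-! ### The homotopy equivalence -/

namespace DGBialgebra.RetractData

variable {k : Type v} [CommRing k] {A B : ℕ → Type w} [∀ n, AddCommGroup (A n)]
  [∀ n, Module k (A n)] [∀ n, AddCommGroup (B n)] [∀ n, Module k (B n)]
  {T : DGBialgebra k B} (R : T.RetractData A)

theorem _root_.DGBialgebra.complex_d (S : DGBialgebra k A) (n : ℕ) :
    S.complex.d (n + 1) n = ModuleCat.ofHom (S.d n) := by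
  simp only [complex, ChainComplex.of_d]

/-- If the retraction is homotopic to the identity, it is a chain map. -/
theorem g_d {H : ∀ n, B n →ₗ[k] B (n + 1)}
    (h0 : ∀ b, T.d 0 (H 0 b) = b - R.f 0 (R.g 0 b))
    (hs : ∀ n b, T.d (n + 1) (H (n + 1) b) + H n (T.d n b) =
      b - R.f (n + 1) (R.g (n + 1) b)) (n : ℕ) (b : B (n + 1)) :
    R.g n (T.d n b) = R.d n (R.g (n + 1) b) := by
  have hdd (n : ℕ) (c : B (n + 2)) : T.d n (T.d (n + 1) c) = 0 :=
    LinearMap.congr_fun (T.d_comp_d n) c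
  have h1 : T.d n (H n (T.d n b)) = T.d n b - R.f n (R.g n (T.d n b)) := by
    cases n with
    | zero => exact h0 _
    | succ n => simpa only [hdd, map_zero, add_zero] using hs n (T.d (n + 1) b)
  have h2 := congrArg (T.d n) (hs n b)
  rw [map_add, map_sub, hdd, zero_add, h1, ← R.f_d] at h2
  have h3 := congrArg (R.g n) (sub_right_injective h2)
  rwa [R.g_f, R.g_f] at h3

/-- If the retraction is homotopic to the identity, the inclusion is a quasi-isomorphism. -/
theorem quasiIso_hom (H : ∀ n, B n →ₗ[k] B (n + 1))
    (h0 : ∀ b, T.d 0 (H 0 b) = b - R.f 0 (R.g 0 b))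
    (hs : ∀ n b, T.d (n + 1) (H (n + 1) b) + H n (T.d n b) =
      b - R.f (n + 1) (R.g (n + 1) b)) : QuasiIso R.hom.chainMap := by
  let G : T.complex ⟶ R.bialgebra.complex :=
    ChainComplex.ofHom (fun n => ModuleCat.ofHom (R.g n)) fun n => by
      simp only [complex, ChainComplex.of_d, ← ModuleCat.ofHom_comp]
      exact congrArg ModuleCat.ofHom (LinearMap.ext fun b => (R.g_d h0 hs n b).symm)
  let h : ∀ i j, (ComplexShape.down ℕ).Rel j i → (T.complex.X i ⟶ T.complex.X j) :=
    fun i _ r => r ▸ ModuleCat.ofHom (H i)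
  have e1 : R.hom.chainMap ≫ G = 𝟙 _ := by
    ext n : 1
    exact ModuleCat.hom_ext (LinearMap.ext fun a => R.g_f n a)
  have e2 : 𝟙 _ - G ≫ R.hom.chainMap = Homotopy.nullHomotopicMap' h := by
    ext n : 1
    cases n with
    | zero =>
      rw [Homotopy.nullHomotopicMap'_f_of_not_rel_left (k₁ := 1) (k₀ := 0) rfl
        (fun l hl => Nat.succ_ne_zero l hl), complex_d]
      exact ModuleCat.hom_ext (LinearMap.ext fun b => (h0 b).symm)
    | succ n =>
      rw [Homotopy.nullHomotopicMap'_f (k₂ := n + 2) (k₁ := n + 1) (k₀ := n) rfl rfl, complex_d,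
        complex_d]
      exact ModuleCat.hom_ext (LinearMap.ext fun b => ((add_comm _ _).trans (hs n b)).symm)
  let e : HomotopyEquiv R.bialgebra.complex T.complex :=
    { hom := R.hom.chainMap
      inv := G
      homotopyHomInvId := Homotopy.ofEq e1
      homotopyInvHomId := ((Homotopy.equivSubZero).symm
        ((Homotopy.ofEq e2).trans (Homotopy.nullHomotopy' h))).symm }
  exact e.quasiIso_hom

end DGBialgebra.RetractData

namespace CubicalSet

variable {Y : CubicalSet.{u}} (k : Type v) [CommRing k]

theorem pushChain_singular_pull {n n' m : ℕ} (l : (⟨n⟩ : Cube) ⟶ ⟨n'⟩) (y : Y.cubes n')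
    (a : (cubeSSet n).NChains k m) : (singular (Y.pull l y)).pushChain k m a =
      (singular y).pushChain k m (cubeSSet.pushChain k (Cube.toOrderHom l) m a) := by
  rw [singular_pull, SingularCube.pushChain_comp]

/-- On the simplices given by a single cube, the retraction followed by `t_Y` is the image of the
endomorphism `awChain` of the chains of the simplicial cube. -/
theorem triangChain_cubicalChain_cell {n m : ℕ} (y : Y.cubes n) (s : CubeSimplex n m) :
    Y.triangChain k m (Y.cubicalChain k m (SSet.cell k (Y.simplex y s))) =
      (singular y).pushChain k m (cubeSSet.awChain n m k (cubeSSet.cell k s)) := by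
  rw [cubicalChain_cell, cubeSSet.awChain_cell]
  refine (CubeSimplex.map_faceSum (Y.triangChain k m).toAddMonoidHom s _).trans
    (Eq.trans ?_ (CubeSimplex.map_faceSum ((singular y).pushChain k m).toAddMonoidHom s _).symm)
  refine CubeSimplex.faceSum_congr fun g hg _ => ?_
  change Y.triangChain k m (faceCell k y g) =
    (singular y).pushChain k m ((cubeSSet.tautological n).faceChain k g)
  rw [faceCell_of k y hg, triangChain_cell, singular_pull,
    SingularCube.faceChain_of k _ hg.monotone, SingularCube.pushChain_chain]
  rfl

variable (Y) in
/-- The homotopy on the chains of a triangulation induced by that on the simplicial cubes. -/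
noncomputable def triangHomotopy (m : ℕ) : Y.triang.NChains k m →ₗ[k] Y.triang.NChains k (m + 1) :=
  SSet.chainLift (Quot.lift (fun a => (singular a.2.1).pushChain k (m + 1)
    (cubeSSet.homotopy a.1 k m (cubeSSet.cell k a.2.2))) (by
      rintro _ _ ⟨l, y, s⟩
      dsimp only
      rw [pushChain_singular_pull, ← cubeSSet.homotopy_pushChain, cubeSSet.pushChain_cell]
      rfl)) (by
    intro x hx
    obtain _ | m := m
    · exact absurd hx SSet.not_mem_degenerate_zero
    · obtain ⟨n, y, s, i, hi, rfl⟩ := exists_simplex_of_mem_degenerate hx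
      have h : cubeSSet.cell k s = 0 :=
        SSet.cell_eq_zero ((cubeSSet.tautological n).toFun_mem_degenerate s fun h =>
          i.castSucc_lt_succ.ne (h hi))
      change (singular y).pushChain k (m + 2)
        (cubeSSet.homotopy n k (m + 1) (cubeSSet.cell k s)) = 0
      rw [h, map_zero, map_zero])

theorem triangHomotopy_cell {n m : ℕ} (y : Y.cubes n) (s : CubeSimplex n m) :
    Y.triangHomotopy k m (SSet.cell k (Y.simplex y s)) = (singular y).pushChain k (m + 1)
      (cubeSSet.homotopy n k m (cubeSSet.cell k s)) := SSet.chainLift_cell _ _ _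

theorem triangHomotopy_pushChain {n m : ℕ} (y : Y.cubes n) (a : (cubeSSet n).NChains k m) :
    Y.triangHomotopy k m ((singular y).pushChain k m a) =
      (singular y).pushChain k (m + 1) (cubeSSet.homotopy n k m a) := by
  suffices h : Y.triangHomotopy k m ∘ₗ (singular y).pushChain k m =
      (singular y).pushChain k (m + 1) ∘ₗ cubeSSet.homotopy n k m from LinearMap.congr_fun h a
  refine SSet.chain_hom_ext fun (s : CubeSimplex n m) => ?_
  refine (congrArg _ ((singular y).pushChain_cell k s)).trans ?_
  exact triangHomotopy_cell k y s

theorem chainD_triangHomotopy_zero (a : Y.triang.NChains k 0) :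
    Y.triang.chainD k 0 (Y.triangHomotopy k 0 a) =
      a - Y.triangChain k 0 (Y.cubicalChain k 0 a) := by
  suffices h : Y.triang.chainD k 0 ∘ₗ Y.triangHomotopy k 0 =
      LinearMap.id - Y.triangChain k 0 ∘ₗ Y.cubicalChain k 0 from LinearMap.congr_fun h a
  refine SSet.chain_hom_ext fun x => ?_
  induction x using Quot.ind with | mk a
  obtain ⟨n, y, s⟩ := a
  change Y.triang.chainD k 0 (Y.triangHomotopy k 0 (SSet.cell k (Y.simplex y s))) =
    SSet.cell k (Y.simplex y s) -
      Y.triangChain k 0 (Y.cubicalChain k 0 (SSet.cell k (Y.simplex y s)))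
  rw [triangChain_cubicalChain_cell, cubeSSet.awChain_zero, triangHomotopy_cell,
    SingularCube.pushChain_cell]
  have h : cubeSSet.homotopy n k 0 (cubeSSet.cell k s) = 0 := rfl
  rw [h, map_zero, map_zero]
  exact (sub_self _).symm

theorem chainD_triangHomotopy_succ (m : ℕ) (a : Y.triang.NChains k (m + 1)) :
    Y.triang.chainD k (m + 1) (Y.triangHomotopy k (m + 1) a) +
      Y.triangHomotopy k m (Y.triang.chainD k m a) =
      a - Y.triangChain k (m + 1) (Y.cubicalChain k (m + 1) a) := by
  suffices h : Y.triang.chainD k (m + 1) ∘ₗ Y.triangHomotopy k (m + 1) +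
      Y.triangHomotopy k m ∘ₗ Y.triang.chainD k m =
      LinearMap.id - Y.triangChain k (m + 1) ∘ₗ Y.cubicalChain k (m + 1) from
    LinearMap.congr_fun h a
  refine SSet.chain_hom_ext fun x => ?_
  induction x using Quot.ind with | mk a
  obtain ⟨n, y, s⟩ := a
  have h1 : SSet.cell k (Y.simplex y s) =
      (singular y).pushChain k (m + 1) (cubeSSet.cell k s) :=
    ((singular y).pushChain_cell k s).symm
  change Y.triang.chainD k (m + 1) (Y.triangHomotopy k (m + 1) (SSet.cell k (Y.simplex y s))) +
    Y.triangHomotopy k m (Y.triang.chainD k m (SSet.cell k (Y.simplex y s))) =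
    SSet.cell k (Y.simplex y s) -
      Y.triangChain k (m + 1) (Y.cubicalChain k (m + 1) (SSet.cell k (Y.simplex y s)))
  rw [triangChain_cubicalChain_cell, h1, triangHomotopy_pushChain,
    SingularCube.chainD_pushChain, SingularCube.chainD_pushChain, triangHomotopy_pushChain,
    ← map_add, cubeSSet.chainD_homotopy, map_sub]

end CubicalSet

theorem CubicalMonoid.quasiIso_triangHom {Y : CubicalSet.{u}} (M : CubicalMonoid Y) (k : Type v)
    [CommRing k] : QuasiIso (M.triangHom k).chainMap :=
  (M.retractData k).quasiIso_hom (Y.triangHomotopy k) (CubicalSet.chainD_triangHomotopy_zero k)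
    (CubicalSet.chainD_triangHomotopy_succ k)

theorem mainTheorem5 (k : Type v) [CommRing k] (Y : CubicalSet.{u}) (M : CubicalMonoid Y) :
    ∃ G : SimplicialMonoid Y.triang,
      (∀ (p q m : ℕ) (y : Y.cubes p) (z : Y.cubes q) (s : CubeSimplex p m) (t : CubeSimplex q m),
        G.mul (Y.simplex y s) (Y.simplex z t) =
          Y.simplex (M.mul y z) (CubeSimplex.pair s t)) ∧
      (M.IsGroup → G.IsGroup) ∧
      ∃ (S : DGBialgebra k (Y.Chains k)) (T : DGBialgebra k (Y.triang.NormalizedChains k)),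
        M.IsChainBialgebra S ∧ G.IsChainBialgebra T ∧
        ∃ φ : DGBialgebra.Hom S T,
          (∀ (n : ℕ) (y : Y.cubes n), φ.f n (Y.chain k y) =
            ∑ π : Equiv.Perm (Fin n), (Equiv.Perm.sign π : ℤ) •
              Y.triang.chain k (Y.simplex y (CubeSimplex.ofPerm π))) ∧
          QuasiIso φ.chainMap :=
  ⟨M.triangMonoid, fun _ _ _ => M.triangMonoid_mul_simplex, M.triangMonoid_isGroup,
    M.chainBialgebra k, M.triangMonoid.chainBialgebra k, M.isChainBialgebra_chainBialgebra k,
    M.triangMonoid.isChainBialgebra_chainBialgebra k, M.triangHom k,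
    fun _ y => Y.triangChain_cell k y, M.quasiIso_triangHom k⟩
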